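/- Let $\mathbb{T}=\mathbb{R}/2\pi\mathbb{Z}$; all functions and distributions on $\mathbb{T}$ are real-valued. For $s\in\mathbb{R}$ and $1\le p\le\infty$ let $$\mathcal{F}L^{s,p}(\mathbb{T})=\{f\in\mathcal{D}'(\mathbb{T}):\ \|f\|_{\mathcal{F}L^{s,p}}:=\|\langle n\rangle^{s}\hat f(n)\|_{\ell^p(\mathbb{Z})}<\infty\},\qquad \langle n\rangle=(1+n^2)^{1/2},\quad \hat f(n)=\tfrac1{2\pi}\langle f,e^{-inx}\rangle,$$ and let $B(0,R)$ be the ball of radius $R$ centred at $0$ in $\mathcal{F}L^{s,p}(\mathbb{T})$. Consider the mKdV equation $$\partial_t u+\partial_x^3u+u^2\partial_xu=0,\qquad u(\cdot,0)=u_0,\qquad x\in\mathbb{T}.$$ Suppose $s\ge 1/2$, $1\le p\le\infty$ and $p'(s+\tfrac14)>1$, where $\tfrac1p+\tfrac1{p'}=1$. Then for every $R>0$ there is $T>0$ such that for every $c>0$ the following holds. For every smooth $u_0\in B(0,R)$ with $\|u_0\|_{L^2(\mathbb{T})}=c$ the mKdV equation has a unique smooth solution on $\mathbb{T}\times[0,T]$,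 and the resulting solution map $\widetilde W:u_0\mapsto u$ for smooth initial data extends to a uniformly continuous map $$B(0,R)\cap\{\varphi:\ \|\varphi\|_{L^2(\mathbb{T})}=c\}\subset\mathcal{F}L^{s,p}(\mathbb{T})\ \longrightarrow\ C([0,T],\mathcal{F}L^{s,p}(\mathbb{T})).$$ -/

import Mathlib

open scoped ContDiff ENNReal
open MeasureTheory

noncomputable section

namespace MKdV

/-- `C^∞(𝕋)`, `𝕋 = ℝ / 2πℤ`: the real-valued smooth `2π`-periodic functions. -/
def SmoothPeriodic : Submodule ℝ (ℝ → ℝ) where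
  carrier := {ψ | ContDiff ℝ ∞ ψ ∧ Function.Periodic ψ (2 * Real.pi)}
  add_mem' := fun ha hb => ⟨ha.1.add hb.1, ha.2.add hb.2⟩
  zero_mem' := ⟨contDiff_const, fun _ => rfl⟩
  smul_mem' := fun c _ ha => ⟨contDiff_const.smul ha.1, fun x => by
    simp only [Pi.smul_apply]; rw [ha.2 x]⟩

/-- The linear functionals on `C^∞(𝕋)` that are continuous for the `C^∞` topology, i.e. bounded
by a multiple of some `C^N` norm. -/
def distrSubmodule : Submodule ℝ (SmoothPeriodic →ₗ[ℝ] ℝ) where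
  carrier := {f | ∃ (N : ℕ) (C : ℝ), ∀ (ψ : SmoothPeriodic) (M : ℝ),
    (∀ k ≤ N, ∀ x, |iteratedDeriv k (ψ : ℝ → ℝ) x| ≤ M) → |f ψ| ≤ C * M}
  add_mem' := by
    rintro f g ⟨N, C, hf⟩ ⟨N', C', hg⟩
    refine ⟨max N N', C + C', fun ψ M h => ?_⟩
    have h1 := hf ψ M fun k hk => h k (hk.trans (le_max_left _ _))
    have h2 := hg ψ M fun k hk => h k (hk.trans (le_max_right _ _))
    rw [LinearMap.add_apply, add_mul]
    exact (abs_add_le _ _).trans (add_le_add h1 h2)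
  zero_mem' := ⟨0, 0, fun ψ M _ => by simp⟩
  smul_mem' := by
    rintro c f ⟨N, C, hf⟩
    refine ⟨N, |c| * C, fun ψ M h => ?_⟩
    rw [LinearMap.smul_apply, smul_eq_mul, abs_mul, mul_assoc]
    exact mul_le_mul_of_nonneg_left (hf ψ M h) (abs_nonneg c)

/-- `D'(𝕋)`: the real-valued distributions on `𝕋`. -/
def Distr : Type := ↥distrSubmodule

instance : AddCommGroup Distr :=
  Submodule.addCommGroup distrSubmodule

instance : Module ℝ Distr :=
  Submodule.module distrSubmodule

/-- The pairing `⟨f, ψ⟩`, linear in the distribution `f` and in the test function `ψ`. -/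
def Distr.pair : Distr →ₗ[ℝ] SmoothPeriodic →ₗ[ℝ] ℝ :=
  distrSubmodule.subtype

/-- The test function `x ↦ cos (n x)`. -/
def cosTest (n : ℤ) : SmoothPeriodic :=
  ⟨fun x => Real.cos (n * x),
    Real.contDiff_cos.comp (contDiff_const.mul contDiff_id), fun x => by
      simp only [mul_add, Real.cos_add_int_mul_two_pi]⟩

/-- The test function `x ↦ sin (n x)`. -/
def sinTest (n : ℤ) : SmoothPeriodic :=
  ⟨fun x => Real.sin (n * x),
    Real.contDiff_sin.comp (contDiff_const.mul contDiff_id), fun x => by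
      simp only [mul_add, Real.sin_add_int_mul_two_pi]⟩

/-- Fourier coefficients `f̂(n) = (2π)⁻¹ ⟨f, e^{-inx}⟩`,
where `e^{-inx} = cos (n x) - i sin (n x)`. -/
def fourierCoef (f : Distr) (n : ℤ) : ℂ :=
  (2 * Real.pi : ℂ)⁻¹ *
    ((f.pair (cosTest n) : ℂ) - Complex.I * (f.pair (sinTest n) : ℂ))

/-- The weighted coefficients `⟨n⟩^s f̂(n)`, where `⟨n⟩ = (1 + n²)^{1/2}`. -/
def weightedCoef (s : ℝ) : Distr →ₗ[ℝ] (ℤ → ℂ) where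
  toFun f n := ((Real.sqrt (1 + (n : ℝ) ^ 2) ^ s : ℝ) : ℂ) * fourierCoef f n
  map_add' f g := by
    funext n
    simp only [fourierCoef, map_add, LinearMap.add_apply, Pi.add_apply,
      Complex.ofReal_add]
    ring
  map_smul' c f := by
    funext n
    simp only [fourierCoef, map_smul, LinearMap.smul_apply, Pi.smul_apply,
      smul_eq_mul, Complex.ofReal_mul, RingHom.id_apply, Complex.real_smul]
    ring

/-- `FL^{s,p}(𝕋)`, the real-valued distributions `f` with `⟨·⟩^s f̂ ∈ ℓ^p`, as a subspace. -/
def FLSubmodule (s : ℝ) (p : ℝ≥0∞) : Submodule ℝ Distr where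
  carrier := {f | Memℓp (weightedCoef s f) p}
  add_mem' := fun ha hb => by
    simp only [Set.mem_ofPred_eq, map_add] at *
    exact ha.add hb
  zero_mem' := by
    simp only [Set.mem_ofPred_eq, map_zero]
    exact zero_memℓp
  smul_mem' := fun c f hf => by
    simp only [Set.mem_ofPred_eq, map_smul] at *
    exact hf.const_smul c

/-- The space `FL^{s,p}(𝕋)`. -/
def FL (s : ℝ) (p : ℝ≥0∞) : Type := ↥(FLSubmodule s p)

instance (s : ℝ) (p : ℝ≥0∞) : AddCommGroup (FL s p) :=
  Submodule.addCommGroup (FLSubmodule s p)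

/-- The distribution underlying an element of `FL^{s,p}(𝕋)`. -/
def FL.toDistr {s : ℝ} {p : ℝ≥0∞} (f : FL s p) : Distr := f.1

/-- The map `f ↦ ⟨·⟩^s f̂` from `FL^{s,p}(𝕋)` to `ℓ^p(ℤ)`. -/
def FL.toLp (s : ℝ) (p : ℝ≥0∞) : FL s p →+ lp (fun _ : ℤ => ℂ) p where
  toFun f := ⟨weightedCoef s f.1, f.2⟩
  map_zero' := Subtype.ext (map_zero (weightedCoef s))
  map_add' f g := Subtype.ext (map_add (weightedCoef s) f.1 g.1)

/-- `‖f‖_{FL^{s,p}} = ‖⟨·⟩^s f̂‖_{ℓ^p}`, with the metric, topology and uniformity it induces. -/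
instance (s : ℝ) (p : ℝ≥0∞) [Fact (1 ≤ p)] : SeminormedAddCommGroup (FL s p) :=
  SeminormedAddCommGroup.induced (FL s p) (lp (fun _ : ℤ => ℂ) p) (FL.toLp s p)

/-- The distribution `f` is the function `g`: `⟨f, ψ⟩ = ∫_𝕋 g ψ dx` for all test functions.
Used only for `g` square integrable over a period. -/
def IsFunction (f : Distr) (g : ℝ → ℝ) : Prop :=
  ∀ ψ : SmoothPeriodic, f.pair ψ = ∫ x in (0 : ℝ)..(2 * Real.pi), g x * (ψ : ℝ → ℝ) x

/-- `f ∈ L²(𝕋)` and `‖f‖_{L²(𝕋)} = c`. -/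
def HasL2Norm (f : Distr) (c : ℝ) : Prop :=
  ∃ g : ℝ → ℝ, MemLp g 2 (volume.restrict (Set.Ioc 0 (2 * Real.pi))) ∧ IsFunction f g ∧
    eLpNorm g 2 (volume.restrict (Set.Ioc 0 (2 * Real.pi))) = ENNReal.ofReal c

/-- `u = u(x, t)` is a smooth real-valued solution on `𝕋 × [0, T]` of the mKdV equation
`∂ₜu + ∂ₓ³u + u² ∂ₓu = 0` with `u(·, 0) = φ` (time derivatives at `t = 0, T` are one-sided). -/
structure IsSmoothSolution (T : ℝ) (φ : ℝ → ℝ) (u : ℝ → ℝ → ℝ) : Prop where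
  smooth : ContDiffOn ℝ ∞ (fun z : ℝ × ℝ => u z.1 z.2) (Set.univ ×ˢ Set.Icc 0 T)
  periodic : ∀ t ∈ Set.Icc 0 T, Function.Periodic (fun x => u x t) (2 * Real.pi)
  initial : ∀ x, u x 0 = φ x
  equation : ∀ x, ∀ t ∈ Set.Icc 0 T,
    derivWithin (fun τ => u x τ) (Set.Icc 0 T) t + iteratedDeriv 3 (fun y => u y t) x
      + u x t ^ 2 * deriv (fun y => u y t) x = 0

/-- The curve `v` in `FL^{s,p}(𝕋)` is the value at `φ` of the smooth solution map of mKdV on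
`[0, T]`: there is a smooth solution with datum `φ`, and `v(t) = u(·, t)` on `[0, T]` for that and
for every other smooth solution `u` with datum `φ`. -/
def IsSolutionMapValue {s : ℝ} {p : ℝ≥0∞} (T : ℝ) (φ : ℝ → ℝ)
    (v : Set.Icc (0 : ℝ) T → FL s p) : Prop :=
  (∃ u, IsSmoothSolution T φ u) ∧
    ∀ u, IsSmoothSolution T φ u → ∀ t, IsFunction (v t).toDistr (fun x => u x t)

end MKdV

end

/-! In Fourier variables mKdV reads d_n' = i n³ d_n - (i n/3) Σ_{a+b+c=n} d_a d_b d_c. For n ≠ 0,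
the triples in which two frequencies cancel contribute -i n M d_n + i n d_n² d_{-n}, where M = Σ d_k
d_{-k} = ‖u‖²_{L²}/2π. M is conserved, so on the sphere ‖u₀‖_{L²} = c it is a fixed number m.
Writing d_n = e^{i(n³-nm)t} a_n gives a_n' = i n a_n² a_{-n} - (i n/3) Σ e^{iφt} a_a a_b a_c, summed
over nonresonant triples, with φ = -3(a+b)(b+c)(a+c) ≠ 0. This profile equation does not contain c,
hence T depends on R alone. Solutions on one sphere carry the same phase, so Lipschitz dependence of
the profile on the data passes to u; this is what fixing the L² norm is for.

The profile equation is solved by contraction in a weighted ℓ^p space of 1/2-Hölder functions of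
time, in the role usually played by Bourgain spaces. Integrating a 1/2-Hölder function against
e^{iφσ} over [s,t] costs O(|φ|^{-1/2}|t-s|^{1/2}), so the Duhamel integral is again 1/2-Hölder, each
nonresonant interaction gains |φ|^{-1/2}, and a small factor √δ appears
(`Holder.norm_duhamel_le_of_ne_zero`).

What remains is a trilinear estimate for the multiplier |n| |(a+b)(b+c)(a+c)|^{-1/2}
(`exists_trilinear_le`). The largest frequency is kept in ℓ^p and the other two are placed in
FL^{1/2,q} with q < 4. Schur's test and Hölder's inequality reduce the estimate to sums of
(⟨α⟩⟨β⟩⟨γ⟩)^{-q'/2} over two free integers, which converge because q' > 4/3. The condition p'(s+1/4)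
> 1, that is s > 3/4 - 1/p, provides the embedding into FL^{1/2,q}; s ≥ 1/2 also controls the
resonant term n a_n² a_{-n}.

All constants are uniform over submultiplicative weights. With (1+ε|n|)^k and ε small, smooth data
still have norm at most R, so the profile decays rapidly on the same time interval
(`exists_mild_solution`). For such profiles conservation of M is proved afterwards
(`IsMild.tsum_gauge_eq`), the Fourier series is a classical solution (`IsFlow.isSmoothSolution`),
and an L² energy estimate gives uniqueness (`IsSmoothSolution.eq_on_period`).

For p = ∞ smooth data are not dense, and the flow of general data need not be continuous in time.
The data are first sent by a Lipschitz retraction, the identity on rapidly decreasing sequences, to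
the closure of the finitely supported ones (`exists_retraction`). -/

noncomputable section

/-! ### Hölder functions of time and the gain from oscillation -/

namespace MKdV

/-! ### Bounded `1/2`-Hölder functions of time -/

/-- The bounded `1/2`-Hölder functions `a : ℝ → ℂ`, represented by their values and by their
difference quotients `√δ (a t - a s) / √|t - s|`; the norm is
`max (sup |a|) (√δ [a]_{1/2})`. -/
def holderSubmodule (δ : ℝ) : Submodule ℂ (lp (fun _ : ℝ ⊕ ℝ × ℝ => ℂ) ∞) where
  carrier := {g | ∀ s t : ℝ, g (Sum.inr (s, t)) =
    ((Real.sqrt δ / Real.sqrt |t - s| : ℝ) : ℂ) * (g (Sum.inl t) - g (Sum.inl s))}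
  add_mem' := fun {a b} ha hb s t => by
    have h1 := ha s t
    have h2 := hb s t
    simp only [lp.coeFn_add, Pi.add_apply, h1, h2]
    ring
  zero_mem' := fun s t => by simp
  smul_mem' := fun c a ha s t => by
    have h1 := ha s t
    simp only [lp.coeFn_smul, Pi.smul_apply, h1, smul_eq_mul]
    ring

/-- The Banach space of bounded `1/2`-Hölder functions. -/
def Holder (δ : ℝ) : Type := holderSubmodule δ

instance (δ : ℝ) : NormedAddCommGroup (Holder δ) :=
  Submodule.normedAddCommGroup (holderSubmodule δ)

instance (δ : ℝ) : NormedSpace ℂ (Holder δ) :=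
  Submodule.normedSpace (holderSubmodule δ)

/-- The defining relations involve finitely many coordinates each, and coordinates are continuous on
ℓ^∞. Closedness supplies the completeness used by the contraction. -/
theorem isClosed_holderSubmodule (δ : ℝ) :
    IsClosed (holderSubmodule δ : Set (lp (fun _ : ℝ ⊕ ℝ × ℝ => ℂ) ∞)) := by
  have hc : ∀ i : ℝ ⊕ ℝ × ℝ, Continuous fun g : lp (fun _ : ℝ ⊕ ℝ × ℝ => ℂ) ∞ => g i :=
    fun i => (lp.lipschitzWith_one_eval ∞ i).continuous
  have : (holderSubmodule δ : Set (lp (fun _ : ℝ ⊕ ℝ × ℝ => ℂ) ∞)) =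
      ⋂ (s : ℝ) (t : ℝ), {g | g (Sum.inr (s, t)) =
    ((Real.sqrt δ / Real.sqrt |t - s| : ℝ) : ℂ) * (g (Sum.inl t) - g (Sum.inl s))} := by
    ext g
    simp [holderSubmodule]
  rw [this]
  exact isClosed_iInter fun s => isClosed_iInter fun t =>
    isClosed_eq (hc _) (continuous_const.mul ((hc _).sub (hc _)))

instance (δ : ℝ) : CompleteSpace (Holder δ) :=
  (isClosed_holderSubmodule δ).completeSpace_coe

namespace Holder

variable {δ : ℝ}

/-- The value of `a` at time `t`. -/
def eval (t : ℝ) : Holder δ →L[ℂ] ℂ :=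
  LinearMap.mkContinuous
    { toFun := fun a => a.1 (Sum.inl t)
      map_add' := fun _ _ => rfl
      map_smul' := fun _ _ => rfl } 1 fun a => by
    rw [one_mul]
    exact lp.norm_apply_le_norm (by simp) a.1 _

theorem norm_eval_le (a : Holder δ) (t : ℝ) : ‖eval t a‖ ≤ ‖a‖ :=
  lp.norm_apply_le_norm (by simp) a.1 _

theorem ext_eval {a b : Holder δ} (h : ∀ t, eval t a = eval t b) : a = b := by
  apply Subtype.ext
  apply lp.ext
  funext i
  rcases i with t | ⟨s, t⟩
  · exact h t
  · rw [a.2 s t, b.2 s t]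
    exact congrArg₂ _ rfl (congrArg₂ _ (h t) (h s))

theorem norm_eval_sub_le (a : Holder δ) (s t : ℝ) :
    Real.sqrt δ * ‖eval t a - eval s a‖ ≤ ‖a‖ * Real.sqrt |t - s| := by
  rcases eq_or_ne t s with rfl | hst
  · simp
  have h1 : ‖a.1 (Sum.inr (s, t))‖ ≤ ‖a‖ := lp.norm_apply_le_norm (by simp) a.1 _
  rw [a.2 s t, norm_mul, Complex.norm_real, Real.norm_of_nonneg (by positivity)] at h1
  have h2 : 0 < Real.sqrt |t - s| := Real.sqrt_pos.2 (abs_pos.2 (sub_ne_zero.2 hst))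
  have h3 := mul_le_mul_of_nonneg_right h1 h2.le
  calc Real.sqrt δ * ‖eval t a - eval s a‖
      = Real.sqrt δ / Real.sqrt |t - s| * ‖eval t a - eval s a‖ * Real.sqrt |t - s| := by
        field_simp
    _ ≤ _ := h3

theorem norm_le {a : Holder δ} {C : ℝ} (hC : 0 ≤ C) (h : ∀ t, ‖eval t a‖ ≤ C)
    (h' : ∀ s t, Real.sqrt δ * ‖eval t a - eval s a‖ ≤ C * Real.sqrt |t - s|) : ‖a‖ ≤ C := by
  have key : ∀ i, ‖a.1 i‖ ≤ C := by
    intro i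
    rcases i with t | ⟨s, t⟩
    · exact h t
    rw [a.2 s t, norm_mul, Complex.norm_real, Real.norm_of_nonneg (by positivity)]
    rcases eq_or_ne t s with rfl | hst
    · simpa using hC
    have h2 : 0 < Real.sqrt |t - s| := Real.sqrt_pos.2 (abs_pos.2 (sub_ne_zero.2 hst))
    rw [div_mul_eq_mul_div, div_le_iff₀ h2]
    exact h' s t
  exact lp.norm_le_of_forall_le hC key

/-- A bounded `1/2`-Hölder function as an element of `Holder δ`. -/
def mk (f : ℝ → ℂ) (C : ℝ) (h : ∀ t, ‖f t‖ ≤ C)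
    (h' : ∀ s t, Real.sqrt δ * ‖f t - f s‖ ≤ C * Real.sqrt |t - s|) : Holder δ :=
  ⟨⟨fun i => match i with
      | Sum.inl t => f t
      | Sum.inr (s, t) => ((Real.sqrt δ / Real.sqrt |t - s| : ℝ) : ℂ) * (f t - f s), by
    have hC : 0 ≤ C := (norm_nonneg _).trans (h 0)
    refine memℓp_infty ⟨C, ?_⟩
    rintro _ ⟨i, rfl⟩
    rcases i with t | ⟨s, t⟩
    · exact h t
    · simp only [norm_mul, Complex.norm_real]
      rw [Real.norm_of_nonneg (by positivity)]
      rcases eq_or_ne t s with rfl | hst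
      · simpa using hC
      have h2 : 0 < Real.sqrt |t - s| := Real.sqrt_pos.2 (abs_pos.2 (sub_ne_zero.2 hst))
      rw [div_mul_eq_mul_div, div_le_iff₀ h2]
      exact h' s t⟩, fun _ _ => rfl⟩

theorem continuous_eval (hδ : 0 < δ) (a : Holder δ) : Continuous fun t => eval t a := by
  have hs : 0 < Real.sqrt δ := Real.sqrt_pos.2 hδ
  rw [continuous_iff_continuousAt]
  intro s
  rw [ContinuousAt, tendsto_iff_norm_sub_tendsto_zero]
  have hlim : Filter.Tendsto (fun t => ‖a‖ * Real.sqrt |t - s| / Real.sqrt δ) (nhds s)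
      (nhds 0) := by
    have hcont : Continuous fun t => ‖a‖ * Real.sqrt |t - s| / Real.sqrt δ := by fun_prop
    have := hcont.tendsto s
    simpa using this
  refine squeeze_zero (fun _ => norm_nonneg _) (fun t => ?_) hlim
  rw [le_div_iff₀ hs, mul_comm]
  exact norm_eval_sub_le a s t

/-- A constant function. -/
def const (δ : ℝ) (z : ℂ) : Holder δ :=
  mk (fun _ => z) ‖z‖ (fun _ => le_rfl) fun s t => by
    simp only [sub_self, norm_zero, mul_zero]; positivity

@[simp] theorem eval_const (z : ℂ) (t : ℝ) : eval t (const δ z) = z := rfl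

theorem norm_const (z : ℂ) : ‖const δ z‖ = ‖z‖ := by
  refine le_antisymm (norm_le (norm_nonneg _) (fun _ => le_rfl) fun s t => ?_) ?_
  · simp only [eval_const, sub_self, norm_zero, mul_zero]; positivity
  · simpa using norm_eval_le (const δ z) 0

theorem const_sub (z w : ℂ) : const δ (z - w) = const δ z - const δ w :=
  ext_eval fun t => by simp

theorem norm_mul_three_le (a b c : Holder δ) (t : ℝ) :
    ‖eval t a * eval t b * eval t c‖ ≤ ‖a‖ * ‖b‖ * ‖c‖ := by
  rw [norm_mul, norm_mul]
  gcongr <;> exact norm_eval_le _ _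

/-- Leibniz: the increment of a product telescopes into three terms, one per factor, which gives the
constant 3. -/
theorem norm_mul_three_sub_le (a b c : Holder δ) (s t : ℝ) :
    Real.sqrt δ * ‖eval t a * eval t b * eval t c - eval s a * eval s b * eval s c‖ ≤
      3 * (‖a‖ * ‖b‖ * ‖c‖) * Real.sqrt |t - s| := by
  have e : eval t a * eval t b * eval t c - eval s a * eval s b * eval s c =
      (eval t a - eval s a) * (eval t b * eval t c) +
        eval s a * ((eval t b - eval s b) * eval t c) +
          eval s a * (eval s b * (eval t c - eval s c)) := by ring
  have hs : 0 ≤ Real.sqrt δ := Real.sqrt_nonneg _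
  have hr : 0 ≤ Real.sqrt |t - s| := Real.sqrt_nonneg _
  have ha := norm_eval_sub_le a s t
  have hb := norm_eval_sub_le b s t
  have hc := norm_eval_sub_le c s t
  calc _ ≤ Real.sqrt δ * (‖eval t a - eval s a‖ * (‖eval t b‖ * ‖eval t c‖) +
        ‖eval s a‖ * (‖eval t b - eval s b‖ * ‖eval t c‖) +
          ‖eval s a‖ * (‖eval s b‖ * ‖eval t c - eval s c‖)) := by
        rw [e]
        gcongr
        refine (norm_add₃_le).trans ?_
        simp only [norm_mul, le_refl]
    _ = (Real.sqrt δ * ‖eval t a - eval s a‖) * (‖eval t b‖ * ‖eval t c‖) +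
        ‖eval s a‖ * ((Real.sqrt δ * ‖eval t b - eval s b‖) * ‖eval t c‖) +
          ‖eval s a‖ * (‖eval s b‖ * (Real.sqrt δ * ‖eval t c - eval s c‖)) := by ring
    _ ≤ (‖a‖ * Real.sqrt |t - s|) * (‖b‖ * ‖c‖) +
        ‖a‖ * ((‖b‖ * Real.sqrt |t - s|) * ‖c‖) +
          ‖a‖ * (‖b‖ * (‖c‖ * Real.sqrt |t - s|)) := by
        gcongr <;> exact norm_eval_le _ _
    _ = _ := by ring

end Holder

/-! ### Oscillatory integrals -/

theorem norm_exp_mul_I (x : ℝ) : ‖Complex.exp (Complex.I * x)‖ = 1 := by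
  rw [mul_comm]; exact Complex.norm_exp_ofReal_mul_I x

/-- Shifting by half a period. -/
theorem two_mul_integral_oscillatory {g : ℝ → ℂ} (hg : Continuous g) {φ : ℝ} (hφ : φ ≠ 0)
    (s t : ℝ) :
    2 * ∫ σ in s..t, Complex.exp (Complex.I * (φ * σ : ℝ)) * g σ =
      (∫ σ in s..t, Complex.exp (Complex.I * (φ * σ : ℝ)) * (g σ - g (σ - Real.pi / φ))) +
      ((∫ σ in s..s + Real.pi / φ,
          Complex.exp (Complex.I * (φ * σ : ℝ)) * g (σ - Real.pi / φ)) -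
        ∫ σ in t..t + Real.pi / φ,
          Complex.exp (Complex.I * (φ * σ : ℝ)) * g (σ - Real.pi / φ)) := by
  set h := Real.pi / φ with hh
  have hc1 : Continuous fun σ : ℝ => Complex.exp (Complex.I * (φ * σ : ℝ)) * g σ := by fun_prop
  have hc2 : Continuous fun σ : ℝ => Complex.exp (Complex.I * (φ * σ : ℝ)) * g (σ - h) := by
    fun_prop
  have e1 : ∫ σ in s..t, Complex.exp (Complex.I * (φ * σ : ℝ)) * g σ =
      - ∫ σ in s + h..t + h, Complex.exp (Complex.I * (φ * σ : ℝ)) * g (σ - h) := by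
    rw [← intervalIntegral.integral_comp_add_right, ← intervalIntegral.integral_neg]
    refine intervalIntegral.integral_congr fun σ _ => ?_
    have : Complex.exp (Complex.I * (φ * (σ + h) : ℝ)) =
        - Complex.exp (Complex.I * (φ * σ : ℝ)) := by
      have : Complex.I * (φ * (σ + h) : ℝ) = Complex.I * (φ * σ : ℝ) + Real.pi * Complex.I := by
        have : φ * (σ + h) = φ * σ + Real.pi := by rw [hh]; field_simp
        rw [this]; push_cast; ring
      rw [this, Complex.exp_add, Complex.exp_pi_mul_I]; ring
    simp only [this, add_sub_cancel_right]; ring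
  have e2 : ∫ σ in s..t, Complex.exp (Complex.I * (φ * σ : ℝ)) * (g σ - g (σ - h)) =
      (∫ σ in s..t, Complex.exp (Complex.I * (φ * σ : ℝ)) * g σ) -
        ∫ σ in s..t, Complex.exp (Complex.I * (φ * σ : ℝ)) * g (σ - h) := by
    rw [← intervalIntegral.integral_sub (hc1.intervalIntegrable _ _)
      (hc2.intervalIntegrable _ _)]
    simp only [mul_sub]
  have e3 := intervalIntegral.integral_interval_sub_interval_comm (μ := volume)
    (f := fun σ : ℝ => Complex.exp (Complex.I * (φ * σ : ℝ)) * g (σ - h))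
    (hc2.intervalIntegrable s t) (hc2.intervalIntegrable (s + h) (t + h))
    (hc2.intervalIntegrable s (s + h))
  rw [two_mul, e2]
  nth_rewrite 2 [e1]
  linear_combination e3

/-- Let h = π/φ. If |t-s| ≤ |h|, the trivial bound M|t-s| suffices. Otherwise the half-period shift
replaces g by its increment over h, of size |h|^{1/2}, up to two boundary integrals of size M|h| ≤
M|h|^{1/2}|t-s|^{1/2}. Either way half a power of 1/|φ| is gained and half a power of |t-s| is kept.
-/
theorem norm_integral_oscillatory_le {g : ℝ → ℂ} (hg : Continuous g) {δ M φ : ℝ} (hδ : 0 < δ)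
    (h1 : ∀ t, ‖g t‖ ≤ M)
    (h2 : ∀ s t, Real.sqrt δ * ‖g t - g s‖ ≤ 3 * M * Real.sqrt |t - s|) (hφ : φ ≠ 0) {s t : ℝ}
    (hst : |t - s| ≤ 2 * δ) :
    ‖∫ σ in s..t, Complex.exp (Complex.I * (φ * σ : ℝ)) * g σ‖ ≤
      8 / Real.sqrt |φ| * M * Real.sqrt |t - s| := by
  have hM : 0 ≤ M := (norm_nonneg _).trans (h1 0)
  set h := Real.pi / φ with hh
  have hh0 : 0 < |h| := by rw [hh]; exact abs_pos.2 (div_ne_zero Real.pi_ne_zero hφ)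
  -- Here π ≤ 4; together with the factor 4 in `hmain` this gives 8.
  have hfac : Real.sqrt |h| ≤ 2 / Real.sqrt |φ| := by
    have hφ' : 0 < Real.sqrt |φ| := Real.sqrt_pos.2 (abs_pos.2 hφ)
    rw [hh, abs_div, Real.sqrt_div (abs_nonneg _), abs_of_pos Real.pi_pos]
    gcongr
    rw [Real.sqrt_le_left (by norm_num)]
    linarith [Real.pi_le_four]
  have hd : Real.sqrt |t - s| * Real.sqrt |t - s| = |t - s| := Real.mul_self_sqrt (abs_nonneg _)
  have hhd : Real.sqrt |h| * Real.sqrt |h| = |h| := Real.mul_self_sqrt (abs_nonneg _)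
  have hmain : ‖∫ σ in s..t, Complex.exp (Complex.I * (φ * σ : ℝ)) * g σ‖ ≤
      4 * Real.sqrt |h| * M * Real.sqrt |t - s| := by
    rcases le_total |t - s| |h| with hle | hle
    · have : ‖∫ σ in s..t, Complex.exp (Complex.I * (φ * σ : ℝ)) * g σ‖ ≤ M * |t - s| := by
        refine intervalIntegral.norm_integral_le_of_norm_le_const fun σ _ => ?_
        rw [norm_mul, norm_exp_mul_I, one_mul]; exact h1 σ
      have h4 : Real.sqrt |t - s| ≤ Real.sqrt |h| := Real.sqrt_le_sqrt hle
      have h5 := Real.sqrt_nonneg |t - s|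
      calc _ ≤ M * (Real.sqrt |t - s| * Real.sqrt |t - s|) := by rw [hd]; exact this
        _ ≤ M * (Real.sqrt |h| * Real.sqrt |t - s|) := by gcongr
        _ ≤ 4 * (M * (Real.sqrt |h| * Real.sqrt |t - s|)) := by
          have : 0 ≤ M * (Real.sqrt |h| * Real.sqrt |t - s|) := by positivity
          linarith
        _ = _ := by ring
    · have hs : 0 < Real.sqrt δ := Real.sqrt_pos.2 hδ
      have b1 : ‖∫ σ in s..t, Complex.exp (Complex.I * (φ * σ : ℝ)) * (g σ - g (σ - h))‖ ≤
          3 * M * Real.sqrt |h| / Real.sqrt δ * |t - s| := by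
        refine intervalIntegral.norm_integral_le_of_norm_le_const fun σ _ => ?_
        rw [norm_mul, norm_exp_mul_I, one_mul, le_div_iff₀ hs, mul_comm]
        simpa using h2 (σ - h) σ
      have b2 : ∀ r, ‖∫ σ in r..r + h, Complex.exp (Complex.I * (φ * σ : ℝ)) * g (σ - h)‖ ≤
          M * |h| := by
        intro r
        have := intervalIntegral.norm_integral_le_of_norm_le_const
          (f := fun σ : ℝ => Complex.exp (Complex.I * (φ * σ : ℝ)) * g (σ - h))
          (a := r) (b := r + h) (C := M) fun σ _ => by
            rw [norm_mul, norm_exp_mul_I, one_mul]; exact h1 _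
        simpa using this
      have key := congrArg norm (two_mul_integral_oscillatory hg hφ s t)
      rw [norm_mul] at key
      -- 3/2 is a rational majorant of √2. Twice the integral is then at most (9/2 + 1 + 1) M √|h|
      -- √|t-s|, which is below the allowed 8.
      have h4 : Real.sqrt |t - s| ≤ 3 / 2 * Real.sqrt δ := by
        rw [Real.sqrt_le_left (by positivity), mul_pow, Real.sq_sqrt hδ.le]
        linarith
      have h5 : Real.sqrt |h| ≤ Real.sqrt |t - s| := Real.sqrt_le_sqrt hle
      have b3 : 3 * M * Real.sqrt |h| / Real.sqrt δ * |t - s| ≤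
          9 / 2 * M * Real.sqrt |h| * Real.sqrt |t - s| := by
        rw [div_mul_eq_mul_div, div_le_iff₀ hs]
        calc 3 * M * Real.sqrt |h| * |t - s|
            = 3 * M * Real.sqrt |h| * (Real.sqrt |t - s| * Real.sqrt |t - s|) := by rw [hd]
          _ ≤ 3 * M * Real.sqrt |h| * (Real.sqrt |t - s| * (3 / 2 * Real.sqrt δ)) := by gcongr
          _ = _ := by ring
      have b4 : M * |h| ≤ M * Real.sqrt |h| * Real.sqrt |t - s| := by
        calc M * |h| = M * Real.sqrt |h| * Real.sqrt |h| := by rw [mul_assoc, hhd]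
          _ ≤ _ := by gcongr
      have b5 : ‖(2 : ℂ)‖ = 2 := by simp
      rw [b5] at key
      have b6 := norm_add_le
        (∫ σ in s..t, Complex.exp (Complex.I * (φ * σ : ℝ)) * (g σ - g (σ - h)))
        ((∫ σ in s..s + h, Complex.exp (Complex.I * (φ * σ : ℝ)) * g (σ - h)) -
        ∫ σ in t..t + h, Complex.exp (Complex.I * (φ * σ : ℝ)) * g (σ - h))
      have b7 := norm_sub_le
        (∫ σ in s..s + h, Complex.exp (Complex.I * (φ * σ : ℝ)) * g (σ - h))
        (∫ σ in t..t + h, Complex.exp (Complex.I * (φ * σ : ℝ)) * g (σ - h))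
      have b8 := b2 s
      have b9 := b2 t
      have b10 : 0 ≤ M * Real.sqrt |h| * Real.sqrt |t - s| := by positivity
      linarith
  refine hmain.trans ?_
  have : 4 * Real.sqrt |h| ≤ 8 / Real.sqrt |φ| := by
    calc _ ≤ 4 * (2 / Real.sqrt |φ|) := by gcongr
      _ = _ := by ring
  gcongr

/-- The bound without oscillation, for the resonant term with φ = 0; half a power of |t-s| is traded
for √δ. -/
theorem norm_integral_modulated_le {g : ℝ → ℂ} {δ M φ : ℝ} (hδ : 0 < δ)
    (h1 : ∀ t, ‖g t‖ ≤ M) {s t : ℝ} (hst : |t - s| ≤ 2 * δ) :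
    ‖∫ σ in s..t, Complex.exp (Complex.I * (φ * σ : ℝ)) * g σ‖ ≤
      2 * Real.sqrt δ * M * Real.sqrt |t - s| := by
  have hM : 0 ≤ M := (norm_nonneg _).trans (h1 0)
  have : ‖∫ σ in s..t, Complex.exp (Complex.I * (φ * σ : ℝ)) * g σ‖ ≤ M * |t - s| := by
    refine intervalIntegral.norm_integral_le_of_norm_le_const fun σ _ => ?_
    rw [norm_mul, norm_exp_mul_I, one_mul]; exact h1 σ
  have h4 : Real.sqrt |t - s| ≤ 2 * Real.sqrt δ := by
    rw [Real.sqrt_le_left (by positivity), mul_pow, Real.sq_sqrt hδ.le]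
    linarith
  calc _ ≤ M * (Real.sqrt |t - s| * Real.sqrt |t - s|) := by
        rw [Real.mul_self_sqrt (abs_nonneg _)]; exact this
    _ ≤ M * (2 * Real.sqrt δ * Real.sqrt |t - s|) := by gcongr
    _ = _ := by ring

/-- Projection of `ℝ` to `[-δ, δ]`. -/
def clamp (δ t : ℝ) : ℝ := max (-δ) (min δ t)

theorem abs_clamp_le {δ : ℝ} (hδ : 0 < δ) (t : ℝ) : |clamp δ t| ≤ δ :=
  abs_le.2 ⟨le_max_left _ _, max_le (by linarith) (min_le_left _ _)⟩

theorem abs_clamp_sub_le (δ s t : ℝ) : |clamp δ t - clamp δ s| ≤ |t - s| := by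
  have h1 := abs_max_sub_max_le_abs (min δ t) (min δ s) (-δ)
  have h2 := abs_min_sub_min_le_max δ t δ s
  simp only [sub_self, abs_zero, abs_nonneg, max_eq_right] at h2
  unfold clamp
  rw [max_comm (-δ), max_comm (-δ)]
  exact h1.trans h2

theorem clamp_of_mem {δ t : ℝ} (ht : t ∈ Set.Icc (-δ) δ) : clamp δ t = t := by
  rw [clamp, min_eq_right ht.2, max_eq_right ht.1]

/-- The trilinear Duhamel integral `∫₀ᵗ e^{iφσ} a(σ) b(σ) c(σ) dσ`, frozen outside `[-δ, δ]`. -/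
def duhamel (δ φ : ℝ) (a b c : Holder δ) (t : ℝ) : ℂ :=
  ∫ σ in (0 : ℝ)..clamp δ t, Complex.exp (Complex.I * (φ * σ : ℝ)) *
    (Holder.eval σ a * Holder.eval σ b * Holder.eval σ c)

section

variable {δ : ℝ} (hδ : 0 < δ) (φ : ℝ) (a b c : Holder δ)

theorem continuous_duhamel_integrand (hδ : 0 < δ) : Continuous fun σ : ℝ =>
    Complex.exp (Complex.I * (φ * σ : ℝ)) *
      (Holder.eval σ a * Holder.eval σ b * Holder.eval σ c) := by
  have := Holder.continuous_eval hδ a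
  have := Holder.continuous_eval hδ b
  have := Holder.continuous_eval hδ c
  fun_prop

theorem duhamel_sub (hδ : 0 < δ) (s t : ℝ) : duhamel δ φ a b c t - duhamel δ φ a b c s =
    ∫ σ in clamp δ s..clamp δ t, Complex.exp (Complex.I * (φ * σ : ℝ)) *
      (Holder.eval σ a * Holder.eval σ b * Holder.eval σ c) := by
  have h := continuous_duhamel_integrand φ a b c hδ
  exact intervalIntegral.integral_interval_sub_left (h.intervalIntegrable _ _)
    (h.intervalIntegrable _ _)

/-- The normalisation of the Hölder seminorm by √δ makes both parts of the norm produce the same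
small factor: the supremum because the endpoint is clamped to [-δ, δ], the seminorm by its
prefactor. Clamped times differ by at most 2δ, so the hypothesis is only needed there. -/
theorem norm_duhamel_bounds (hδ : 0 < δ) {κ : ℝ} (hκ : 0 ≤ κ)
    (h : ∀ s t : ℝ, |t - s| ≤ 2 * δ →
    ‖∫ σ in s..t, Complex.exp (Complex.I * (φ * σ : ℝ)) *
      (Holder.eval σ a * Holder.eval σ b * Holder.eval σ c)‖ ≤
      κ * (‖a‖ * ‖b‖ * ‖c‖) * Real.sqrt |t - s|) :
    (∀ t, ‖duhamel δ φ a b c t‖ ≤ κ * Real.sqrt δ * (‖a‖ * ‖b‖ * ‖c‖)) ∧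
    ∀ s t, Real.sqrt δ * ‖duhamel δ φ a b c t - duhamel δ φ a b c s‖ ≤
      κ * Real.sqrt δ * (‖a‖ * ‖b‖ * ‖c‖) * Real.sqrt |t - s| := by
  have hr : 0 ≤ ‖a‖ * ‖b‖ * ‖c‖ := by positivity
  constructor
  · intro t
    have h1 := abs_clamp_le hδ t
    refine (h 0 (clamp δ t) (by rw [sub_zero]; linarith)).trans ?_
    calc _ ≤ κ * (‖a‖ * ‖b‖ * ‖c‖) * Real.sqrt δ := by
          gcongr; rwa [sub_zero]
      _ = _ := by ring
  · intro s t
    rw [duhamel_sub φ a b c hδ]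
    have h1 := abs_clamp_le hδ t
    have h2 := abs_clamp_le hδ s
    have h3 := h (clamp δ s) (clamp δ t) (by
      refine (abs_sub _ _).trans ?_
      linarith)
    calc _ ≤ Real.sqrt δ * (κ * (‖a‖ * ‖b‖ * ‖c‖) * Real.sqrt |t - s|) := by
          gcongr
          refine h3.trans (mul_le_mul_of_nonneg_left ?_ (by positivity))
          exact Real.sqrt_le_sqrt (abs_clamp_sub_le δ s t)
      _ = _ := by ring

theorem duhamel_bounds (hδ : 0 < δ) :
    (∀ t, ‖duhamel δ φ a b c t‖ ≤ 2 * Real.sqrt δ * Real.sqrt δ * (‖a‖ * ‖b‖ * ‖c‖)) ∧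
    ∀ s t, Real.sqrt δ * ‖duhamel δ φ a b c t - duhamel δ φ a b c s‖ ≤
      2 * Real.sqrt δ * Real.sqrt δ * (‖a‖ * ‖b‖ * ‖c‖) * Real.sqrt |t - s| :=
  norm_duhamel_bounds φ a b c hδ (by positivity) fun _ _ hst =>
    norm_integral_modulated_le hδ (Holder.norm_mul_three_le a b c) hst

/-- The trilinear Duhamel integral as an element of `Holder δ`. -/
def Holder.duhamel : Holder δ :=
  Holder.mk (MKdV.duhamel δ φ a b c) _ (duhamel_bounds φ a b c hδ).1
    (duhamel_bounds φ a b c hδ).2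

@[simp] theorem Holder.eval_duhamel (t : ℝ) :
    Holder.eval t (Holder.duhamel hδ φ a b c) = MKdV.duhamel δ φ a b c t := rfl

theorem Holder.norm_duhamel_le :
    ‖Holder.duhamel hδ φ a b c‖ ≤ 2 * δ * (‖a‖ * ‖b‖ * ‖c‖) := by
  have h := duhamel_bounds φ a b c hδ
  rw [mul_assoc 2, Real.mul_self_sqrt hδ.le] at h
  exact Holder.norm_le (by positivity) h.1 h.2

theorem Holder.norm_duhamel_le_of_ne_zero (hφ : φ ≠ 0) :
    ‖Holder.duhamel hδ φ a b c‖ ≤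
      8 * Real.sqrt δ / Real.sqrt |φ| * (‖a‖ * ‖b‖ * ‖c‖) := by
  have h := norm_duhamel_bounds φ a b c hδ (κ := 8 / Real.sqrt |φ|) (by positivity)
    fun _ _ hst => norm_integral_oscillatory_le
      (((Holder.continuous_eval hδ a).mul (Holder.continuous_eval hδ b)).mul
        (Holder.continuous_eval hδ c)) hδ
      (Holder.norm_mul_three_le a b c) (Holder.norm_mul_three_sub_le a b c) hφ hst
  rw [div_mul_eq_mul_div] at h
  exact Holder.norm_le (by positivity) h.1 h.2

/-- The only form in which trilinearity enters the contraction argument. -/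
theorem Holder.duhamel_sub_duhamel (a' b' c' : Holder δ) :
    Holder.duhamel hδ φ a b c - Holder.duhamel hδ φ a' b' c' =
      Holder.duhamel hδ φ (a - a') b c + Holder.duhamel hδ φ a' (b - b') c +
        Holder.duhamel hδ φ a' b' (c - c') := by
  refine Holder.ext_eval fun t => ?_
  have hi : ∀ x y z : Holder δ, IntervalIntegrable (fun σ : ℝ =>
      Complex.exp (Complex.I * (φ * σ : ℝ)) *
        (Holder.eval σ x * Holder.eval σ y * Holder.eval σ z)) volume 0 (clamp δ t) :=
    fun x y z => (continuous_duhamel_integrand φ x y z hδ).intervalIntegrable _ _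
  simp only [map_sub, map_add, Holder.eval_duhamel, MKdV.duhamel]
  have hi' : ∀ x y z : Holder δ, IntervalIntegrable (fun σ : ℝ =>
      Complex.exp (Complex.I * (φ * σ : ℝ)) *
        (Holder.eval σ x * Holder.eval σ y * Holder.eval σ z)) volume 0 (clamp δ t) := hi
  have j1 := hi' (a - a') b c
  have j2 := hi' a' (b - b') c
  have j3 := hi' a' b' (c - c')
  simp only [map_sub] at j1 j2 j3
  rw [← intervalIntegral.integral_sub (hi _ _ _) (hi _ _ _),
    ← intervalIntegral.integral_add j1 j2, ← intervalIntegral.integral_add (j1.add j2) j3]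
  refine intervalIntegral.integral_congr fun σ _ => ?_
  ring

end

end MKdV

end

/-! ### Sequence norms, Schur's test and the lattice sum behind the trilinear estimate -/

noncomputable section

namespace MKdV

/-! ### Inequalities for sums of extended nonnegative reals -/

theorem ENNReal.tsum_le_of_forall_finset {ι : Type*} {f : ι → ℝ≥0∞} {C : ℝ≥0∞}
    (h : ∀ s : Finset ι, ∑ i ∈ s, f i ≤ C) : ∑' i, f i ≤ C := by
  rw [ENNReal.tsum_eq_iSup_sum]; exact iSup_le h

theorem ENNReal.tsum_mul_le_Lp_mul_Lq {ι : Type*} {q q' : ℝ} (hq : q.HolderConjugate q')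
    (f g : ι → ℝ≥0∞) :
    ∑' i, f i * g i ≤ (∑' i, f i ^ q) ^ (1 / q) * (∑' i, g i ^ q') ^ (1 / q') := by
  refine ENNReal.tsum_le_of_forall_finset fun s => ?_
  refine (ENNReal.inner_le_Lp_mul_Lq s f g hq).trans ?_
  have h1 := hq.nonneg
  have h2 := hq.symm.nonneg
  gcongr <;> exact ENNReal.sum_le_tsum s

/-- Jensen's inequality for t ↦ t^p with weights of arbitrary total mass; the p-th power step of
Schur's test. -/
theorem ENNReal.tsum_weight_mul_rpow_le {ι : Type*} {p : ℝ} (hp : 1 ≤ p) (w f : ι → ℝ≥0∞) :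
    (∑' i, w i * f i) ^ p ≤ (∑' i, w i) ^ (p - 1) * ∑' i, w i * f i ^ p := by
  have hp0 : 0 < p := by linarith
  have h1 : ∑' i, w i * f i ≤ (∑' i, w i) ^ (1 - p⁻¹) * (∑' i, w i * f i ^ p) ^ p⁻¹ := by
    refine ENNReal.tsum_le_of_forall_finset fun s => ?_
    refine (ENNReal.inner_le_weight_mul_Lp_of_nonneg s hp w f).trans ?_
    have h1 : 0 ≤ 1 - p⁻¹ := by
      rw [sub_nonneg]; exact inv_le_one_of_one_le₀ hp
    gcongr <;> exact ENNReal.sum_le_tsum s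
  calc (∑' i, w i * f i) ^ p
      ≤ ((∑' i, w i) ^ (1 - p⁻¹) * (∑' i, w i * f i ^ p) ^ p⁻¹) ^ p := by gcongr
    _ = _ := by
      rw [ENNReal.mul_rpow_of_nonneg _ _ hp0.le, ← ENNReal.rpow_mul, ← ENNReal.rpow_mul,
        inv_mul_cancel₀ hp0.ne', ENNReal.rpow_one]
      congr 2
      field_simp

/-- The `ℓ^p` norm of a sequence of extended nonnegative reals. -/
def seqNorm {ι : Type*} (p : ℝ≥0∞) (f : ι → ℝ≥0∞) : ℝ≥0∞ :=
  if p = ⊤ then ⨆ i, f i else (∑' i, f i ^ p.toReal) ^ (1 / p.toReal)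

section seqNorm

variable {ι : Type*} {p : ℝ≥0∞}

theorem seqNorm_top (f : ι → ℝ≥0∞) : seqNorm ⊤ f = ⨆ i, f i := by simp [seqNorm]

theorem seqNorm_of_ne_top (hp : p ≠ ⊤) (f : ι → ℝ≥0∞) :
    seqNorm p f = (∑' i, f i ^ p.toReal) ^ (1 / p.toReal) := by simp [seqNorm, hp]

theorem toReal_ge_one (hp1 : 1 ≤ p) (hp : p ≠ ⊤) : 1 ≤ p.toReal := by
  have := ENNReal.toReal_mono hp hp1
  simpa using this

theorem seqNorm_mono {f g : ι → ℝ≥0∞} (h : ∀ i, f i ≤ g i) : seqNorm p f ≤ seqNorm p g := by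
  by_cases hp : p = ⊤
  · subst hp
    rw [seqNorm_top, seqNorm_top]; exact iSup_mono h
  · rw [seqNorm_of_ne_top hp, seqNorm_of_ne_top hp]
    gcongr with i
    exact h i

theorem seqNorm_const_mul (hp1 : 1 ≤ p) (c : ℝ≥0∞) (f : ι → ℝ≥0∞) :
    seqNorm p (fun i => c * f i) = c * seqNorm p f := by
  by_cases hp : p = ⊤
  · subst hp
    rw [seqNorm_top, seqNorm_top, ENNReal.mul_iSup]
  · have h0 : 0 < p.toReal := by linarith [toReal_ge_one hp1 hp]
    rw [seqNorm_of_ne_top hp, seqNorm_of_ne_top hp]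
    simp_rw [ENNReal.mul_rpow_of_nonneg _ _ h0.le]
    rw [ENNReal.tsum_mul_left, ENNReal.mul_rpow_of_nonneg _ _ (by positivity),
      ← ENNReal.rpow_mul, mul_one_div_cancel h0.ne', ENNReal.rpow_one]

theorem seqNorm_add_le (hp1 : 1 ≤ p) (f g : ι → ℝ≥0∞) :
    seqNorm p (fun i => f i + g i) ≤ seqNorm p f + seqNorm p g := by
  by_cases hp : p = ⊤
  · subst hp
    simp only [seqNorm_top]
    exact iSup_le fun i => add_le_add (le_iSup f i) (le_iSup g i)
  · have h1 := toReal_ge_one hp1 hp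
    have h0 : 0 < p.toReal := by linarith
    rw [seqNorm_of_ne_top hp, seqNorm_of_ne_top hp, seqNorm_of_ne_top hp, one_div,
      ENNReal.rpow_inv_le_iff h0]
    refine ENNReal.tsum_le_of_forall_finset fun s => ?_
    rw [← ENNReal.rpow_inv_le_iff h0, ← one_div]
    refine (ENNReal.Lp_add_le s f g h1).trans ?_
    gcongr <;> exact ENNReal.sum_le_tsum s

theorem le_seqNorm (hp1 : 1 ≤ p) (f : ι → ℝ≥0∞) (i : ι) : f i ≤ seqNorm p f := by
  by_cases hp : p = ⊤
  · subst hp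
    rw [seqNorm_top]; exact le_iSup f i
  · have h0 : 0 < p.toReal := by linarith [toReal_ge_one hp1 hp]
    rw [seqNorm_of_ne_top hp]
    calc f i = (f i ^ p.toReal) ^ (1 / p.toReal) := by
          rw [← ENNReal.rpow_mul, mul_one_div_cancel h0.ne', ENNReal.rpow_one]
      _ ≤ _ := by
        gcongr
        exact ENNReal.le_tsum i

/-- Schur's test on `ℓ^p`, `1 ≤ p ≤ ∞`. -/
theorem seqNorm_schur {E : Type*} (hp1 : 1 ≤ p) (κ : ℤ → E → ℝ≥0∞) (σ : E → ℤ) {S : ℝ≥0∞}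
    (hrow : ∀ n, ∑' e, κ n e ≤ S) (hcol : ∀ m, ∑' e, κ (m + σ e) e ≤ S) (f : ℤ → ℝ≥0∞) :
    seqNorm p (fun n => ∑' e, κ n e * f (n - σ e)) ≤ S * seqNorm p f := by
  by_cases hp : p = ⊤
  · subst hp
    rw [seqNorm_top, seqNorm_top]
    refine iSup_le fun n => ?_
    calc ∑' e, κ n e * f (n - σ e) ≤ ∑' e, κ n e * ⨆ i, f i := by
          gcongr with e
          exact le_iSup f _
      _ = (∑' e, κ n e) * ⨆ i, f i := ENNReal.tsum_mul_right
      _ ≤ _ := by gcongr; exact hrow n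
  · have h1 := toReal_ge_one hp1 hp
    have h0 : 0 < p.toReal := by linarith
    rw [seqNorm_of_ne_top hp, seqNorm_of_ne_top hp]
    have key : ∑' n, (∑' e, κ n e * f (n - σ e)) ^ p.toReal ≤
        S ^ p.toReal * ∑' n, f n ^ p.toReal := by
      calc ∑' n, (∑' e, κ n e * f (n - σ e)) ^ p.toReal
          ≤ ∑' n, S ^ (p.toReal - 1) * ∑' e, κ n e * f (n - σ e) ^ p.toReal := by
            gcongr with n
            -- Row sums pay for p - 1 powers of S. After Fubini and the translation n = m + σ e,
            -- column sums pay for the last one.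
            refine (ENNReal.tsum_weight_mul_rpow_le h1 _ _).trans ?_
            have : 0 ≤ p.toReal - 1 := by linarith
            gcongr
            exact hrow n
        _ = S ^ (p.toReal - 1) * ∑' e, ∑' n, κ n e * f (n - σ e) ^ p.toReal := by
            rw [ENNReal.tsum_mul_left, ENNReal.tsum_comm]
        _ = S ^ (p.toReal - 1) * ∑' e, ∑' m, κ (m + σ e) e * f m ^ p.toReal := by
            congr 2
            funext e
            rw [← (Equiv.addRight (σ e)).tsum_eq]
            simp
        _ = S ^ (p.toReal - 1) * ∑' m, (∑' e, κ (m + σ e) e) * f m ^ p.toReal := by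
            rw [ENNReal.tsum_comm]
            simp_rw [ENNReal.tsum_mul_right]
        _ ≤ S ^ (p.toReal - 1) * ∑' m, S * f m ^ p.toReal := by
            gcongr with m
            exact hcol m
        _ = _ := by
            rw [ENNReal.tsum_mul_left, ← mul_assoc]
            congr 1
            nth_rewrite 2 [← ENNReal.rpow_one S]
            rw [← ENNReal.rpow_add_of_nonneg _ _ (by linarith) (by norm_num)]
            congr 1; ring
    calc _ ≤ (S ^ p.toReal * ∑' n, f n ^ p.toReal) ^ (1 / p.toReal) := by gcongr
      _ = _ := by
        rw [ENNReal.mul_rpow_of_nonneg _ _ (by positivity), ← ENNReal.rpow_mul,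
          mul_one_div_cancel h0.ne', ENNReal.rpow_one]

end seqNorm

/-! ### The triple sum -/

/-- The weight `1 + |n|`. -/
def br (n : ℤ) : ℝ := 1 + |(n : ℝ)|

theorem one_le_br (n : ℤ) : 1 ≤ br n := by unfold br; linarith [abs_nonneg (n : ℝ)]

theorem br_pos (n : ℤ) : 0 < br n := by linarith [one_le_br n]

theorem br_neg (n : ℤ) : br (-n) = br n := by simp [br]

theorem summable_br_rpow {ρ : ℝ} (hρ : 1 < ρ) : Summable fun n : ℤ => br n ^ (-ρ) := by
  refine Summable.of_norm_bounded_eventually (Real.summable_abs_int_rpow hρ) ?_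
  have : {n : ℤ | n ≠ 0} ∈ Filter.cofinite := by
    rw [Filter.mem_cofinite]
    exact (Set.finite_singleton (0 : ℤ)).subset fun n hn => by simpa using hn
  filter_upwards [this] with n hn
  have h0 : 0 < |(n : ℝ)| := abs_pos.2 (by exact_mod_cast hn)
  rw [Real.norm_of_nonneg (Real.rpow_nonneg (br_pos n).le _)]
  refine Real.rpow_le_rpow_of_nonpos h0 ?_ (by linarith)
  unfold br; linarith

/-- The largest of the three factors is at least the geometric mean of the other two, so it can be
discarded while the exponent of the remaining pair grows by 3/2. The maximum being unknown, all
three pairs appear. -/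
theorem rpow_mul_three_le {x y z r : ℝ} (hx : 0 < x) (hy : 0 < y) (hz : 0 < z) (hr : 0 ≤ r) :
    (x * y * z) ^ (-r) ≤ (x * y) ^ (-(3 / 2 * r)) + (y * z) ^ (-(3 / 2 * r)) +
      (x * z) ^ (-(3 / 2 * r)) := by
  have key : ∀ a b c : ℝ, 0 < a → 0 < b → 0 < c → a ≤ c → b ≤ c →
      (a * b * c) ^ (-r) ≤ (a * b) ^ (-(3 / 2 * r)) := by
    intro a b c ha hb hc hac hbc
    have h1 : (a * b) ^ (3 / 2 : ℝ) ≤ a * b * c := by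
      have h2 : (a * b) ^ (3 / 2 : ℝ) = a * b * Real.sqrt (a * b) := by
        rw [Real.sqrt_eq_rpow, ← Real.rpow_one_add' (by positivity) (by norm_num)]
        norm_num
      rw [h2]
      gcongr
      rw [Real.sqrt_le_left hc.le]
      nlinarith
    rw [show -(3 / 2 * r) = (3 / 2) * (-r) by ring, Real.rpow_mul (by positivity)]
    exact Real.rpow_le_rpow_of_nonpos (by positivity) h1 (by linarith)
  have p1 : 0 ≤ (x * y) ^ (-(3 / 2 * r)) := by positivity
  have p2 : 0 ≤ (y * z) ^ (-(3 / 2 * r)) := by positivity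
  have p3 : 0 ≤ (x * z) ^ (-(3 / 2 * r)) := by positivity
  rcases le_total x y with h1 | h1 <;> rcases le_total y z with h2 | h2 <;>
    rcases le_total x z with h3 | h3
  · linarith [key x y z hx hy hz h3 h2]
  · linarith [key x y z hx hy hz (h1.trans h2) h2]
  · have := key x z y hx hz hy h1 h2
    rw [show x * z * y = x * y * z by ring] at this; linarith
  · have := key x z y hx hz hy h1 h2
    rw [show x * z * y = x * y * z by ring] at this; linarith
  · linarith [key x y z hx hy hz h3 h2]
  · have := key y z x hy hz hx h1 h3
    rw [show y * z * x = x * y * z by ring] at this; linarith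
  · have := key y z x hy hz hx h1 (h2.trans h1)
    rw [show y * z * x = x * y * z by ring] at this; linarith
  · have := key y z x hy hz hx h1 h3
    rw [show y * z * x = x * y * z by ring] at this; linarith

/-- The kernel `((1+|a|)(1+|b|)(1+|c|))^{-1/2}`. -/
def tri (a b c : ℤ) : ℝ := (br a * br b * br c) ^ (-(1 / 2) : ℝ)

theorem tri_nonneg (a b c : ℤ) : 0 ≤ tri a b c :=
  Real.rpow_nonneg (by have := br_pos a; have := br_pos b; have := br_pos c; positivity) _

/-- Once the largest factor is dropped, a pair of frequencies is left with exponent ρ = 3q'/4 > 1.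
By injectivity the pair visits each point of ℤ² at most once, so the sum is dominated by the square
of a convergent series. The bound does not see α, β, γ, hence it is uniform in any frequency held
fixed. -/
theorem exists_tsum_tri_le {q' : ℝ} (hq' : 4 / 3 < q') : ∃ S : ℝ≥0∞, S ≠ ⊤ ∧
    ∀ α β γ : ℤ × ℤ → ℤ, Function.Injective (fun e => (α e, β e)) →
      Function.Injective (fun e => (β e, γ e)) → Function.Injective (fun e => (α e, γ e)) →
      ∑' e, ENNReal.ofReal (tri (α e) (β e) (γ e)) ^ q' ≤ S := by
  set ρ : ℝ := 3 / 2 * (1 / 2 * q') with hρ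
  have hρ1 : 1 < ρ := by rw [hρ]; linarith
  set G : ℤ × ℤ → ℝ≥0∞ := fun d => ENNReal.ofReal ((br d.1 * br d.2) ^ (-ρ)) with hG
  have hsum := summable_br_rpow hρ1
  have hGfin : ∑' d, G d ≠ ⊤ := by
    have h1 : Summable fun d : ℤ × ℤ => br d.1 ^ (-ρ) * br d.2 ^ (-ρ) :=
      hsum.mul_of_nonneg hsum (fun n => Real.rpow_nonneg (br_pos n).le _)
        (fun n => Real.rpow_nonneg (br_pos n).le _)
    have h2 : G = fun d => ENNReal.ofReal (br d.1 ^ (-ρ) * br d.2 ^ (-ρ)) := by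
      funext d
      rw [hG]
      simp only
      rw [Real.mul_rpow (br_pos _).le (br_pos _).le]
    rw [h2]
    exact h1.tsum_ofReal_ne_top
  refine ⟨∑' d, G d + ∑' d, G d + ∑' d, G d, by simp [hGfin], fun α β γ h1 h2 h3 => ?_⟩
  calc ∑' e, ENNReal.ofReal (tri (α e) (β e) (γ e)) ^ q'
      ≤ ∑' e, (G (α e, β e) + G (β e, γ e) + G (α e, γ e)) := by
        gcongr with e
        have ha := br_pos (α e)
        have hb := br_pos (β e)
        have hc := br_pos (γ e)
        rw [ENNReal.ofReal_rpow_of_nonneg (tri_nonneg _ _ _) (by linarith), hG]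
        simp only
        rw [← ENNReal.ofReal_add (by positivity) (by positivity),
          ← ENNReal.ofReal_add (by positivity) (by positivity)]
        apply ENNReal.ofReal_le_ofReal
        rw [tri, ← Real.rpow_mul (by positivity), neg_mul]
        exact rpow_mul_three_le ha hb hc (by linarith)
    _ = ∑' e, G (α e, β e) + ∑' e, G (β e, γ e) + ∑' e, G (α e, γ e) := by
        rw [ENNReal.tsum_add, ENNReal.tsum_add]
    _ ≤ _ := by
        exact add_le_add (add_le_add (ENNReal.tsum_comp_le_tsum_of_injective h1 G)
          (ENNReal.tsum_comp_le_tsum_of_injective h2 G))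
          (ENNReal.tsum_comp_le_tsum_of_injective h3 G)

/-- The `ℓ^q` norm, `q` real. -/
def lqNorm (q : ℝ) (g : ℤ → ℝ≥0∞) : ℝ≥0∞ := (∑' n, g n ^ q) ^ (1 / q)

/-- Hölder on ℤ²: the kernel takes ℓ^{q'}, and the ℓ^q norm of the tensor product g ⊗ h factors. -/
theorem exists_tsum_tri_mul_le {q q' : ℝ} (hq : q.HolderConjugate q') (hq' : 4 / 3 < q') :
    ∃ S : ℝ≥0∞, S ≠ ⊤ ∧ ∀ α β γ : ℤ × ℤ → ℤ, Function.Injective (fun e => (α e, β e)) →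
      Function.Injective (fun e => (β e, γ e)) → Function.Injective (fun e => (α e, γ e)) →
      ∀ g h : ℤ → ℝ≥0∞, ∑' e : ℤ × ℤ, ENNReal.ofReal (tri (α e) (β e) (γ e)) * (g e.1 * h e.2) ≤
        S * (lqNorm q g * lqNorm q h) := by
  obtain ⟨S, hS, H⟩ := exists_tsum_tri_le hq'
  have hq0 := hq.pos
  have hq0' := hq.symm.pos
  refine ⟨S ^ (1 / q'), ENNReal.rpow_ne_top_of_nonneg (by positivity) hS,
    fun α β γ h1 h2 h3 g h => ?_⟩
  refine (ENNReal.tsum_mul_le_Lp_mul_Lq hq.symm _ _).trans ?_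
  have e1 : ∑' e : ℤ × ℤ, (g e.1 * h e.2) ^ q = (∑' n, g n ^ q) * ∑' n, h n ^ q := by
    simp_rw [ENNReal.mul_rpow_of_nonneg _ _ hq0.le]
    rw [ENNReal.tsum_prod (f := fun a b => g a ^ q * h b ^ q)]
    simp_rw [ENNReal.tsum_mul_left, ENNReal.tsum_mul_right]
  rw [e1, ENNReal.mul_rpow_of_nonneg _ _ (by positivity)]
  unfold lqNorm
  gcongr
  exact H α β γ h1 h2 h3

end MKdV

end

/-! ### Pointwise bounds for the nonresonant multiplier and the unweighted trilinear estimate -/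

noncomputable section

namespace MKdV

/-! ### The multiplier of the nonresonant interaction -/

/-- No two of the three frequencies cancel. -/
def Nonres (a b c : ℤ) : Prop := a + b ≠ 0 ∧ b + c ≠ 0 ∧ a + c ≠ 0

instance (a b c : ℤ) : Decidable (Nonres a b c) := by unfold Nonres; infer_instance

/-- `|(a+b)(b+c)(a+c)|`. -/
def gap (a b c : ℤ) : ℝ := |((a + b : ℤ) : ℝ)| * |((b + c : ℤ) : ℝ)| * |((a + c : ℤ) : ℝ)|

theorem one_le_abs_cast {m : ℤ} (hm : m ≠ 0) : 1 ≤ |(m : ℝ)| := by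
  rw [← Int.cast_abs]; exact_mod_cast Int.one_le_abs hm

theorem gap_ge_one {a b c : ℤ} (h : Nonres a b c) : 1 ≤ gap a b c := by
  have h1 := one_le_abs_cast h.1
  have h2 := one_le_abs_cast h.2.1
  have h3 := one_le_abs_cast h.2.2
  unfold gap
  exact one_le_mul_of_one_le_of_one_le (one_le_mul_of_one_le_of_one_le h1 h2) h3

theorem br_le_two_mul {m : ℤ} (hm : m ≠ 0) : br m ≤ 2 * |(m : ℝ)| := by
  have := one_le_abs_cast hm
  unfold br; linarith

/-- The multiplier `|n| (⟨n⟩ / (⟨a⟩⟨b⟩⟨c⟩ |(a+b)(b+c)(a+c)|))^{1/2}`, `n = a + b + c`. -/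
def mult (a b c : ℤ) : ℝ :=
  Real.sqrt (((a + b + c : ℤ) : ℝ) ^ 2 * br (a + b + c) / (br a * br b * br c * gap a b c))

theorem tri_eq (a b c : ℤ) : tri a b c = Real.sqrt (1 / (br a * br b * br c)) := by
  have ha := br_pos a
  have hb := br_pos b
  have hc := br_pos c
  rw [tri, Real.rpow_neg (by positivity), ← Real.sqrt_eq_rpow, one_div, Real.sqrt_inv]

/-- Both sides are square roots, so the comparison reduces to a polynomial inequality; 900 = 30² is
a common constant for all frequency regimes. -/
theorem mult_le_tri {a b c : ℤ} (h : Nonres a b c) {α β γ : ℤ}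
    (H : ((a + b + c : ℤ) : ℝ) ^ 2 * br (a + b + c) * (br α * br β * br γ) ≤
      900 * (br a * br b * br c * gap a b c)) : mult a b c ≤ 30 * tri α β γ := by
  have ha := br_pos a
  have hb := br_pos b
  have hc := br_pos c
  have ha' := br_pos α
  have hb' := br_pos β
  have hc' := br_pos γ
  have hg : 0 < gap a b c := by linarith [gap_ge_one h]
  have h30 : (30 : ℝ) = Real.sqrt 900 := by
    rw [show (900 : ℝ) = 30 ^ 2 by norm_num, Real.sqrt_sq (by norm_num)]
  rw [tri_eq, mult, h30, ← Real.sqrt_mul (by norm_num)]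
  apply Real.sqrt_le_sqrt
  rw [mul_one_div, div_le_div_iff₀ (by positivity) (by positivity)]
  exact H

section

variable {a b c : ℤ}

theorem sq_mul_br_le (hb : |b| ≤ |a|) (hc : |c| ≤ |a|) :
    ((a + b + c : ℤ) : ℝ) ^ 2 * br (a + b + c) ≤ 27 * br a ^ 3 := by
  have hb' : |(b : ℝ)| ≤ |(a : ℝ)| := by exact_mod_cast hb
  have hc' : |(c : ℝ)| ≤ |(a : ℝ)| := by exact_mod_cast hc
  have h1 : |((a + b + c : ℤ) : ℝ)| ≤ 3 * |(a : ℝ)| := by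
    push_cast
    have := abs_add_three (a : ℝ) b c
    linarith
  have h0 := abs_nonneg (a : ℝ)
  have h2 : |((a + b + c : ℤ) : ℝ)| ≤ 3 * br a := by unfold br; linarith
  have h3 : br (a + b + c) ≤ 3 * br a := by
    unfold br at *; linarith
  have h4 := br_pos (a + b + c)
  rw [← sq_abs]
  calc _ ≤ (3 * br a) ^ 2 * (3 * br a) := by gcongr
    _ = _ := by ring

theorem br_le_four_mul_abs_add {a c : ℤ} (hc : 2 * |c| ≤ |a|) (ha : a ≠ 0) :
    br a ≤ 4 * |((a + c : ℤ) : ℝ)| := by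
  have h1 := one_le_abs_cast ha
  have h2 : 2 * |(c : ℝ)| ≤ |(a : ℝ)| := by exact_mod_cast hc
  have h3 : |(a : ℝ)| ≤ |((a + c : ℤ) : ℝ)| + |(c : ℝ)| := by
    push_cast
    have := abs_sub ((a : ℝ) + c) c
    simpa using this
  unfold br; linarith

theorem br_le_two_mul_br {a b : ℤ} (h : |a| ≤ 2 * |b|) : br a ≤ 2 * br b := by
  have h2 : |(a : ℝ)| ≤ 2 * |(b : ℝ)| := by exact_mod_cast h
  unfold br; linarith

theorem ne_zero_of_nonres (h : Nonres a b c) (hb : |b| ≤ |a|) : a ≠ 0 := by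
  rintro rfl
  have : b = 0 := by simpa using hb
  exact h.1 (by simp [this])

/-- All frequencies comparable. -/
theorem mult_le_of_comparable (h : Nonres a b c) (hb : |b| ≤ |a|) (hc : |c| ≤ |a|)
    (hb' : |a| ≤ 2 * |b|) (hc' : |a| ≤ 2 * |c|) :
    mult a b c ≤ 30 * tri (b + c) (a + c) (a + b) := by
  refine mult_le_tri h ?_
  have h0 := sq_mul_br_le hb hc
  have h1 := br_le_two_mul_br hb'
  have h2 := br_le_two_mul_br hc'
  have h3 := br_le_two_mul h.1
  have h4 := br_le_two_mul h.2.1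
  have h5 := br_le_two_mul h.2.2
  have pa := br_pos a
  have pb := br_pos b
  have pc := br_pos c
  have px := br_pos (b + c)
  have py := br_pos (a + c)
  have pz := br_pos (a + b)
  -- Here n²⟨n⟩ is absorbed by ⟨a⟩⟨b⟩⟨c⟩, and the whole decay comes from the gap.
  calc _ ≤ 27 * br a ^ 3 * ((2 * |((b + c : ℤ) : ℝ)|) * (2 * |((a + c : ℤ) : ℝ)|) *
        (2 * |((a + b : ℤ) : ℝ)|)) := by gcongr
    _ = 216 * (br a * br a * br a * gap a b c) := by unfold gap; ring
    _ ≤ 216 * (br a * (2 * br b) * (2 * br c) * gap a b c) := by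
        have : 0 ≤ gap a b c := by linarith [gap_ge_one h]
        gcongr
    _ = 864 * (br a * br b * br c * gap a b c) := by ring
    _ ≤ _ := by
        have : 0 ≤ gap a b c := by linarith [gap_ge_one h]
        gcongr; norm_num

/-- One high and two low frequencies. -/
theorem mult_le_of_high_low_low (h : Nonres a b c) (hb : |b| ≤ |a|) (hc : |c| ≤ |a|)
    (hb' : 2 * |b| ≤ |a|) (hc' : 2 * |c| ≤ |a|) :
    mult a b c ≤ 30 * tri b c (b + c) := by
  refine mult_le_tri h ?_
  have ha := ne_zero_of_nonres h hb
  have h0 := sq_mul_br_le hb hc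
  have h1 := br_le_four_mul_abs_add hb' ha
  have h2 := br_le_four_mul_abs_add hc' ha
  have h4 := br_le_two_mul h.2.1
  have pa := br_pos a
  have pb := br_pos b
  have pc := br_pos c
  have px := br_pos (b + c)
  -- Since |a+b| and |a+c| are comparable to |a|, two gap factors and ⟨a⟩ absorb n²⟨n⟩; the decay
  -- left is ⟨b⟩⟨c⟩|b+c|.
  calc _ ≤ 27 * br a ^ 3 * (br b * br c * (2 * |((b + c : ℤ) : ℝ)|)) := by gcongr
    _ = 54 * (br a * br b * br c) * (br a * br a * |((b + c : ℤ) : ℝ)|) := by ring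
    _ ≤ 54 * (br a * br b * br c) * ((4 * |((a + b : ℤ) : ℝ)|) * (4 * |((a + c : ℤ) : ℝ)|) *
        |((b + c : ℤ) : ℝ)|) := by gcongr
    _ = 864 * (br a * br b * br c * gap a b c) := by unfold gap; ring
    _ ≤ _ := by
        have : 0 ≤ gap a b c := by linarith [gap_ge_one h]
        gcongr; norm_num

/-- Two high frequencies and one low frequency. -/
theorem mult_le_of_high_high_low (h : Nonres a b c) (hb : |b| ≤ |a|) (hc : |c| ≤ |a|)
    (hb' : |a| ≤ 2 * |b|) (hc' : 2 * |c| ≤ |a|) :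
    mult a b c ≤ 30 * tri c (b + c) (a + b) := by
  refine mult_le_tri h ?_
  have ha := ne_zero_of_nonres h hb
  have h0 := sq_mul_br_le hb hc
  have h1 := br_le_two_mul_br hb'
  have h2 := br_le_four_mul_abs_add hc' ha
  have h4 := br_le_two_mul h.2.1
  have h5 := br_le_two_mul h.1
  have pa := br_pos a
  have pb := br_pos b
  have pc := br_pos c
  have px := br_pos (b + c)
  have pz := br_pos (a + b)
  calc _ ≤ 27 * br a ^ 3 * (br c * (2 * |((b + c : ℤ) : ℝ)|) * (2 * |((a + b : ℤ) : ℝ)|)) := by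
        gcongr
    _ = 108 * (br a * br c * |((b + c : ℤ) : ℝ)| * |((a + b : ℤ) : ℝ)|) * (br a * br a) := by ring
    _ ≤ 108 * (br a * br c * |((b + c : ℤ) : ℝ)| * |((a + b : ℤ) : ℝ)|) *
        ((2 * br b) * (4 * |((a + c : ℤ) : ℝ)|)) := by gcongr
    _ = 864 * (br a * br b * br c * gap a b c) := by unfold gap; ring
    _ ≤ _ := by
        have : 0 ≤ gap a b c := by linarith [gap_ge_one h]
        gcongr; norm_num

theorem sq_le_nine_mul_br (hb : |b| ≤ |a|) (hc : |c| ≤ |a|) :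
    ((a + b + c : ℤ) : ℝ) ^ 2 ≤ 9 * br a ^ 2 := by
  have hb' : |(b : ℝ)| ≤ |(a : ℝ)| := by exact_mod_cast hb
  have hc' : |(c : ℝ)| ≤ |(a : ℝ)| := by exact_mod_cast hc
  have h0 := abs_nonneg (a : ℝ)
  have h1 : |((a + b + c : ℤ) : ℝ)| ≤ 3 * br a := by
    push_cast
    have := abs_add_three (a : ℝ) b c
    unfold br; linarith
  rw [← sq_abs]
  calc _ ≤ (3 * br a) ^ 2 := by gcongr
    _ = _ := by ring

/-- Replaces `mult_le_of_high_high_low` when n = a + b + c is fixed: then a + b = n - c, so c and a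
+ b do not determine (b, c) and the kernel used there is not summable. The remedy is to keep ⟨n⟩
rather than bound it by ⟨a⟩. As n = (a+b) + c, the larger of |a+b| and |c| absorbs ⟨n⟩, and the
other stays in the kernel next to b and b + c. -/
theorem mult_le_of_high_high_low' (h : Nonres a b c) (hb : |b| ≤ |a|) (hc : |c| ≤ |a|)
    (hc' : 2 * |c| ≤ |a|) :
    mult a b c ≤ 30 * tri b c (b + c) ∨ mult a b c ≤ 30 * tri b (a + b) (b + c) := by
  have ha := ne_zero_of_nonres h hb
  have h0 := sq_le_nine_mul_br hb hc
  have h2 := br_le_four_mul_abs_add hc' ha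
  have h4 := br_le_two_mul h.2.1
  have h5 := br_le_two_mul h.1
  have pa := br_pos a
  have pb := br_pos b
  have pc := br_pos c
  have px := br_pos (b + c)
  have pz := br_pos (a + b)
  have pn := br_pos (a + b + c)
  have hg : 0 ≤ gap a b c := by linarith [gap_ge_one h]
  have hn : |((a + b + c : ℤ) : ℝ)| ≤ |((a + b : ℤ) : ℝ)| + |(c : ℝ)| := by
    push_cast; exact abs_add_le _ _
  have hz := one_le_abs_cast h.1
  rcases le_total |(c : ℝ)| |((a + b : ℤ) : ℝ)| with hcz | hcz
  · left
    refine mult_le_tri h ?_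
    have hn' : br (a + b + c) ≤ 3 * |((a + b : ℤ) : ℝ)| := by
      rw [br]; linarith
    calc _ ≤ 9 * br a ^ 2 * (3 * |((a + b : ℤ) : ℝ)|) *
          (br b * br c * (2 * |((b + c : ℤ) : ℝ)|)) := by gcongr
      _ = 54 * (br a * br b * br c) * |((b + c : ℤ) : ℝ)| * |((a + b : ℤ) : ℝ)| * br a := by ring
      _ ≤ 54 * (br a * br b * br c) * |((b + c : ℤ) : ℝ)| * |((a + b : ℤ) : ℝ)| *
          (4 * |((a + c : ℤ) : ℝ)|) := by gcongr
      _ = 216 * (br a * br b * br c * gap a b c) := by unfold gap; ring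
      _ ≤ _ := by gcongr; norm_num
  · right
    refine mult_le_tri h ?_
    have hn' : br (a + b + c) ≤ 2 * br c := by
      unfold br; linarith [abs_nonneg (c : ℝ)]
    calc _ ≤ 9 * br a ^ 2 * (2 * br c) *
          (br b * (2 * |((a + b : ℤ) : ℝ)|) * (2 * |((b + c : ℤ) : ℝ)|)) := by gcongr
      _ = 72 * (br a * br b * br c) * |((b + c : ℤ) : ℝ)| * |((a + b : ℤ) : ℝ)| * br a := by ring
      _ ≤ 72 * (br a * br b * br c) * |((b + c : ℤ) : ℝ)| * |((a + b : ℤ) : ℝ)| *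
          (4 * |((a + c : ℤ) : ℝ)|) := by gcongr
      _ = 288 * (br a * br b * br c * gap a b c) := by unfold gap; ring
      _ ≤ _ := by gcongr; norm_num

theorem gap_swap (a b c : ℤ) : gap a c b = gap a b c := by
  unfold gap
  rw [add_comm c b]; ring

theorem nonres_swap {a b c : ℤ} : Nonres a c b ↔ Nonres a b c := by
  unfold Nonres
  rw [add_comm c b]; tauto

theorem mult_swap (a b c : ℤ) : mult a c b = mult a b c := by
  unfold mult
  rw [gap_swap, add_right_comm a c b, mul_right_comm (br a)]

/-- The kernel bound used when the output frequency is fixed. -/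
theorem mult_le_row (h : Nonres a b c) (hb : |b| ≤ |a|) (hc : |c| ≤ |a|) :
    mult a b c ≤ 30 * (tri b c (b + c) + tri (b + c) (a + c) (a + b) +
      tri b (a + b) (b + c) + tri c (a + c) (b + c)) := by
  have p1 := tri_nonneg b c (b + c)
  have p2 := tri_nonneg (b + c) (a + c) (a + b)
  have p3 := tri_nonneg b (a + b) (b + c)
  have p4 := tri_nonneg c (a + c) (b + c)
  rcases le_total (2 * |c|) |a| with hc' | hc'
  · rcases mult_le_of_high_high_low' h hb hc hc' with h1 | h1 <;> linarith
  · rcases le_total (2 * |b|) |a| with hb' | hb'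
    · have h1 := mult_le_of_high_high_low' (nonres_swap.2 h) hc hb hb'
      rw [mult_swap, add_comm c b] at h1
      have e : tri c b (b + c) = tri b c (b + c) := by unfold tri; rw [mul_comm (br c)]
      rw [e] at h1
      rcases h1 with h1 | h1 <;> linarith
    · linarith [mult_le_of_comparable h hb hc hb' hc']

/-- The kernel bound used when the highest input frequency is fixed. -/
theorem mult_le_col (h : Nonres a b c) (hb : |b| ≤ |a|) (hc : |c| ≤ |a|) :
    mult a b c ≤ 30 * (tri b c (b + c) + tri (b + c) (a + c) (a + b) +
      tri c (b + c) (a + b) + tri b (b + c) (a + c)) := by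
  have p1 := tri_nonneg b c (b + c)
  have p2 := tri_nonneg (b + c) (a + c) (a + b)
  have p3 := tri_nonneg c (b + c) (a + b)
  have p4 := tri_nonneg b (b + c) (a + c)
  rcases le_total (2 * |c|) |a| with hc' | hc' <;> rcases le_total (2 * |b|) |a| with hb' | hb'
  · linarith [mult_le_of_high_low_low h hb hc hb' hc']
  · linarith [mult_le_of_high_high_low h hb hc hb' hc']
  · have h1 := mult_le_of_high_high_low (nonres_swap.2 h) hc hb hc' hb'
    rw [mult_swap, add_comm c b] at h1
    linarith
  · linarith [mult_le_of_comparable h hb hc hb' hc']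

end

/-! ### The trilinear estimate -/

/-- The kernel of the interaction in which the first frequency is the largest. -/
def kern (a b c : ℤ) : ℝ≥0∞ :=
  if Nonres a b c ∧ |b| ≤ |a| ∧ |c| ≤ |a| then ENNReal.ofReal (mult a b c) else 0

theorem kern_le {a b c : ℤ} {B : ℝ} (h : Nonres a b c → |b| ≤ |a| → |c| ≤ |a| → mult a b c ≤ B) :
    kern a b c ≤ ENNReal.ofReal B := by
  unfold kern
  split_ifs with h1
  · exact ENNReal.ofReal_le_ofReal (h h1.1 h1.2.1 h1.2.2)
  · exact zero_le

/-- The two lower inputs g, h are absorbed into the kernel of a linear operator acting on f, to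
which Schur's test applies. Its row sums (n fixed) and column sums (the top frequency fixed) are
bounded by Hölder, using `mult_le_row` and `mult_le_col` respectively. The exponent p of the top
input is therefore unrestricted. -/
theorem exists_seqNorm_kern_le {q q' : ℝ} (hq : q.HolderConjugate q') (hq' : 4 / 3 < q') :
    ∃ S : ℝ≥0∞, S ≠ ⊤ ∧ ∀ p : ℝ≥0∞, 1 ≤ p → ∀ f g h : ℤ → ℝ≥0∞,
      seqNorm p (fun n => ∑' e : ℤ × ℤ, kern (n - (e.1 + e.2)) e.1 e.2 *
        (f (n - (e.1 + e.2)) * g e.1 * h e.2)) ≤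
      S * (seqNorm p f * lqNorm q g * lqNorm q h) := by
  obtain ⟨S, hS, H⟩ := exists_tsum_tri_mul_le hq hq'
  -- Rows and columns are both dominated by four kernels with constant 30, whence 120.
  have four : ∀ (α₁ β₁ γ₁ α₂ β₂ γ₂ α₃ β₃ γ₃ α₄ β₄ γ₄ : ℤ × ℤ → ℤ) (g h : ℤ → ℝ≥0∞)
      (k : ℤ × ℤ → ℝ≥0∞),
      (∀ e, k e ≤ ENNReal.ofReal (30 * (tri (α₁ e) (β₁ e) (γ₁ e) + tri (α₂ e) (β₂ e) (γ₂ e) +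
        tri (α₃ e) (β₃ e) (γ₃ e) + tri (α₄ e) (β₄ e) (γ₄ e)))) →
      Function.Injective (fun e => (α₁ e, β₁ e)) → Function.Injective (fun e => (β₁ e, γ₁ e)) →
      Function.Injective (fun e => (α₁ e, γ₁ e)) →
      Function.Injective (fun e => (α₂ e, β₂ e)) → Function.Injective (fun e => (β₂ e, γ₂ e)) →
      Function.Injective (fun e => (α₂ e, γ₂ e)) →
      Function.Injective (fun e => (α₃ e, β₃ e)) → Function.Injective (fun e => (β₃ e, γ₃ e)) →
      Function.Injective (fun e => (α₃ e, γ₃ e)) →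
      Function.Injective (fun e => (α₄ e, β₄ e)) → Function.Injective (fun e => (β₄ e, γ₄ e)) →
      Function.Injective (fun e => (α₄ e, γ₄ e)) →
      ∑' e : ℤ × ℤ, k e * (g e.1 * h e.2) ≤ 120 * S * (lqNorm q g * lqNorm q h) := by
    intro α₁ β₁ γ₁ α₂ β₂ γ₂ α₃ β₃ γ₃ α₄ β₄ γ₄ g h k hk a1 a2 a3 b1 b2 b3 c1 c2 c3 d1 d2 d3
    have e1 := H α₁ β₁ γ₁ a1 a2 a3 g h
    have e2 := H α₂ β₂ γ₂ b1 b2 b3 g h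
    have e3 := H α₃ β₃ γ₃ c1 c2 c3 g h
    have e4 := H α₄ β₄ γ₄ d1 d2 d3 g h
    calc _ ≤ ∑' e : ℤ × ℤ, 30 * (ENNReal.ofReal (tri (α₁ e) (β₁ e) (γ₁ e)) * (g e.1 * h e.2) +
          ENNReal.ofReal (tri (α₂ e) (β₂ e) (γ₂ e)) * (g e.1 * h e.2) +
          ENNReal.ofReal (tri (α₃ e) (β₃ e) (γ₃ e)) * (g e.1 * h e.2) +
          ENNReal.ofReal (tri (α₄ e) (β₄ e) (γ₄ e)) * (g e.1 * h e.2)) := by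
          refine ENNReal.tsum_le_tsum fun e => ?_
          rw [← add_mul, ← add_mul, ← add_mul]
          refine (mul_le_mul' ((hk e).trans (le_of_eq ?_)) le_rfl).trans
            (le_of_eq (mul_assoc _ _ _))
          have p1 := tri_nonneg (α₁ e) (β₁ e) (γ₁ e)
          have p2 := tri_nonneg (α₂ e) (β₂ e) (γ₂ e)
          have p3 := tri_nonneg (α₃ e) (β₃ e) (γ₃ e)
          have p4 := tri_nonneg (α₄ e) (β₄ e) (γ₄ e)
          rw [ENNReal.ofReal_mul (by norm_num), ENNReal.ofReal_add (by positivity) p4,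
            ENNReal.ofReal_add (by positivity) p3, ENNReal.ofReal_add p1 p2]
          norm_num
      _ ≤ 30 * (S * (lqNorm q g * lqNorm q h) + S * (lqNorm q g * lqNorm q h) +
          S * (lqNorm q g * lqNorm q h) + S * (lqNorm q g * lqNorm q h)) := by
          rw [ENNReal.tsum_mul_left, ENNReal.tsum_add, ENNReal.tsum_add, ENNReal.tsum_add]
          exact mul_le_mul_right (add_le_add (add_le_add (add_le_add e1 e2) e3) e4) _
      _ = _ := by ring
  refine ⟨120 * S, ENNReal.mul_ne_top (by norm_num) hS, fun p hp f g h => ?_⟩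
  have hrow : ∀ n : ℤ, ∑' e : ℤ × ℤ, kern (n - (e.1 + e.2)) e.1 e.2 * (g e.1 * h e.2) ≤
      120 * S * (lqNorm q g * lqNorm q h) := by
    intro n
    refine four (fun e => e.1) (fun e => e.2) (fun e => e.1 + e.2)
      (fun e => e.1 + e.2) (fun e => n - e.1) (fun e => n - e.2)
      (fun e => e.1) (fun e => n - e.2) (fun e => e.1 + e.2)
      (fun e => e.2) (fun e => n - e.1) (fun e => e.1 + e.2) g h _ (fun e => ?_)
      ?_ ?_ ?_ ?_ ?_ ?_ ?_ ?_ ?_ ?_ ?_ ?_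
    · refine kern_le fun h1 h2 h3 => ?_
      have := mult_le_row h1 h2 h3
      rw [show n - (e.1 + e.2) + e.2 = n - e.1 by ring,
        show n - (e.1 + e.2) + e.1 = n - e.2 by ring] at this
      exact this
    all_goals
      rintro ⟨x, y⟩ ⟨x', y'⟩ hxy
      simp only [Prod.mk.injEq] at hxy ⊢
      omega
  have hcol : ∀ m : ℤ, ∑' e : ℤ × ℤ, kern m e.1 e.2 * (g e.1 * h e.2) ≤
      120 * S * (lqNorm q g * lqNorm q h) := by
    intro m
    refine four (fun e => e.1) (fun e => e.2) (fun e => e.1 + e.2)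
      (fun e => e.1 + e.2) (fun e => m + e.2) (fun e => m + e.1)
      (fun e => e.2) (fun e => e.1 + e.2) (fun e => m + e.1)
      (fun e => e.1) (fun e => e.1 + e.2) (fun e => m + e.2) g h _ (fun e => ?_)
      ?_ ?_ ?_ ?_ ?_ ?_ ?_ ?_ ?_ ?_ ?_ ?_
    · exact kern_le mult_le_col
    all_goals
      rintro ⟨x, y⟩ ⟨x', y'⟩ hxy
      simp only [Prod.mk.injEq] at hxy ⊢
      omega
  have key := seqNorm_schur hp (fun n (e : ℤ × ℤ) => kern (n - (e.1 + e.2)) e.1 e.2 *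
    (g e.1 * h e.2)) (fun e => e.1 + e.2) hrow (fun m => by simpa using hcol m) f
  calc _ = seqNorm p (fun n => ∑' e : ℤ × ℤ, kern (n - (e.1 + e.2)) e.1 e.2 *
        (g e.1 * h e.2) * f (n - (e.1 + e.2))) := by
        congr 1; funext n; congr 1; funext e; ring
    _ ≤ _ := key
    _ = _ := by ring

end MKdV

end

/-! ### Embedding into FL^{1/2,q} with q < 4, and the weighted trilinear estimate -/

noncomputable section

namespace MKdV

/-! ### Weights -/

/-- The Japanese bracket `⟨n⟩ = (1 + n²)^{1/2}`. -/
def jb (n : ℤ) : ℝ := Real.sqrt (1 + (n : ℝ) ^ 2)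

theorem one_le_jb (n : ℤ) : 1 ≤ jb n := by
  unfold jb
  rw [Real.one_le_sqrt]; nlinarith [sq_nonneg (n : ℝ)]

theorem jb_pos (n : ℤ) : 0 < jb n := by linarith [one_le_jb n]

theorem jb_neg (n : ℤ) : jb (-n) = jb n := by simp [jb]

theorem jb_le_br (n : ℤ) : jb n ≤ br n := by
  have h := br_pos n
  unfold jb
  rw [Real.sqrt_le_left h.le]
  unfold br
  nlinarith [abs_nonneg (n : ℝ), sq_abs (n : ℝ)]

theorem br_le_two_jb (n : ℤ) : br n ≤ 2 * jb n := by
  have h1 := one_le_jb n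
  have h2 : |(n : ℝ)| ≤ jb n := by
    unfold jb
    rw [← Real.sqrt_sq_eq_abs]
    apply Real.sqrt_le_sqrt; linarith
  unfold br; linarith

theorem jb_le_three_jb {m n : ℤ} (h : |n| ≤ 3 * |m|) : jb n ≤ 3 * jb m := by
  have h' : |(n : ℝ)| ≤ 3 * |(m : ℝ)| := by exact_mod_cast h
  have : (n : ℝ) ^ 2 ≤ 9 * (m : ℝ) ^ 2 := by
    rw [← sq_abs (n : ℝ), ← sq_abs (m : ℝ)]
    nlinarith [abs_nonneg (n : ℝ), abs_nonneg (m : ℝ)]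
  unfold jb
  rw [Real.sqrt_le_left (by positivity), mul_pow, Real.sq_sqrt (by positivity)]
  linarith

theorem sqrt_br_le (n : ℤ) : Real.sqrt (br n) ≤ Real.sqrt 2 * jb n ^ (1 / 2 : ℝ) := by
  rw [← Real.sqrt_eq_rpow, ← Real.sqrt_mul (by norm_num)]
  exact Real.sqrt_le_sqrt (br_le_two_jb n)

theorem jb_rpow_half_le (n : ℤ) : jb n ^ (1 / 2 : ℝ) ≤ Real.sqrt (br n) := by
  rw [← Real.sqrt_eq_rpow]
  exact Real.sqrt_le_sqrt (jb_le_br n)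

theorem summable_jb_rpow {ρ : ℝ} (hρ : 1 < ρ) : Summable fun n : ℤ => jb n ^ (-ρ) := by
  refine Summable.of_nonneg_of_le (fun n => Real.rpow_nonneg (jb_pos n).le _) (fun n => ?_)
    ((summable_br_rpow hρ).mul_left ((1 / 2 : ℝ) ^ (-ρ)))
  rw [← Real.mul_rpow (by norm_num) (br_pos n).le]
  refine Real.rpow_le_rpow_of_nonpos (by have := br_pos n; positivity) ?_ (by linarith)
  linarith [br_le_two_jb n]

/-! ### Embedding into `FL^{1/2,q}` with `q < 4` -/

/-- The hypothesis says 1/p' < s + 1/4, and 1/p' = 1 - 1/p. Reading it through inverses treats p = ∞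
and p' = ∞ uniformly. -/
theorem three_quarters_sub_lt {s : ℝ} {p p' : ℝ≥0∞} (hp : 1 ≤ p) (hpp' : p.HolderConjugate p')
    (hs : 1 / 2 ≤ s) (hsp : 1 < p' * ENNReal.ofReal (s + 1 / 4)) :
    3 / 4 - (p⁻¹).toReal < s := by
  have h1 : p⁻¹ + p'⁻¹ = 1 := by simpa using hpp'.inv_add_inv_eq_inv
  have hp0 : p⁻¹ ≠ ⊤ := ENNReal.inv_ne_top.2 (by rintro rfl; simp at hp)
  have hp'0 : p' ≠ 0 := by rintro rfl; simp at hsp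
  have h2 : p'⁻¹ < ENNReal.ofReal (s + 1 / 4) := by
    by_cases ht : p' = ⊤
    · subst ht
      rw [ENNReal.inv_top, ENNReal.ofReal_pos]; linarith
    · have h3 := ENNReal.mul_lt_mul_right (ENNReal.inv_ne_zero.2 ht)
        (ENNReal.inv_ne_top.2 hp'0) hsp
      rwa [mul_one, ← mul_assoc, ENNReal.inv_mul_cancel hp'0 ht, one_mul] at h3
  have h3 : (1 : ℝ≥0∞) < p⁻¹ + ENNReal.ofReal (s + 1 / 4) := by
    rw [← h1]
    exact (ENNReal.add_lt_add_iff_left hp0).2 h2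
  have h4 := (ENNReal.toReal_lt_toReal (by simp) (by simp [hp0])).2 h3
  rw [ENNReal.toReal_add hp0 (by simp), ENNReal.toReal_ofReal (by linarith)] at h4
  simp only [ENNReal.toReal_one] at h4
  linarith

theorem lqNorm_eq_seqNorm {q : ℝ} (hq : 0 ≤ q) (f : ℤ → ℝ≥0∞) :
    lqNorm q f = seqNorm (ENNReal.ofReal q) f := by
  rw [seqNorm_of_ne_top (by simp), ENNReal.toReal_ofReal hq, lqNorm]

theorem lqNorm_le_seqNorm {p : ℝ≥0∞} {q : ℝ} (hp : p ≠ ⊤) (hp1 : 1 ≤ p) (hpq : p.toReal ≤ q)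
    (f : ℤ → ℝ≥0∞) : lqNorm q f ≤ seqNorm p f := by
  have h1 := toReal_ge_one hp1 hp
  have hq : 0 < q := by linarith
  have h0 : 0 < p.toReal := by linarith
  rw [lqNorm, one_div, ENNReal.rpow_inv_le_iff hq]
  calc ∑' n, f n ^ q = ∑' n, f n ^ (q - p.toReal) * f n ^ p.toReal := by
        congr 1; funext n
        rw [← ENNReal.rpow_add_of_nonneg _ _ (by linarith) h0.le]
        congr 1; ring
    _ ≤ ∑' n, seqNorm p f ^ (q - p.toReal) * f n ^ p.toReal := by
        have : 0 ≤ q - p.toReal := by linarith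
        gcongr with n
        exact le_seqNorm hp1 f n
    _ = seqNorm p f ^ (q - p.toReal) * seqNorm p f ^ p.toReal := by
        rw [ENNReal.tsum_mul_left]
        congr 1
        rw [seqNorm_of_ne_top hp, ← ENNReal.rpow_mul, one_div_mul_cancel h0.ne', ENNReal.rpow_one]
    _ = _ := by
        rw [← ENNReal.rpow_add_of_nonneg _ _ (by linarith) h0.le]
        congr 1; ring

/-- Hölder with 1/q = 1/p + 1/r: the weight ⟨n⟩^{-σ} lies in ℓ^r exactly when σ r > 1, which is the
assumed gap. -/
theorem exists_lqNorm_weight_le {p : ℝ≥0∞} {q σ : ℝ} (hp1 : 1 ≤ p) (hq : 0 < q)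
    (hqp : ENNReal.ofReal q < p) (hσ : 1 / q - (p⁻¹).toReal < σ) :
    ∃ C : ℝ≥0∞, C ≠ ⊤ ∧ ∀ f : ℤ → ℝ≥0∞,
      lqNorm q (fun n => ENNReal.ofReal (jb n ^ (-σ)) * f n) ≤ C * seqNorm p f := by
  have hfin : ∀ ρ : ℝ, 1 < ρ → ∑' n : ℤ, ENNReal.ofReal (jb n ^ (-ρ)) ≠ ⊤ :=
    fun ρ hρ => (summable_jb_rpow hρ).tsum_ofReal_ne_top
  have hpow : ∀ (n : ℤ) (r : ℝ), 0 ≤ r →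
      ENNReal.ofReal (jb n ^ (-σ)) ^ r = ENNReal.ofReal (jb n ^ (-(σ * r))) := by
    intro n r hr
    rw [ENNReal.ofReal_rpow_of_nonneg (Real.rpow_nonneg (jb_pos n).le _) hr,
      ← Real.rpow_mul (jb_pos n).le, neg_mul]
  by_cases hp : p = ⊤
  · subst hp
    simp only [ENNReal.inv_top, ENNReal.toReal_zero, sub_zero] at hσ
    have h1 : 1 < σ * q := by rwa [div_lt_iff₀ hq] at hσ
    refine ⟨(∑' n : ℤ, ENNReal.ofReal (jb n ^ (-(σ * q)))) ^ (1 / q),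
      ENNReal.rpow_ne_top_of_nonneg (by positivity) (hfin _ h1), fun f => ?_⟩
    rw [lqNorm, seqNorm_top]
    calc _ ≤ (∑' n, ENNReal.ofReal (jb n ^ (-(σ * q))) * (⨆ i, f i) ^ q) ^ (1 / q) := by
          gcongr with n
          rw [ENNReal.mul_rpow_of_nonneg _ _ hq.le, hpow n q hq.le]
          gcongr
          exact le_iSup f n
      _ = _ := by
          rw [ENNReal.tsum_mul_right, ENNReal.mul_rpow_of_nonneg _ _ (by positivity),
            ← ENNReal.rpow_mul, mul_one_div_cancel hq.ne', ENNReal.rpow_one]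
  · have hP1 := toReal_ge_one hp1 hp
    set P := p.toReal with hP
    have hqP : q < P := by
      rw [hP]; exact (ENNReal.ofReal_lt_iff_lt_toReal hq.le hp).1 hqp
    have hP0 : 0 < P := by linarith
    rw [ENNReal.toReal_inv, ← hP] at hσ
    have hconj : (P / q).HolderConjugate (P / (P - q)) := by
      rw [Real.holderConjugate_iff]
      have : 0 < P - q := by linarith
      refine ⟨(one_lt_div hq).2 hqP, ?_⟩
      field_simp
      ring
    have hr : 1 < σ * (q * (P / (P - q))) := by
      have h2 : 0 < P - q := by linarith
      have h3 : 1 / q - P⁻¹ = (P - q) / (q * P) := by field_simp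
      rw [h3, div_lt_iff₀ (by positivity)] at hσ
      rw [show σ * (q * (P / (P - q))) = σ * (q * P) / (P - q) by ring, one_lt_div h2]
      exact hσ
    refine ⟨(∑' n : ℤ, ENNReal.ofReal (jb n ^ (-(σ * (q * (P / (P - q))))))) ^
      (1 / (P / (P - q)) * (1 / q)),
      ENNReal.rpow_ne_top_of_nonneg (by have := hconj.symm.pos; positivity) (hfin _ hr),
      fun f => ?_⟩
    have h4 := ENNReal.tsum_mul_le_Lp_mul_Lq hconj (fun n => f n ^ q)
      (fun n => ENNReal.ofReal (jb n ^ (-σ)) ^ q)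
    have e1 : ∀ n, (f n ^ q) ^ (P / q) = f n ^ P := fun n => by
      rw [← ENNReal.rpow_mul]; congr 1; field_simp
    have e2 : ∀ n, (ENNReal.ofReal (jb n ^ (-σ)) ^ q) ^ (P / (P - q)) =
        ENNReal.ofReal (jb n ^ (-(σ * (q * (P / (P - q)))))) := fun n => by
      rw [← ENNReal.rpow_mul, hpow n _ (by have := hconj.symm.pos; positivity)]
    simp only [e1, e2] at h4
    rw [lqNorm, seqNorm_of_ne_top hp, ← hP]
    calc _ = (∑' n, f n ^ q * ENNReal.ofReal (jb n ^ (-σ)) ^ q) ^ (1 / q) := by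
          congr 2; funext n
          rw [ENNReal.mul_rpow_of_nonneg _ _ hq.le, mul_comm]
      _ ≤ _ := ENNReal.rpow_le_rpow h4 (by positivity)
      _ = _ := by
          rw [ENNReal.mul_rpow_of_nonneg _ _ (by positivity), ← ENNReal.rpow_mul,
            ← ENNReal.rpow_mul, mul_comm]
          congr 2
          field_simp

/-- The only place where the condition on p and s is used in full: q < 4 means q' > 4/3, the
threshold of the lattice sum. -/
theorem exists_embedding {s : ℝ} {p p' : ℝ≥0∞} (hp : 1 ≤ p) (hpp' : p.HolderConjugate p')
    (hs : 1 / 2 ≤ s) (hsp : 1 < p' * ENNReal.ofReal (s + 1 / 4)) :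
    ∃ q q' : ℝ, q.HolderConjugate q' ∧ 4 / 3 < q' ∧ ∃ C : ℝ≥0∞, C ≠ ⊤ ∧ ∀ B : ℤ → ℝ≥0∞,
      lqNorm q (fun n => ENNReal.ofReal (Real.sqrt (br n)) * B n) ≤
        C * seqNorm p (fun n => ENNReal.ofReal (jb n ^ s) * B n) := by
  have h34 := three_quarters_sub_lt hp hpp' hs hsp
  have main : ∃ q : ℝ, 3 ≤ q ∧ q < 4 ∧ ∃ C : ℝ≥0∞, C ≠ ⊤ ∧ ∀ f : ℤ → ℝ≥0∞,
      lqNorm q (fun n => ENNReal.ofReal (jb n ^ (-(s - 1 / 2))) * f n) ≤ C * seqNorm p f := by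
    by_cases h4 : p < 4
    · have hpt : p ≠ ⊤ := (h4.trans (by simp)).ne
      have hp4 : p.toReal < 4 := by
        have := (ENNReal.toReal_lt_toReal hpt (by simp)).2 h4
        simpa using this
      -- For p < 4 the inclusion of ℓ^p in ℓ^q is enough, without decay from the weight. The floor 3
      -- merely keeps q away from 1, so that q' exists.
      refine ⟨max p.toReal 3, le_max_right _ _, max_lt hp4 (by norm_num), 1, by simp,
        fun f => ?_⟩
      rw [one_mul]
      refine le_trans ?_ (lqNorm_le_seqNorm hpt hp (le_max_left _ 3) f)
      unfold lqNorm
      have : (0 : ℝ) ≤ max p.toReal 3 := le_max_of_le_right (by norm_num)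
      gcongr with n
      refine mul_le_of_le_one_left' ?_
      rw [ENNReal.ofReal_le_one]
      exact Real.rpow_le_one_of_one_le_of_nonpos (one_le_jb n) (by linarith)
    · push Not at h4
      -- θ = 1/q has to lie strictly between 1/4 and 1/p + s - 1/2, an interval that is nonempty by
      -- `three_quarters_sub_lt`; the cap 1/3 keeps q ≥ 3.
      set ℓ : ℝ := min (1 / 3) ((p⁻¹).toReal + (s - 1 / 2)) with hℓ
      have hℓ1 : 1 / 4 < ℓ := lt_min (by norm_num) (by linarith)
      have hℓ2 : ℓ ≤ 1 / 3 := min_le_left _ _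
      have hℓ3 : ℓ ≤ (p⁻¹).toReal + (s - 1 / 2) := min_le_right _ _
      set θ : ℝ := (1 / 4 + ℓ) / 2 with hθ
      have hθ1 : 1 / 4 < θ := by rw [hθ]; linarith
      have hθ2 : θ < ℓ := by rw [hθ]; linarith
      have hθ0 : 0 < θ := by linarith
      have hq4 : 1 / θ < 4 := by rw [div_lt_iff₀ hθ0]; linarith
      refine ⟨1 / θ, ?_, hq4, exists_lqNorm_weight_le hp (by positivity) ?_ ?_⟩
      · rw [le_div_iff₀ hθ0]; linarith
      · refine lt_of_lt_of_le ?_ h4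
        have : (4 : ℝ≥0∞) = ENNReal.ofReal 4 := by simp
        rw [this]
        exact (ENNReal.ofReal_lt_ofReal_iff (by norm_num)).2 hq4
      · rw [one_div_one_div]; linarith
  obtain ⟨q, hq3, hq4, C, hC, H⟩ := main
  refine ⟨q, q / (q - 1), ?_, ?_, ENNReal.ofReal (Real.sqrt 2) * C,
    ENNReal.mul_ne_top (by simp) hC, fun B => ?_⟩
  · rw [Real.holderConjugate_iff]
    have : q - 1 ≠ 0 := by linarith
    refine ⟨by linarith, by field_simp; ring⟩
  · rw [div_lt_div_iff₀ (by norm_num) (by linarith)]; linarith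
  · calc lqNorm q (fun n => ENNReal.ofReal (Real.sqrt (br n)) * B n)
        ≤ lqNorm q (fun n => ENNReal.ofReal (Real.sqrt 2) *
          (ENNReal.ofReal (jb n ^ (-(s - 1 / 2))) * (ENNReal.ofReal (jb n ^ s) * B n))) := by
          unfold lqNorm
          have : 0 ≤ q := by linarith
          gcongr with n
          beta_reduce
          rw [← mul_assoc, ← mul_assoc]
          gcongr
          have := jb_pos n
          rw [← ENNReal.ofReal_mul (by positivity), ← ENNReal.ofReal_mul (by positivity)]
          apply ENNReal.ofReal_le_ofReal
          refine (sqrt_br_le n).trans (le_of_eq ?_)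
          rw [mul_assoc, ← Real.rpow_add this]
          congr 2; ring
      _ = ENNReal.ofReal (Real.sqrt 2) * lqNorm q (fun n =>
          (ENNReal.ofReal (jb n ^ (-(s - 1 / 2))) * (ENNReal.ofReal (jb n ^ s) * B n))) := by
          rw [lqNorm_eq_seqNorm (by linarith), lqNorm_eq_seqNorm (by linarith),
            seqNorm_const_mul]
          rw [ENNReal.one_le_ofReal]; linarith
      _ ≤ _ := by
          rw [mul_assoc]
          gcongr
          exact H _

/-! ### The weighted trilinear estimate -/

/-- Weights `v ≥ 1` with `v (m + n) ≤ v m * v n`. -/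
structure IsWeight (v : ℤ → ℝ) : Prop where
  one_le : ∀ n, 1 ≤ v n
  add_le : ∀ m n, v (m + n) ≤ v m * v n

theorem IsWeight.pos {v : ℤ → ℝ} (hv : IsWeight v) (n : ℤ) : 0 < v n := by
  linarith [hv.one_le n]

/-- The multiplier of the nonresonant interaction, after the gain from the oscillation. -/
def gain (a b c : ℤ) : ℝ≥0∞ :=
  if Nonres a b c then
    ENNReal.ofReal (|((a + b + c : ℤ) : ℝ)| / Real.sqrt (gap a b c)) else 0

theorem gap_perm (a b c : ℤ) : gap b a c = gap a b c := by
  unfold gap; rw [add_comm b a]; ring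

theorem nonres_perm {a b c : ℤ} : Nonres b a c ↔ Nonres a b c := by
  unfold Nonres; rw [add_comm b a]; tauto

theorem gain_perm (a b c : ℤ) : gain b a c = gain a b c := by
  unfold gain; rw [gap_perm, add_comm b a]
  simp only [nonres_perm]

theorem gain_swap (a b c : ℤ) : gain a c b = gain a b c := by
  unfold gain; rw [gap_swap, add_right_comm a c b]
  simp only [nonres_swap]

/-- Only the exponent s - 1/2 ≥ 0 is moved from the output to the top input. The output keeps
⟨n⟩^{1/2}, which is part of `mult`. -/
theorem jb_rpow_mul_sqrt_br_le {s : ℝ} (hs : 1 / 2 ≤ s) {m n : ℤ} (h : |n| ≤ 3 * |m|) :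
    jb n ^ s * Real.sqrt (br m) ≤
      Real.sqrt 2 * (3 : ℝ) ^ (s - 1 / 2) * (Real.sqrt (br n) * jb m ^ s) := by
  have hn := jb_pos n
  have hm := jb_pos m
  have e : ∀ k, jb k ^ s = jb k ^ (1 / 2 : ℝ) * jb k ^ (s - 1 / 2) := fun k => by
    rw [← Real.rpow_add (jb_pos k)]; congr 1; ring
  have h1 : jb n ^ (s - 1 / 2) ≤ (3 : ℝ) ^ (s - 1 / 2) * jb m ^ (s - 1 / 2) := by
    rw [← Real.mul_rpow (by norm_num) hm.le]
    exact Real.rpow_le_rpow hn.le (jb_le_three_jb h) (by linarith)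
  have h2 := sqrt_br_le m
  have h3 := jb_rpow_half_le n
  rw [e n, e m]
  calc _ ≤ Real.sqrt (br n) * ((3 : ℝ) ^ (s - 1 / 2) * jb m ^ (s - 1 / 2)) *
        (Real.sqrt 2 * jb m ^ (1 / 2 : ℝ)) := by gcongr
    _ = _ := by ring

/-- Distributes the weights so that the top input carries ⟨a⟩^s and the other two carry the
1/2-derivative weight. Submultiplicativity splits v with constant 1, so nothing depends on v. -/
theorem weight_mul_gain_le {s : ℝ} (hs : 1 / 2 ≤ s) {v : ℤ → ℝ} (hv : IsWeight v) {a b c : ℤ}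
    (hb : |b| ≤ |a|) (hc : |c| ≤ |a|) :
    ENNReal.ofReal (v (a + b + c) * jb (a + b + c) ^ s) * gain a b c ≤
      ENNReal.ofReal (Real.sqrt 2 * (3 : ℝ) ^ (s - 1 / 2)) * (kern a b c *
        (ENNReal.ofReal (v a * jb a ^ s) * ENNReal.ofReal (v b * Real.sqrt (br b)) *
          ENNReal.ofReal (v c * Real.sqrt (br c)))) := by
  unfold gain kern
  by_cases h : Nonres a b c
  swap
  · simp [h]
  simp only [h, hb, hc, and_self, if_true]
  have hg : 0 < gap a b c := by linarith [gap_ge_one h]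
  have pa := br_pos a
  have pb := br_pos b
  have pc := br_pos c
  have pn := br_pos (a + b + c)
  have ja := jb_pos a
  have jn := jb_pos (a + b + c)
  have va := hv.pos a
  have vb := hv.pos b
  have vc := hv.pos c
  have vn := hv.pos (a + b + c)
  have hmult : mult a b c = |((a + b + c : ℤ) : ℝ)| * Real.sqrt (br (a + b + c)) /
      (Real.sqrt (br a) * Real.sqrt (br b) * Real.sqrt (br c) * Real.sqrt (gap a b c)) := by
    rw [mult, Real.sqrt_div (by positivity), Real.sqrt_mul (by positivity), Real.sqrt_sq_eq_abs,
      Real.sqrt_mul (by positivity), Real.sqrt_mul (by positivity), Real.sqrt_mul (by positivity)]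
  have hmn : 0 ≤ mult a b c := Real.sqrt_nonneg _
  rw [← ENNReal.ofReal_mul (by positivity), ← ENNReal.ofReal_mul (by positivity),
    ← ENNReal.ofReal_mul (by positivity), ← ENNReal.ofReal_mul hmn,
    ← ENNReal.ofReal_mul (by positivity)]
  apply ENNReal.ofReal_le_ofReal
  have h3 : |a + b + c| ≤ 3 * |a| := by
    have := abs_add_three a b c
    linarith
  have h1 := jb_rpow_mul_sqrt_br_le hs h3
  have h2 : v (a + b + c) ≤ v a * v b * v c :=
    (hv.add_le _ _).trans (mul_le_mul_of_nonneg_right (hv.add_le _ _) vc.le)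
  rw [hmult]
  have sa := Real.sqrt_pos.2 pa
  have sb := Real.sqrt_pos.2 pb
  have sc := Real.sqrt_pos.2 pc
  have sg := Real.sqrt_pos.2 hg
  have e : Real.sqrt 2 * (3 : ℝ) ^ (s - 1 / 2) * (|((a + b + c : ℤ) : ℝ)| *
      Real.sqrt (br (a + b + c)) /
      (Real.sqrt (br a) * Real.sqrt (br b) * Real.sqrt (br c) * Real.sqrt (gap a b c)) *
      (v a * jb a ^ s * (v b * Real.sqrt (br b)) * (v c * Real.sqrt (br c)))) =
      (v a * v b * v c) * (Real.sqrt 2 * (3 : ℝ) ^ (s - 1 / 2) *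
        (Real.sqrt (br (a + b + c)) * jb a ^ s)) * |((a + b + c : ℤ) : ℝ)| /
        (Real.sqrt (br a) * Real.sqrt (gap a b c)) := by
    field_simp
  rw [e, le_div_iff₀ (by positivity)]
  calc _ = v (a + b + c) * (jb (a + b + c) ^ s * Real.sqrt (br a)) *
        |((a + b + c : ℤ) : ℝ)| := by field_simp
    _ ≤ _ := by gcongr

/-- The weighted norm `‖v ⟨·⟩^s A‖_{ℓ^p}`. -/
def wNorm (p : ℝ≥0∞) (s : ℝ) (v : ℤ → ℝ) (A : ℤ → ℝ≥0∞) : ℝ≥0∞ :=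
  seqNorm p fun n => ENNReal.ofReal (v n * jb n ^ s) * A n

/-- The sum is split according to which of the three frequencies is largest. As `gain` is symmetric,
each piece is the kernel estimate with the inputs permuted, whence the factor 3. -/
theorem exists_trilinear_le {s : ℝ} {p p' : ℝ≥0∞} (hp : 1 ≤ p) (hpp' : p.HolderConjugate p')
    (hs : 1 / 2 ≤ s) (hsp : 1 < p' * ENNReal.ofReal (s + 1 / 4)) :
    ∃ S : ℝ≥0∞, S ≠ ⊤ ∧ ∀ v : ℤ → ℝ, IsWeight v → ∀ A B C : ℤ → ℝ≥0∞,
      wNorm p s v (fun n => ∑' e : ℤ × ℤ, gain (n - (e.1 + e.2)) e.1 e.2 *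
        (A (n - (e.1 + e.2)) * B e.1 * C e.2)) ≤
      S * (wNorm p s v A * wNorm p s v B * wNorm p s v C) := by
  obtain ⟨q, q', hq, hq', K, hK, emb⟩ := exists_embedding hp hpp' hs hsp
  obtain ⟨S, hS, H⟩ := exists_seqNorm_kern_le hq hq'
  set K' := ENNReal.ofReal (Real.sqrt 2 * (3 : ℝ) ^ (s - 1 / 2)) with hK'
  refine ⟨3 * (K' * (S * (K * K))), ?_, fun v hv A B C => ?_⟩
  · exact ENNReal.mul_ne_top (by simp) (ENNReal.mul_ne_top ENNReal.ofReal_ne_top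
      (ENNReal.mul_ne_top hS (ENNReal.mul_ne_top hK hK)))
  set f : (ℤ → ℝ≥0∞) → ℤ → ℝ≥0∞ := fun A n => ENNReal.ofReal (v n * jb n ^ s) * A n with hf
  set g : (ℤ → ℝ≥0∞) → ℤ → ℝ≥0∞ := fun A n =>
    ENNReal.ofReal (v n * Real.sqrt (br n)) * A n with hg
  have hgf : ∀ A, lqNorm q (g A) ≤ K * wNorm p s v A := by
    intro A
    have := emb fun n => ENNReal.ofReal (v n) * A n
    convert this using 2
    · funext n
      simp only [hg]
      rw [mul_comm (v n), ENNReal.ofReal_mul (Real.sqrt_nonneg _), mul_assoc]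
    · unfold wNorm
      congr 1
      funext n
      rw [mul_comm (v n), ENNReal.ofReal_mul (Real.rpow_nonneg (jb_pos n).le _), mul_assoc]
  set Φ : (ℤ → ℝ≥0∞) → (ℤ → ℝ≥0∞) → (ℤ → ℝ≥0∞) → ℤ → ℝ≥0∞ := fun A B C n =>
    ∑' e : ℤ × ℤ, kern (n - (e.1 + e.2)) e.1 e.2 *
      (f A (n - (e.1 + e.2)) * g B e.1 * g C e.2) with hΦ
  have hΦle : ∀ A B C, seqNorm p (Φ A B C) ≤
      S * (K * K) * (wNorm p s v A * wNorm p s v B * wNorm p s v C) := by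
    intro A B C
    calc _ ≤ S * (seqNorm p (f A) * lqNorm q (g B) * lqNorm q (g C)) := H p hp _ _ _
      _ ≤ S * (wNorm p s v A * (K * wNorm p s v B) * (K * wNorm p s v C)) := by
          gcongr
          · exact le_rfl
          · exact hgf B
          · exact hgf C
      _ = _ := by ring
  have hpt : ∀ (A B C : ℤ → ℝ≥0∞) (a b c : ℤ), |b| ≤ |a| → |c| ≤ |a| →
      ENNReal.ofReal (v (a + b + c) * jb (a + b + c) ^ s) * (gain a b c * (A a * B b * C c)) ≤
        K' * (kern a b c * (f A a * g B b * g C c)) := by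
    intro A B C a b c hb hc
    have := mul_le_mul_left (weight_mul_gain_le hs hv hb hc) (A a * B b * C c)
    calc _ = _ := by rw [← mul_assoc]
      _ ≤ _ := this
      _ = _ := by simp only [hf, hg]; ring
  have hsum : ∀ n, f (fun n => ∑' e : ℤ × ℤ, gain (n - (e.1 + e.2)) e.1 e.2 *
      (A (n - (e.1 + e.2)) * B e.1 * C e.2)) n ≤
      K' * (Φ A B C n + Φ B A C n + Φ C B A n) := by
    intro n
    have i1 : Φ B A C n = ∑' e : ℤ × ℤ, kern e.1 (n - (e.1 + e.2)) e.2 *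
        (f B e.1 * g A (n - (e.1 + e.2)) * g C e.2) := by
      let σ : ℤ × ℤ ≃ ℤ × ℤ :=
        { toFun := fun e => (n - (e.1 + e.2), e.2)
          invFun := fun e => (n - (e.1 + e.2), e.2)
          left_inv := fun e => by ext <;> simp only; ring
          right_inv := fun e => by ext <;> simp only; ring }
      rw [hΦ]
      simp only
      rw [← σ.tsum_eq]
      congr 1
      funext e
      simp only [σ, Equiv.coe_fn_mk]
      rw [show n - (n - (e.1 + e.2) + e.2) = e.1 by ring]
    have i2 : Φ C B A n = ∑' e : ℤ × ℤ, kern e.2 e.1 (n - (e.1 + e.2)) *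
        (f C e.2 * g B e.1 * g A (n - (e.1 + e.2))) := by
      let σ : ℤ × ℤ ≃ ℤ × ℤ :=
        { toFun := fun e => (e.1, n - (e.1 + e.2))
          invFun := fun e => (e.1, n - (e.1 + e.2))
          left_inv := fun e => by ext <;> simp only; ring
          right_inv := fun e => by ext <;> simp only; ring }
      rw [hΦ]
      simp only
      rw [← σ.tsum_eq]
      congr 1
      funext e
      simp only [σ, Equiv.coe_fn_mk]
      rw [show n - (e.1 + (n - (e.1 + e.2))) = e.2 by ring]
    rw [i1, i2, hΦ]
    simp only
    rw [← ENNReal.tsum_add, ← ENNReal.tsum_add, ← ENNReal.tsum_mul_left]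
    simp only [hf]
    rw [← ENNReal.tsum_mul_left]
    refine ENNReal.tsum_le_tsum fun e => ?_
    obtain ⟨b, c⟩ := e
    simp only
    set a := n - (b + c) with ha
    have hn : n = a + b + c := by rw [ha]; ring
    rw [mul_add, mul_add]
    rcases le_total |b| |a| with h1 | h1
    · rcases le_total |c| |a| with h2 | h2
      · rw [hn]
        exact (hpt A B C a b c h1 h2).trans (le_add_right (le_add_right le_rfl))
      · rw [hn]
        have := hpt C B A c b a (h1.trans h2) h2
        refine le_trans (le_of_eq ?_) (this.trans (le_add_left le_rfl))
        rw [show c + b + a = a + b + c by ring,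
          show gain c b a = gain a b c by rw [gain_perm, gain_swap, gain_perm]]
        ring
    · rcases le_total |c| |b| with h2 | h2
      · rw [hn]
        have := hpt B A C b a c h1 h2
        refine le_trans (le_of_eq ?_) (this.trans ?_)
        · rw [show b + a + c = a + b + c by ring, gain_perm]; ring
        · exact le_add_right (le_add_left le_rfl)
      · rw [hn]
        have := hpt C B A c b a h2 (h1.trans h2)
        refine le_trans (le_of_eq ?_) (this.trans (le_add_left le_rfl))
        rw [show c + b + a = a + b + c by ring,
          show gain c b a = gain a b c by rw [gain_perm, gain_swap, gain_perm]]
        ring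
  calc _ ≤ seqNorm p (fun n => K' * (Φ A B C n + Φ B A C n + Φ C B A n)) := seqNorm_mono hsum
    _ = K' * seqNorm p (fun n => Φ A B C n + Φ B A C n + Φ C B A n) := seqNorm_const_mul hp _ _
    _ ≤ K' * (seqNorm p (Φ A B C) + seqNorm p (Φ B A C) + seqNorm p (Φ C B A)) := by
        gcongr
        exact (seqNorm_add_le hp _ _).trans (add_le_add (seqNorm_add_le hp _ _) le_rfl)
    _ ≤ K' * (S * (K * K) * (wNorm p s v A * wNorm p s v B * wNorm p s v C) +
          S * (K * K) * (wNorm p s v B * wNorm p s v A * wNorm p s v C) +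
          S * (K * K) * (wNorm p s v C * wNorm p s v B * wNorm p s v A)) := by
        gcongr <;> apply hΦle
    _ = _ := by ring

end MKdV

end

/-! ### The contraction argument for the profile equation -/

noncomputable section

namespace MKdV

/-! ### Fixed points of cubic perturbations of the identity -/

section fixedPoint

variable {X : Type*} [NormedAddCommGroup X]

/-- A bounded trilinear map, additivity being recorded as a difference identity. -/
structure IsTrilinearBound (T : X → X → X → X) (κ : ℝ) : Prop where
  norm_le : ∀ b c d, ‖T b c d‖ ≤ κ * (‖b‖ * ‖c‖ * ‖d‖)
  sub : ∀ b c d b' c' d', T b c d - T b' c' d' =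
    T (b - b') c d + T b' (c - c') d + T b' c' (d - d')

variable {T : X → X → X → X} {κ R : ℝ}

/-- On the ball of radius 2R each of the three slots contributes κ(2R)², in total 12κR² ≤ 1/2; hence
the number 24 in the smallness condition. -/
theorem IsTrilinearBound.norm_sub_le (hT : IsTrilinearBound T κ) (hκ : 0 ≤ κ) (hR : 0 ≤ R)
    (hκR : 24 * (κ * R ^ 2) ≤ 1) {b b' : X} (hb : ‖b‖ ≤ 2 * R) (hb' : ‖b'‖ ≤ 2 * R) :
    ‖T b b b - T b' b' b'‖ ≤ 1 / 2 * ‖b - b'‖ := by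
  rw [hT.sub]
  have h0 := norm_nonneg (b - b')
  have h1 : ‖T (b - b') b b‖ ≤ κ * (‖b - b'‖ * (2 * R) * (2 * R)) :=
    (hT.norm_le _ _ _).trans (by gcongr)
  have h2 : ‖T b' (b - b') b‖ ≤ κ * ((2 * R) * ‖b - b'‖ * (2 * R)) :=
    (hT.norm_le _ _ _).trans (by gcongr)
  have h3 : ‖T b' b' (b - b')‖ ≤ κ * ((2 * R) * (2 * R) * ‖b - b'‖) :=
    (hT.norm_le _ _ _).trans (by gcongr)
  calc _ ≤ ‖T (b - b') b b‖ + ‖T b' (b - b') b‖ + ‖T b' b' (b - b')‖ := norm_add₃_le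
    _ ≤ 12 * (κ * R ^ 2) * ‖b - b'‖ := by linarith
    _ ≤ _ := by gcongr; linarith

theorem IsTrilinearBound.lipschitz (hT : IsTrilinearBound T κ) (hκ : 0 ≤ κ) (hR : 0 ≤ R)
    (hκR : 24 * (κ * R ^ 2) ≤ 1) {x b x' b' : X} (hb : ‖b‖ ≤ 2 * R) (hb' : ‖b'‖ ≤ 2 * R)
    (h : b = x + T b b b) (h' : b' = x' + T b' b' b') : ‖b - b'‖ ≤ 2 * ‖x - x'‖ := by
  have h1 := hT.norm_sub_le hκ hR hκR hb hb'
  have h2 : b - b' = (x - x') + (T b b b - T b' b' b') := by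
    nth_rewrite 1 [h]; nth_rewrite 1 [h']; abel
  have h3 := norm_add_le (x - x') (T b b b - T b' b' b')
  rw [← h2] at h3
  linarith

theorem IsTrilinearBound.exists_fixedPoint [CompleteSpace X] (hT : IsTrilinearBound T κ)
    (hκ : 0 ≤ κ) (hR : 0 ≤ R) (hκR : 24 * (κ * R ^ 2) ≤ 1) {x : X} (hx : ‖x‖ ≤ R) :
    ∃ b, ‖b‖ ≤ 2 * R ∧ b = x + T b b b := by
  set f : X → X := fun b => x + T b b b with hf
  have hmaps : Set.MapsTo f (Metric.closedBall 0 (2 * R)) (Metric.closedBall 0 (2 * R)) := by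
    intro b hb
    rw [mem_closedBall_zero_iff] at hb ⊢
    have h1 : ‖T b b b‖ ≤ κ * ((2 * R) * (2 * R) * (2 * R)) :=
      (hT.norm_le _ _ _).trans (by gcongr)
    have h2 : κ * ((2 * R) * (2 * R) * (2 * R)) ≤ R := by
      have : κ * ((2 * R) * (2 * R) * (2 * R)) = 8 * (κ * R ^ 2) * R := by ring
      rw [this]
      have : 8 * (κ * R ^ 2) ≤ 1 := by
        have : 0 ≤ κ * R ^ 2 := by positivity
        linarith
      nlinarith
    calc ‖x + T b b b‖ ≤ ‖x‖ + ‖T b b b‖ := norm_add_le _ _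
      _ ≤ 2 * R := by linarith
  have hc : ContractingWith (1 / 2) (hmaps.restrict f _ _) := by
    refine ⟨by rw [div_lt_one (by norm_num)]; norm_num, LipschitzWith.of_dist_le_mul ?_⟩
    rintro ⟨b, hb⟩ ⟨b', hb'⟩
    rw [mem_closedBall_zero_iff] at hb hb'
    rw [Subtype.dist_eq, Subtype.dist_eq, dist_eq_norm, dist_eq_norm]
    simp only [Set.MapsTo.val_restrict_apply, hf, add_sub_add_left_eq_sub]
    simpa using hT.norm_sub_le hκ hR hκR hb hb'
  obtain ⟨b, hb, hfix, -⟩ := hc.exists_fixedPoint' Metric.isClosed_closedBall.isComplete hmaps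
    (x := 0) (by simpa using hR) (edist_ne_top _ _)
  exact ⟨b, by simpa using hb, hfix.symm⟩

end fixedPoint

/-! ### Sequence norms and `lp` -/

section

variable {E : Type*} [NormedAddCommGroup E] {p : ℝ≥0∞}

theorem memℓp_of_seqNorm_ne_top (hp1 : 1 ≤ p) {y : ℤ → E}
    (h : seqNorm p (fun n => ‖y n‖ₑ) ≠ ⊤) : Memℓp y p := by
  by_cases hp : p = ⊤
  · subst hp
    refine memℓp_infty ⟨(seqNorm ⊤ fun n => ‖y n‖ₑ).toReal, ?_⟩
    rintro _ ⟨n, rfl⟩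
    have := ENNReal.toReal_mono h (le_seqNorm hp1 (fun n => ‖y n‖ₑ) n)
    simpa using this
  · have h0 : 0 < p.toReal := by linarith [toReal_ge_one hp1 hp]
    refine memℓp_gen ?_
    rw [seqNorm_of_ne_top hp] at h
    have h1 : ∑' n, ‖y n‖ₑ ^ p.toReal ≠ ⊤ := fun h2 => h (by
      rw [h2, ENNReal.top_rpow_of_pos (by positivity)])
    have := ENNReal.summable_toReal h1
    simpa [← ENNReal.toReal_rpow] using this

/-- The estimates are carried out in [0, ∞], where sums need no convergence proof. This identity and
`memℓp_of_seqNorm_ne_top` carry them over to the Banach space in which the fixed point is taken. -/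
theorem seqNorm_enorm [Fact (1 ≤ p)] (y : lp (fun _ : ℤ => E) p) :
    seqNorm p (fun n => ‖y n‖ₑ) = ‖y‖ₑ := by
  have hp1 : 1 ≤ p := Fact.out
  have hp0 : p ≠ 0 := by rintro rfl; simp at hp1
  by_cases hp : p = ⊤
  · subst hp
    rw [seqNorm_top]
    apply le_antisymm
    · refine iSup_le fun n => ?_
      rw [← ofReal_norm, ← ofReal_norm]
      exact ENNReal.ofReal_le_ofReal (lp.norm_apply_le_norm (by simp) y n)
    · by_cases ht : (⨆ n, ‖y n‖ₑ) = ⊤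
      · rw [ht]; exact le_top
      · rw [← ofReal_norm, ENNReal.ofReal_le_iff_le_toReal ht]
        refine lp.norm_le_of_forall_le ENNReal.toReal_nonneg fun n => ?_
        have := ENNReal.toReal_mono ht (le_iSup (fun n => ‖y n‖ₑ) n)
        simpa using this
  · have h0 : 0 < p.toReal := by linarith [toReal_ge_one hp1 hp]
    rw [seqNorm_of_ne_top hp, ← ofReal_norm, lp.norm_eq_tsum_rpow h0,
      ← ENNReal.ofReal_rpow_of_nonneg
        (tsum_nonneg fun n => Real.rpow_nonneg (norm_nonneg _) _) (by positivity),
      ENNReal.ofReal_tsum_of_nonneg (fun n => Real.rpow_nonneg (norm_nonneg _) _)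
        ((lp.memℓp y).summable h0)]
    congr 2
    funext n
    rw [← ofReal_norm, ENNReal.ofReal_rpow_of_nonneg (norm_nonneg _) h0.le]

end

/-! ### The cubic Duhamel operator -/

/-- The phase `a³ + b³ + c³ - (a + b + c)³`. -/
def phase (a b c : ℤ) : ℝ := ((-3 * ((a + b) * (b + c) * (a + c)) : ℤ) : ℝ)

/-- Rests on the factorisation a³ + b³ + c³ - (a+b+c)³ = -3(a+b)(b+c)(a+c), built into `phase`:
nonresonance is nonvanishing of the phase. -/
theorem abs_phase (a b c : ℤ) : |phase a b c| = 3 * gap a b c := by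
  unfold phase gap
  push_cast
  rw [abs_mul, abs_mul, abs_mul]
  norm_num

variable {δ : ℝ} (hδ : 0 < δ)

/-- The nonresonant interaction of the frequencies `n - e.1 - e.2`, `e.1`, `e.2`. -/
def cubicTerm (A B C : ℤ → Holder δ) (n : ℤ) (e : ℤ × ℤ) : Holder δ :=
  if Nonres (n - (e.1 + e.2)) e.1 e.2 then
    (-(Complex.I * n / 3)) • Holder.duhamel hδ (phase (n - (e.1 + e.2)) e.1 e.2)
      (A (n - (e.1 + e.2))) (B e.1) (C e.2)
  else 0

/-- The Duhamel operator of the renormalised equation in the interaction representation. -/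
def cubic (A B C : ℤ → Holder δ) (n : ℤ) : Holder δ :=
  (Complex.I * n) • Holder.duhamel hδ 0 (A n) (B n) (C (-n)) + ∑' e, cubicTerm hδ A B C n e

theorem enorm_cubicTerm_le (A B C : ℤ → Holder δ) (n : ℤ) (e : ℤ × ℤ) :
    ‖cubicTerm hδ A B C n e‖ₑ ≤ ENNReal.ofReal (8 * Real.sqrt δ) *
      (gain (n - (e.1 + e.2)) e.1 e.2 *
        (‖A (n - (e.1 + e.2))‖ₑ * ‖B e.1‖ₑ * ‖C e.2‖ₑ)) := by
  unfold cubicTerm gain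
  split_ifs with h
  swap
  · simp
  have hg := gap_ge_one h
  have hφ : phase (n - (e.1 + e.2)) e.1 e.2 ≠ 0 := by
    rw [← abs_pos, abs_phase]; linarith
  have h1 := Holder.norm_duhamel_le_of_ne_zero hδ (phase (n - (e.1 + e.2)) e.1 e.2)
      (A (n - (e.1 + e.2))) (B e.1) (C e.2) hφ
  rw [← ofReal_norm, ← ofReal_norm, ← ofReal_norm, ← ofReal_norm,
    ← ENNReal.ofReal_mul (by positivity), ← ENNReal.ofReal_mul (by positivity),
    ← ENNReal.ofReal_mul (by positivity), ← ENNReal.ofReal_mul (by positivity)]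
  apply ENNReal.ofReal_le_ofReal
  have hn : n - (e.1 + e.2) + e.1 + e.2 = n := by ring
  rw [hn, norm_smul]
  have h2 : ‖-(Complex.I * (n : ℂ) / 3)‖ ≤ |(n : ℝ)| := by
    rw [norm_neg, norm_div, norm_mul, Complex.norm_I, one_mul, Complex.norm_intCast]
    have := abs_nonneg (n : ℝ)
    simp only [Complex.norm_ofNat]
    linarith
  have hg0 : 0 < Real.sqrt (gap (n - (e.1 + e.2)) e.1 e.2) := Real.sqrt_pos.2 (by linarith)
  have h3 : Real.sqrt (gap (n - (e.1 + e.2)) e.1 e.2) ≤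
      Real.sqrt |phase (n - (e.1 + e.2)) e.1 e.2| := by
    rw [abs_phase]; apply Real.sqrt_le_sqrt; linarith
  calc _ ≤ |(n : ℝ)| * (8 * Real.sqrt δ / Real.sqrt (gap (n - (e.1 + e.2)) e.1 e.2) *
        (‖A (n - (e.1 + e.2))‖ * ‖B e.1‖ * ‖C e.2‖)) := by
        refine mul_le_mul h2 (h1.trans ?_) (norm_nonneg _) (abs_nonneg _)
        gcongr
    _ = _ := by ring

theorem enorm_tsum_le {ι E : Type*} [NormedAddCommGroup E] (f : ι → E) :
    ‖∑' i, f i‖ₑ ≤ ∑' i, ‖f i‖ₑ := by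
  by_cases h : ∑' i, ‖f i‖ₑ = ⊤
  · rw [h]; exact le_top
  have hs : Summable fun i => ‖f i‖ := by
    have := ENNReal.summable_toReal h
    simpa using this
  rw [← ofReal_norm]
  refine (ENNReal.ofReal_le_ofReal (norm_tsum_le_tsum_norm hs)).trans ?_
  rw [ENNReal.ofReal_tsum_of_nonneg (fun _ => norm_nonneg _) hs]
  simp

theorem enorm_cubic_le (A B C : ℤ → Holder δ) (n : ℤ) :
    ‖cubic hδ A B C n‖ₑ ≤ ENNReal.ofReal (2 * δ) *
        (ENNReal.ofReal |(n : ℝ)| * (‖A n‖ₑ * ‖B n‖ₑ * ‖C (-n)‖ₑ)) +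
      ENNReal.ofReal (8 * Real.sqrt δ) * ∑' e : ℤ × ℤ, gain (n - (e.1 + e.2)) e.1 e.2 *
        (‖A (n - (e.1 + e.2))‖ₑ * ‖B e.1‖ₑ * ‖C e.2‖ₑ) := by
  unfold cubic
  refine (enorm_add_le _ _).trans (add_le_add ?_ ?_)
  · rw [← ofReal_norm, ← ofReal_norm, ← ofReal_norm, ← ofReal_norm,
      ← ENNReal.ofReal_mul (by positivity), ← ENNReal.ofReal_mul (by positivity),
      ← ENNReal.ofReal_mul (by positivity), ← ENNReal.ofReal_mul (by positivity)]
    apply ENNReal.ofReal_le_ofReal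
    rw [norm_smul, norm_mul, Complex.norm_I, one_mul, Complex.norm_intCast]
    calc _ ≤ |(n : ℝ)| * (2 * δ * (‖A n‖ * ‖B n‖ * ‖C (-n)‖)) := by
          gcongr; exact Holder.norm_duhamel_le hδ 0 _ _ _
      _ = _ := by ring
  · rw [← ENNReal.tsum_mul_left]
    exact (enorm_tsum_le _).trans (ENNReal.tsum_le_tsum (enorm_cubicTerm_le hδ A B C n))

/-- There is no oscillation to exploit here, so the derivative n must be paid for by two of the
factors: |n| ≤ ⟨n⟩^s⟨-n⟩^s because 2s ≥ 1. -/
theorem wNorm_resonant_le {s : ℝ} {p : ℝ≥0∞} (hp : 1 ≤ p) (hs : 1 / 2 ≤ s) {v : ℤ → ℝ}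
    (hv : IsWeight v) (A B C : ℤ → ℝ≥0∞) :
    wNorm p s v (fun n => ENNReal.ofReal |(n : ℝ)| * (A n * B n * C (-n))) ≤
      wNorm p s v A * wNorm p s v B * wNorm p s v C := by
  have hw : ∀ n, 0 < v n * jb n ^ s := fun n =>
    mul_pos (hv.pos n) (Real.rpow_pos_of_pos (jb_pos n) _)
  have key : ∀ n, ENNReal.ofReal (v n * jb n ^ s) *
      (ENNReal.ofReal |(n : ℝ)| * (A n * B n * C (-n))) ≤
      (wNorm p s v B * wNorm p s v C) * (ENNReal.ofReal (v n * jb n ^ s) * A n) := by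
    intro n
    have hB := le_seqNorm hp (fun n => ENNReal.ofReal (v n * jb n ^ s) * B n) n
    have hC := le_seqNorm hp (fun n => ENNReal.ofReal (v n * jb n ^ s) * C n) (-n)
    have hn : ENNReal.ofReal |(n : ℝ)| ≤
        ENNReal.ofReal (v n * jb n ^ s) * ENNReal.ofReal (v (-n) * jb (-n) ^ s) := by
      rw [← ENNReal.ofReal_mul (hw n).le]
      apply ENNReal.ofReal_le_ofReal
      have h1 : |(n : ℝ)| ≤ jb n := by
        unfold jb
        rw [← Real.sqrt_sq_eq_abs]
        apply Real.sqrt_le_sqrt; linarith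
      have h2 : jb n ^ (1 / 2 : ℝ) ≤ jb n ^ s :=
        Real.rpow_le_rpow_of_exponent_le (one_le_jb n) hs
      have h3 : jb n = jb n ^ (1 / 2 : ℝ) * jb n ^ (1 / 2 : ℝ) := by
        rw [← Real.rpow_add (jb_pos n)]; norm_num
      rw [jb_neg]
      have h4 : 0 < jb n ^ (1 / 2 : ℝ) := Real.rpow_pos_of_pos (jb_pos n) _
      have h5 : jb n ^ (1 / 2 : ℝ) ≤ v n * jb n ^ s := by
        nlinarith [hv.one_le n]
      have h6 : jb n ^ (1 / 2 : ℝ) ≤ v (-n) * jb n ^ s := by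
        nlinarith [hv.one_le (-n)]
      calc |(n : ℝ)| ≤ jb n ^ (1 / 2 : ℝ) * jb n ^ (1 / 2 : ℝ) := by rwa [← h3]
        _ ≤ _ := by
          have := (hw n).le
          gcongr
    calc _ ≤ ENNReal.ofReal (v n * jb n ^ s) * (ENNReal.ofReal (v n * jb n ^ s) *
          ENNReal.ofReal (v (-n) * jb (-n) ^ s) * (A n * B n * C (-n))) := by gcongr
      _ = (ENNReal.ofReal (v n * jb n ^ s) * B n) *
          (ENNReal.ofReal (v (-n) * jb (-n) ^ s) * C (-n)) *
          (ENNReal.ofReal (v n * jb n ^ s) * A n) := by ring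
      _ ≤ _ := by
          gcongr
          · exact hB
          · exact hC
  calc _ ≤ seqNorm p (fun n => (wNorm p s v B * wNorm p s v C) *
        (ENNReal.ofReal (v n * jb n ^ s) * A n)) := seqNorm_mono key
    _ = _ := by rw [seqNorm_const_mul hp]; unfold wNorm; ring

/-- The weighted norm of a family of Hölder functions. -/
def wn (p : ℝ≥0∞) (s : ℝ) (v : ℤ → ℝ) (A : ℤ → Holder δ) : ℝ≥0∞ :=
  wNorm p s v fun n => ‖A n‖ₑ

theorem wNorm_mono {p : ℝ≥0∞} {s : ℝ} {v : ℤ → ℝ} {A B : ℤ → ℝ≥0∞} (h : ∀ n, A n ≤ B n) :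
    wNorm p s v A ≤ wNorm p s v B := seqNorm_mono fun n => by gcongr; exact h n

theorem wNorm_add_le {p : ℝ≥0∞} (hp : 1 ≤ p) {s : ℝ} {v : ℤ → ℝ} (A B : ℤ → ℝ≥0∞) :
    wNorm p s v (fun n => A n + B n) ≤ wNorm p s v A + wNorm p s v B := by
  unfold wNorm
  simp_rw [mul_add]
  exact seqNorm_add_le hp _ _

theorem wNorm_const_mul {p : ℝ≥0∞} (hp : 1 ≤ p) {s : ℝ} {v : ℤ → ℝ} (c : ℝ≥0∞)
    (A : ℤ → ℝ≥0∞) : wNorm p s v (fun n => c * A n) = c * wNorm p s v A := by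
  unfold wNorm
  rw [← seqNorm_const_mul hp]
  congr 1; funext n; ring

/-- The resonant part contributes 2δ ≤ 2√δ and the nonresonant part 8√δ·S, with constants chosen
before the weight v. Summability is recorded as well, since an unconditional sum defaults to 0 when
it diverges and additivity would then fail. -/
theorem exists_wn_cubic_le {s : ℝ} {p p' : ℝ≥0∞} (hp : 1 ≤ p) (hpp' : p.HolderConjugate p')
    (hs : 1 / 2 ≤ s) (hsp : 1 < p' * ENNReal.ofReal (s + 1 / 4)) :
    ∃ κ : ℝ, 0 < κ ∧ ∀ (δ : ℝ) (hδ : 0 < δ), δ ≤ 1 → ∀ v : ℤ → ℝ, IsWeight v →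
      ∀ A B C : ℤ → Holder δ,
      wn p s v (cubic hδ A B C) ≤
        ENNReal.ofReal (κ * Real.sqrt δ) * (wn p s v A * wn p s v B * wn p s v C) ∧
      (wn p s v A ≠ ⊤ → wn p s v B ≠ ⊤ → wn p s v C ≠ ⊤ →
        ∀ n, Summable (cubicTerm hδ A B C n)) := by
  obtain ⟨S, hS, H⟩ := exists_trilinear_le hp hpp' hs hsp
  refine ⟨2 + 8 * S.toReal, by positivity, fun δ hδ hδ1 v hv A B C => ⟨?_, ?_⟩⟩
  · have h1 := H v hv (fun n => ‖A n‖ₑ) (fun n => ‖B n‖ₑ) (fun n => ‖C n‖ₑ)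
    have h2 := wNorm_resonant_le hp hs hv (fun n => ‖A n‖ₑ) (fun n => ‖B n‖ₑ) (fun n => ‖C n‖ₑ)
    have hsq : δ ≤ Real.sqrt δ := Real.le_sqrt_of_sq_le (by nlinarith)
    have hκ : ENNReal.ofReal ((2 + 8 * S.toReal) * Real.sqrt δ) =
        ENNReal.ofReal (2 * Real.sqrt δ) + ENNReal.ofReal (8 * Real.sqrt δ) * S := by
      rw [show ENNReal.ofReal (8 * Real.sqrt δ) * S =
        ENNReal.ofReal (8 * Real.sqrt δ) * ENNReal.ofReal S.toReal by
          rw [ENNReal.ofReal_toReal hS], ← ENNReal.ofReal_mul (by positivity), ← ENNReal.ofReal_add (by positivity)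
        (by positivity)]
      congr 1; ring
    rw [hκ]
    unfold wn
    refine (wNorm_mono (enorm_cubic_le hδ A B C)).trans ((wNorm_add_le hp _ _).trans ?_)
    rw [wNorm_const_mul hp, wNorm_const_mul hp, add_mul]
    refine add_le_add (mul_le_mul' (ENNReal.ofReal_le_ofReal (by linarith)) h2) ?_
    rw [mul_assoc]
    exact mul_le_mul' le_rfl h1
  · intro hA hB hC n
    have h1 := H v hv (fun n => ‖A n‖ₑ) (fun n => ‖B n‖ₑ) (fun n => ‖C n‖ₑ)
    have h2 := (le_seqNorm hp _ n).trans h1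
    have h3 : S * (wn p s v A * wn p s v B * wn p s v C) ≠ ⊤ :=
      ENNReal.mul_ne_top hS (ENNReal.mul_ne_top (ENNReal.mul_ne_top hA hB) hC)
    have h4 := ne_top_of_le_ne_top h3 h2
    have hw : ENNReal.ofReal (v n * jb n ^ s) ≠ 0 := by
      rw [Ne, ENNReal.ofReal_eq_zero, not_le]
      exact mul_pos (hv.pos n) (Real.rpow_pos_of_pos (jb_pos n) _)
    have h5 : ∑' e : ℤ × ℤ, gain (n - (e.1 + e.2)) e.1 e.2 *
        (‖A (n - (e.1 + e.2))‖ₑ * ‖B e.1‖ₑ * ‖C e.2‖ₑ) ≠ ⊤ := by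
      intro h6
      simp only [h6] at h4
      exact h4 (ENNReal.mul_top hw)
    have h6 : ∑' e, ‖cubicTerm hδ A B C n e‖ₑ ≠ ⊤ := by
      have h7 := ENNReal.tsum_le_tsum (enorm_cubicTerm_le hδ A B C n)
      rw [ENNReal.tsum_mul_left] at h7
      exact ne_top_of_le_ne_top (ENNReal.mul_ne_top ENNReal.ofReal_ne_top h5) h7
    have h7 := ENNReal.summable_toReal h6
    exact Summable.of_norm (by simpa using h7)

theorem cubic_sub_cubic {A B C A' B' C' : ℤ → Holder δ} {n : ℤ}
    (h1 : Summable (cubicTerm hδ (A - A') B C n)) (h2 : Summable (cubicTerm hδ A' (B - B') C n))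
    (h3 : Summable (cubicTerm hδ A' B' (C - C') n)) (h4 : Summable (cubicTerm hδ A B C n))
    (h5 : Summable (cubicTerm hδ A' B' C' n)) :
    cubic hδ A B C n - cubic hδ A' B' C' n = cubic hδ (A - A') B C n +
      cubic hδ A' (B - B') C n + cubic hδ A' B' (C - C') n := by
  have e1 : ∑' e, cubicTerm hδ A B C n e - ∑' e, cubicTerm hδ A' B' C' n e =
      ∑' e, cubicTerm hδ (A - A') B C n e + ∑' e, cubicTerm hδ A' (B - B') C n e +
        ∑' e, cubicTerm hδ A' B' (C - C') n e := by
    rw [← h4.tsum_sub h5, ← h1.tsum_add h2, ← (h1.add h2).tsum_add h3]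
    congr 1
    funext e
    unfold cubicTerm
    split_ifs with h
    · rw [← smul_sub, Holder.duhamel_sub_duhamel, smul_add, smul_add]; rfl
    · simp
  unfold cubic
  rw [add_sub_add_comm, e1, ← smul_sub, Holder.duhamel_sub_duhamel, smul_add, smul_add]
  simp only [Pi.sub_apply]
  abel

/-! ### Existence and Lipschitz dependence of mild solutions -/

/-- `a` solves the renormalised equation with initial data `α`. -/
def IsMild (α : ℤ → ℂ) (a : ℤ → Holder δ) : Prop :=
  ∀ n, a n = Holder.const δ (α n) + cubic hδ a a a n

section

variable {p : ℝ≥0∞} {s : ℝ} {v : ℤ → ℝ}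

/-- Removing the weight from an element of `ℓ^p`. -/
def unweight (s : ℝ) (v : ℤ → ℝ) (b : lp (fun _ : ℤ => Holder δ) p) (n : ℤ) : Holder δ :=
  (((v n * jb n ^ s)⁻¹ : ℝ) : ℂ) • b n

theorem weight_pos (hv : IsWeight v) (n : ℤ) : 0 < v n * jb n ^ s :=
  mul_pos (hv.pos n) (Real.rpow_pos_of_pos (jb_pos n) _)

theorem enorm_weight_smul {x : ℝ} (hx : 0 ≤ x) (a : Holder δ) :
    ‖(x : ℂ) • a‖ₑ = ENNReal.ofReal x * ‖a‖ₑ := by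
  rw [enorm_smul, ← ofReal_norm (x : ℂ), Complex.norm_real, Real.norm_of_nonneg hx]

theorem weight_smul_unweight (hv : IsWeight v) (b : lp (fun _ : ℤ => Holder δ) p) (n : ℤ) :
    ((v n * jb n ^ s : ℝ) : ℂ) • unweight s v b n = b n := by
  rw [unweight, smul_smul, ← Complex.ofReal_mul, mul_inv_cancel₀ (weight_pos hv n).ne']
  simp

theorem wn_unweight [Fact (1 ≤ p)] (hv : IsWeight v) (b : lp (fun _ : ℤ => Holder δ) p) :
    wn p s v (unweight s v b) = ‖b‖ₑ := by
  rw [← seqNorm_enorm b]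
  unfold wn wNorm
  congr 1
  funext n
  rw [← enorm_weight_smul (weight_pos hv n).le, weight_smul_unweight hv]

theorem unweight_sub (b c : lp (fun _ : ℤ => Holder δ) p) :
    unweight s v (b - c) = unweight s v b - unweight s v c := by
  funext n
  simp only [unweight, Pi.sub_apply, lp.coeFn_sub, smul_sub]

/-- Multiplying a family of finite weighted norm by the weight. -/
def weight [Fact (1 ≤ p)] (hv : IsWeight v) (A : ℤ → Holder δ) (h : wn p s v A ≠ ⊤) :
    lp (fun _ : ℤ => Holder δ) p :=
  ⟨fun n => ((v n * jb n ^ s : ℝ) : ℂ) • A n, memℓp_of_seqNorm_ne_top Fact.out (by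
    have : (fun n => ‖((v n * jb n ^ s : ℝ) : ℂ) • A n‖ₑ) =
      fun n => ENNReal.ofReal (v n * jb n ^ s) * ‖A n‖ₑ :=
        funext fun n => enorm_weight_smul (weight_pos hv n).le _
    rw [this]; exact h)⟩

theorem enorm_weight [Fact (1 ≤ p)] (hv : IsWeight v) (A : ℤ → Holder δ) (h : wn p s v A ≠ ⊤) :
    ‖weight hv A h‖ₑ = wn p s v A := by
  rw [← seqNorm_enorm]
  unfold wn wNorm
  congr 1
  funext n
  exact enorm_weight_smul (weight_pos hv n).le _

theorem unweight_weight [Fact (1 ≤ p)] (hv : IsWeight v) (A : ℤ → Holder δ) (h : wn p s v A ≠ ⊤) :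
    unweight s v (weight hv A h) = A := by
  funext n
  change (((v n * jb n ^ s)⁻¹ : ℝ) : ℂ) • (((v n * jb n ^ s : ℝ) : ℂ) • A n) = A n
  rw [smul_smul, ← Complex.ofReal_mul, inv_mul_cancel₀ (weight_pos hv n).ne']
  simp

theorem unweight_injective (hv : IsWeight v) {b c : lp (fun _ : ℤ => Holder δ) p}
    (h : unweight s v b = unweight s v c) : b = c := by
  apply lp.ext
  funext n
  rw [← weight_smul_unweight (s := s) hv b n, ← weight_smul_unweight (s := s) hv c n, h]

/-- The norm of the data of the renormalised equation. -/
def dn (p : ℝ≥0∞) (s : ℝ) (v : ℤ → ℝ) (α : ℤ → ℂ) : ℝ≥0∞ := wNorm p s v fun n => ‖α n‖ₑ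

theorem wn_const (α : ℤ → ℂ) : wn p s v (fun n => Holder.const δ (α n)) = dn p s v α := by
  unfold wn dn
  congr 1
  funext n
  rw [← ofReal_norm, ← ofReal_norm, Holder.norm_const]

end

/-- Local solvability of the renormalised equation: on a time interval depending only on the size
of the data, uniformly over submultiplicative weights. -/
theorem exists_solvable {s : ℝ} {p p' : ℝ≥0∞} [Fact (1 ≤ p)] (hpp' : p.HolderConjugate p')
    (hs : 1 / 2 ≤ s) (hsp : 1 < p' * ENNReal.ofReal (s + 1 / 4)) {R : ℝ} (hR : 0 < R) :
    ∃ (δ : ℝ) (hδ : 0 < δ), ∀ v : ℤ → ℝ, IsWeight v →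
      (∀ α : ℤ → ℂ, dn p s v α ≤ ENNReal.ofReal R →
        ∃ a : ℤ → Holder δ, IsMild hδ α a ∧ wn p s v a ≤ ENNReal.ofReal (2 * R)) ∧
      (∀ (α α' : ℤ → ℂ) (a a' : ℤ → Holder δ), dn p s v α ≠ ⊤ → dn p s v α' ≠ ⊤ →
        IsMild hδ α a → IsMild hδ α' a' →
        wn p s v a ≤ ENNReal.ofReal (2 * R) → wn p s v a' ≤ ENNReal.ofReal (2 * R) →
        wn p s v (a - a') ≤ 2 * dn p s v (α - α')) ∧
      (∀ a : ℤ → Holder δ, wn p s v a ≠ ⊤ → ∀ n, Summable (cubicTerm hδ a a a n)) := by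
  have hp : 1 ≤ p := Fact.out
  obtain ⟨κ, hκ, H⟩ := exists_wn_cubic_le hp hpp' hs hsp
  -- θ plays the role of √δ: it makes 24 κ √δ R² ≤ 1, and θ ≤ 1 gives δ ≤ 1.
  set θ : ℝ := min 1 (1 / (24 * (κ * R ^ 2))) with hθ
  have hθ0 : 0 < θ := lt_min one_pos (by positivity)
  have hθ1 : θ ≤ 1 := min_le_left _ _
  have hδ : 0 < θ ^ 2 := by positivity
  have hδ1 : θ ^ 2 ≤ 1 := pow_le_one₀ hθ0.le hθ1
  have hsq : Real.sqrt (θ ^ 2) = θ := Real.sqrt_sq hθ0.le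
  have hκR : 24 * (κ * θ * R ^ 2) ≤ 1 := by
    have h1 : θ ≤ 1 / (24 * (κ * R ^ 2)) := min_le_right _ _
    rw [le_div_iff₀ (by positivity)] at h1
    linarith
  -- The time δ is fixed before the weight; persistence of regularity depends on this order.
  refine ⟨θ ^ 2, hδ, fun v hv => ?_⟩
  have H' := H (θ ^ 2) hδ hδ1 v hv
  rw [hsq] at H'
  have hfin : ∀ b : lp (fun _ : ℤ => Holder (θ ^ 2)) p, wn p s v (unweight s v b) ≠ ⊤ := by
    intro b; rw [wn_unweight hv]; exact enorm_ne_top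
  have hcfin : ∀ b c d : lp (fun _ : ℤ => Holder (θ ^ 2)) p,
      wn p s v (cubic hδ (unweight s v b) (unweight s v c) (unweight s v d)) ≠ ⊤ := by
    intro b c d
    exact ne_top_of_le_ne_top (ENNReal.mul_ne_top ENNReal.ofReal_ne_top
      (ENNReal.mul_ne_top (ENNReal.mul_ne_top (hfin b) (hfin c)) (hfin d))) (H' _ _ _).1
  set T : lp (fun _ : ℤ => Holder (θ ^ 2)) p → lp (fun _ : ℤ => Holder (θ ^ 2)) p →
      lp (fun _ : ℤ => Holder (θ ^ 2)) p → lp (fun _ : ℤ => Holder (θ ^ 2)) p :=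
    fun b c d => weight hv _ (hcfin b c d) with hT
  have hTb : IsTrilinearBound T (κ * θ) := by
    constructor
    · intro b c d
      have h1 := (H' (unweight s v b) (unweight s v c) (unweight s v d)).1
      rw [wn_unweight hv, wn_unweight hv, wn_unweight hv, ← enorm_weight hv _ (hcfin b c d),
        ← ofReal_norm, ← ofReal_norm, ← ofReal_norm, ← ofReal_norm,
        ← ENNReal.ofReal_mul (by positivity), ← ENNReal.ofReal_mul (by positivity),
        ← ENNReal.ofReal_mul (by positivity),
        ENNReal.ofReal_le_ofReal_iff (by positivity)] at h1
      exact h1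
    · intro b c d b' c' d'
      apply unweight_injective (s := s) hv
      have hadd : ∀ x y : lp (fun _ : ℤ => Holder (θ ^ 2)) p,
          unweight s v (x + y) = unweight s v x + unweight s v y := by
        intro x y
        funext n
        simp only [unweight, Pi.add_apply, lp.coeFn_add, smul_add]
      rw [unweight_sub, hadd, hadd]
      simp only [hT, unweight_weight, unweight_sub]
      funext n
      simp only [Pi.sub_apply, Pi.add_apply]
      have hf : ∀ b c : lp (fun _ : ℤ => Holder (θ ^ 2)) p,
          wn p s v (unweight s v b - unweight s v c) ≠ ⊤ := fun b c => by
        rw [← unweight_sub]; exact hfin _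
      exact cubic_sub_cubic hδ ((H' _ _ _).2 (hf _ _) (hfin _) (hfin _) n)
        ((H' _ _ _).2 (hfin _) (hf _ _) (hfin _) n)
        ((H' _ _ _).2 (hfin _) (hfin _) (hf _ _) n)
        ((H' _ _ _).2 (hfin _) (hfin _) (hfin _) n)
        ((H' _ _ _).2 (hfin _) (hfin _) (hfin _) n)
  have hκθ : 0 ≤ κ * θ := by positivity
  refine ⟨fun α hα => ?_, fun α α' a a' hα hα' hm hm' ha ha' => ?_, fun a ha =>
    (H' a a a).2 ha ha ha⟩
  · have hαfin : wn p s v (fun n => Holder.const (θ ^ 2) (α n)) ≠ ⊤ := by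
      rw [wn_const]; exact ne_top_of_le_ne_top ENNReal.ofReal_ne_top hα
    obtain ⟨b, hb, hfix⟩ := hTb.exists_fixedPoint hκθ hR.le hκR
      (x := weight hv _ hαfin) (by
        rw [← wn_const (δ := θ ^ 2), ← enorm_weight hv _ hαfin, ← ofReal_norm,
          ENNReal.ofReal_le_ofReal_iff hR.le] at hα
        exact hα)
    refine ⟨unweight s v b, fun n => ?_, ?_⟩
    · have h1 : unweight s v b n =
          unweight s v (weight hv _ hαfin) n + unweight s v (T b b b) n := by
        nth_rewrite 1 [hfix]
        simp only [unweight, lp.coeFn_add, Pi.add_apply, smul_add]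
      rw [h1, unweight_weight]
      simp only [hT, unweight_weight]
    · rw [wn_unweight hv, ← ofReal_norm]
      exact ENNReal.ofReal_le_ofReal hb
  · have hαfin : wn p s v (fun n => Holder.const (θ ^ 2) (α n)) ≠ ⊤ := by
      rw [wn_const]; exact hα
    have hαfin' : wn p s v (fun n => Holder.const (θ ^ 2) (α' n)) ≠ ⊤ := by
      rw [wn_const]; exact hα'
    have hafin := ne_top_of_le_ne_top ENNReal.ofReal_ne_top ha
    have hafin' := ne_top_of_le_ne_top ENNReal.ofReal_ne_top ha'
    have hfix : ∀ (α : ℤ → ℂ) (a : ℤ → Holder (θ ^ 2))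
        (h1 : wn p s v (fun n => Holder.const (θ ^ 2) (α n)) ≠ ⊤) (h2 : wn p s v a ≠ ⊤),
        IsMild hδ α a → weight hv a h2 = weight hv _ h1 +
          T (weight hv a h2) (weight hv a h2) (weight hv a h2) := by
      intro α a h1 h2 hm
      apply lp.ext
      funext n
      rw [lp.coeFn_add, Pi.add_apply]
      change ((v n * jb n ^ s : ℝ) : ℂ) • a n = ((v n * jb n ^ s : ℝ) : ℂ) • Holder.const _ (α n) +
        ((v n * jb n ^ s : ℝ) : ℂ) • cubic hδ _ _ _ n
      rw [unweight_weight, ← smul_add]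
      congr 1
      exact hm n
    have hnorm : ∀ (a : ℤ → Holder (θ ^ 2)) (h2 : wn p s v a ≠ ⊤),
        wn p s v a ≤ ENNReal.ofReal (2 * R) → ‖weight hv a h2‖ ≤ 2 * R := by
      intro a h2 h3
      rwa [← enorm_weight hv _ h2, ← ofReal_norm,
        ENNReal.ofReal_le_ofReal_iff (by positivity)] at h3
    have key := hTb.lipschitz hκθ hR.le hκR (hnorm a hafin ha) (hnorm a' hafin' ha')
      (hfix α a hαfin hafin hm) (hfix α' a' hαfin' hafin' hm')
    have e1 : wn p s v (a - a') = ‖weight hv a hafin - weight hv a' hafin'‖ₑ := by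
      rw [← wn_unweight (s := s) hv, unweight_sub, unweight_weight, unweight_weight]
    have e2 : dn p s v (α - α') = ‖weight hv _ hαfin - weight hv _ hαfin'‖ₑ := by
      rw [← wn_unweight (s := s) hv, unweight_sub, unweight_weight, unweight_weight,
        ← wn_const (δ := θ ^ 2)]
      congr 1
      funext n
      exact Holder.const_sub _ _
    rw [e1, e2, ← ofReal_norm, ← ofReal_norm]
    calc _ ≤ ENNReal.ofReal (2 * ‖weight hv _ hαfin - weight hv _ hαfin'‖) :=
          ENNReal.ofReal_le_ofReal key
      _ = _ := by rw [ENNReal.ofReal_mul (by norm_num)]; norm_num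

end MKdV

end

/-! ### Reality of the profile and persistence of regularity -/

noncomputable section

namespace MKdV

/-! ### Reality of mild solutions -/

section conj

variable {δ : ℝ}

/-- Complex conjugation of Hölder functions. -/
def Holder.conj (a : Holder δ) : Holder δ :=
  Holder.mk (fun t => starRingEnd ℂ (Holder.eval t a)) ‖a‖
    (fun t => by rw [RCLike.norm_conj]; exact Holder.norm_eval_le a t)
    fun s t => by rw [← map_sub, RCLike.norm_conj]; exact Holder.norm_eval_sub_le a s t

@[simp] theorem Holder.eval_conj (a : Holder δ) (t : ℝ) :
    Holder.eval t a.conj = starRingEnd ℂ (Holder.eval t a) := rfl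

theorem Holder.norm_conj (a : Holder δ) : ‖a.conj‖ = ‖a‖ := by
  have h : ∀ b : Holder δ, ‖b.conj‖ ≤ ‖b‖ := fun b =>
    Holder.norm_le (norm_nonneg b)
      (fun t => by rw [Holder.eval_conj, RCLike.norm_conj]; exact Holder.norm_eval_le b t)
      fun s t => by
        rw [Holder.eval_conj, Holder.eval_conj, ← map_sub, RCLike.norm_conj]
        exact Holder.norm_eval_sub_le b s t
  have h2 : a.conj.conj = a := Holder.ext_eval fun t => by simp
  refine le_antisymm (h a) ?_
  nth_rewrite 1 [← h2]
  exact h _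

theorem conj_duhamel (φ : ℝ) (a b c : Holder δ) (t : ℝ) :
    starRingEnd ℂ (duhamel δ φ a b c t) = duhamel δ (-φ) a.conj b.conj c.conj t := by
  unfold duhamel
  rw [← intervalIntegral.intervalIntegral_conj]
  refine intervalIntegral.integral_congr fun σ _ => ?_
  simp only [map_mul, Holder.eval_conj, ← Complex.exp_conj, Complex.conj_I, Complex.conj_ofReal]
  congr 2
  push_cast
  ring

theorem phase_neg (a b c : ℤ) : phase (-a) (-b) (-c) = -phase a b c := by
  unfold phase; push_cast; ring

theorem nonres_neg {a b c : ℤ} : Nonres (-a) (-b) (-c) ↔ Nonres a b c := by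
  unfold Nonres; omega

variable (hδ : 0 < δ)

theorem eval_cubic {A B C : ℤ → Holder δ} {n : ℤ} (h : Summable (cubicTerm hδ A B C n)) (t : ℝ) :
    Holder.eval t (cubic hδ A B C n) =
      Complex.I * n * duhamel δ 0 (A n) (B n) (C (-n)) t +
        ∑' e, Holder.eval t (cubicTerm hδ A B C n e) := by
  unfold cubic
  rw [map_add, ContinuousLinearMap.map_tsum _ h, map_smul, smul_eq_mul, Holder.eval_duhamel]

theorem eval_cubicTerm (A B C : ℤ → Holder δ) (n : ℤ) (e : ℤ × ℤ) (t : ℝ) :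
    Holder.eval t (cubicTerm hδ A B C n e) = if Nonres (n - (e.1 + e.2)) e.1 e.2 then
      -(Complex.I * n / 3) * duhamel δ (phase (n - (e.1 + e.2)) e.1 e.2)
        (A (n - (e.1 + e.2))) (B e.1) (C e.2) t else 0 := by
  unfold cubicTerm
  split_ifs
  · rw [map_smul, smul_eq_mul, Holder.eval_duhamel]
  · exact map_zero _

/-- The conjugate reflection `n ↦ conj (a (-n))`. -/
def reflect (a : ℤ → Holder δ) (n : ℤ) : Holder δ := (a (-n)).conj

/-- Conjugation flips the phase, as does negating all three frequencies, and i n is invariant under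
both operations combined. -/
theorem cubicTerm_reflect (a : ℤ → Holder δ) (n : ℤ) (e : ℤ × ℤ) :
    cubicTerm hδ (reflect a) (reflect a) (reflect a) n (-e) =
      (cubicTerm hδ a a a (-n) e).conj := by
  refine Holder.ext_eval fun t => ?_
  rw [Holder.eval_conj, eval_cubicTerm, eval_cubicTerm]
  have e1 : n - ((-e).1 + (-e).2) = -(-n - (e.1 + e.2)) := by
    simp only [Prod.fst_neg, Prod.snd_neg]; ring
  rw [e1]
  simp only [Prod.fst_neg, Prod.snd_neg, nonres_neg]
  split_ifs
  · rw [phase_neg, map_mul, conj_duhamel]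
    simp only [reflect, neg_neg, map_neg, map_div₀, map_mul, Complex.conj_I, map_ofNat,
      map_intCast, Int.cast_neg]
    ring
  · simp

/-- With uniqueness this forces the profile of real data to be real. -/
theorem IsMild.reflect {α : ℤ → ℂ} {a : ℤ → Holder δ} (h : IsMild hδ α a)
    (hα : ∀ n, α (-n) = starRingEnd ℂ (α n)) (hs : ∀ n, Summable (cubicTerm hδ a a a n))
    (hs' : ∀ n, Summable (cubicTerm hδ (reflect a) (reflect a) (reflect a) n)) :
    IsMild hδ α (MKdV.reflect a) := by
  intro n
  refine Holder.ext_eval fun t => ?_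
  have h1 := congrArg (fun b => starRingEnd ℂ (Holder.eval t b)) (h (-n))
  simp only [map_add, Holder.eval_const, eval_cubic hδ (hs _)] at h1
  rw [map_add, Holder.eval_const, eval_cubic hδ (hs' _)]
  change starRingEnd ℂ (Holder.eval t (a (-n))) = _
  rw [h1, hα, Complex.conj_conj]
  congr 1
  congr 1
  · rw [map_mul, conj_duhamel]
    simp only [MKdV.reflect, neg_neg, map_mul, map_neg, Complex.conj_I, map_intCast,
      Int.cast_neg, neg_zero]
    ring
  · rw [Complex.conj_tsum, ← (Equiv.neg (ℤ × ℤ)).tsum_eq]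
    congr 1
    funext e
    have h2 := cubicTerm_reflect hδ a n (-e)
    rw [neg_neg] at h2
    rw [Equiv.neg_apply, h2, Holder.eval_conj]

end conj

theorem seqNorm_comp_equiv {ι ι' : Type*} (p : ℝ≥0∞) (e : ι' ≃ ι) (f : ι → ℝ≥0∞) :
    seqNorm p (fun i => f (e i)) = seqNorm p f := by
  unfold seqNorm
  split_ifs
  · exact e.iSup_comp
  · rw [e.tsum_eq fun i => f i ^ p.toReal]

theorem wn_reflect {δ : ℝ} {p : ℝ≥0∞} {s : ℝ} (a : ℤ → Holder δ) :
    wn p s (fun _ => 1) (reflect a) = wn p s (fun _ => 1) a := by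
  unfold wn wNorm
  rw [← seqNorm_comp_equiv p (Equiv.neg ℤ)]
  congr 1
  funext n
  simp only [Equiv.neg_apply, jb_neg, reflect, neg_neg]
  rw [← ofReal_norm, ← ofReal_norm, Holder.norm_conj]

theorem isWeight_one : IsWeight fun _ => 1 := ⟨fun _ => le_rfl, fun _ _ => by norm_num⟩

theorem eq_of_wn_sub_eq_zero {δ : ℝ} {p : ℝ≥0∞} (hp : 1 ≤ p) {s : ℝ} {v : ℤ → ℝ}
    (hv : IsWeight v) {a b : ℤ → Holder δ} (h : wn p s v (a - b) = 0) : a = b := by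
  funext n
  have h1 := (le_seqNorm hp (fun n => ENNReal.ofReal (v n * jb n ^ s) * ‖(a - b) n‖ₑ) n).trans
    (le_of_eq h)
  rw [nonpos_iff_eq_zero, mul_eq_zero, ENNReal.ofReal_eq_zero] at h1
  rcases h1 with h1 | h1
  · exact absurd (weight_pos (s := s) hv n) (not_lt.2 h1)
  · exact sub_eq_zero.1 (by simpa using h1)

/-! ### Persistence of regularity -/

/-- The weights `(1 + ε|n|)^k`. -/
def polyWeight (ε : ℝ) (k : ℕ) (n : ℤ) : ℝ := (1 + ε * |(n : ℝ)|) ^ k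

theorem isWeight_polyWeight {ε : ℝ} (hε : 0 ≤ ε) (k : ℕ) : IsWeight (polyWeight ε k) := by
  constructor
  · intro n
    exact one_le_pow₀ (by have := abs_nonneg (n : ℝ); nlinarith)
  · intro m n
    unfold polyWeight
    rw [← mul_pow]
    have h1 := abs_nonneg (m : ℝ)
    have h2 := abs_nonneg (n : ℝ)
    have h3 := abs_nonneg ((m + n : ℤ) : ℝ)
    gcongr
    have h4 : |((m + n : ℤ) : ℝ)| ≤ |(m : ℝ)| + |(n : ℝ)| := by push_cast; exact abs_add_le _ _
    have h5 : 0 ≤ ε * |(m : ℝ)| * (ε * |(n : ℝ)|) := by positivity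
    nlinarith

/-- Convexity of x ↦ x^k at 1 + ε|n| = (1-ε)·1 + ε(1+|n|). -/
theorem polyWeight_le {ε : ℝ} (hε : 0 ≤ ε) (hε1 : ε ≤ 1) (k : ℕ) (n : ℤ) :
    polyWeight ε k n ≤ 1 + ε * br n ^ k := by
  unfold polyWeight
  have h := (convexOn_pow k).2 (show (1 : ℝ) ∈ Set.Ici 0 from Set.mem_Ici.2 zero_le_one)
    (show br n ∈ Set.Ici 0 from Set.mem_Ici.2 (br_pos n).le) (by linarith : 0 ≤ 1 - ε) hε (by ring)
  simp only [smul_eq_mul, one_pow, mul_one] at h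
  have e : 1 - ε + ε * br n = 1 + ε * |(n : ℝ)| := by unfold br; ring
  rw [e] at h
  linarith

theorem le_polyWeight {ε : ℝ} (hε : 0 ≤ ε) (hε1 : ε ≤ 1) (k : ℕ) (n : ℤ) :
    ε ^ k * br n ^ k ≤ polyWeight ε k n := by
  unfold polyWeight
  rw [← mul_pow]
  have := br_pos n
  gcongr
  unfold br; linarith

theorem seqNorm_le_tsum {p : ℝ≥0∞} (hp : 1 ≤ p) (f : ℤ → ℝ≥0∞) : seqNorm p f ≤ ∑' n, f n := by
  by_cases ht : p = ⊤
  · subst ht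
    rw [seqNorm_top]
    exact iSup_le fun n => ENNReal.le_tsum n
  · have h1 := toReal_ge_one hp ht
    have := lqNorm_le_seqNorm (p := 1) (q := p.toReal) (by simp) le_rfl (by simpa using h1) f
    rw [seqNorm_of_ne_top (p := 1) (by simp)] at this
    rw [seqNorm_of_ne_top ht]
    simpa [lqNorm] using this

/-- Rapidly decreasing sequences. -/
def Rapid {E : Type*} [Norm E] (α : ℤ → E) : Prop :=
  ∀ k : ℕ, ∃ C : ℝ, ∀ n, br n ^ k * ‖α n‖ ≤ C

theorem summable_br_pow : Summable fun n : ℤ => (br n ^ 2)⁻¹ := by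
  have := summable_br_rpow (ρ := 2) (by norm_num)
  refine this.congr fun n => ?_
  rw [Real.rpow_neg (br_pos n).le]
  norm_cast

theorem Rapid.le_inv {E : Type*} [NormedAddCommGroup E] {α : ℤ → E} (h : Rapid α) (k : ℕ) :
    ∃ C : ℝ, 0 ≤ C ∧ ∀ n, br n ^ k * ‖α n‖ ≤ C * (br n ^ 2)⁻¹ := by
  obtain ⟨C, hC⟩ := h (k + 2)
  refine ⟨C, ?_, fun n => ?_⟩
  · refine le_trans ?_ (hC 0)
    have := br_pos 0
    positivity
  · have hb := br_pos n
    rw [← div_eq_mul_inv, le_div_iff₀ (by positivity)]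
    calc _ = br n ^ (k + 2) * ‖α n‖ := by ring
      _ ≤ C := hC n

theorem Rapid.summable {E : Type*} [NormedAddCommGroup E] {α : ℤ → E} (h : Rapid α) (k : ℕ) :
    Summable fun n => br n ^ k * ‖α n‖ := by
  obtain ⟨C, -, hC⟩ := h.le_inv k
  exact Summable.of_nonneg_of_le (fun n => by have := br_pos n; positivity) hC
    (summable_br_pow.mul_left C)

theorem jb_rpow_le_br_pow {s : ℝ} {m : ℕ} (hm : s ≤ m) (n : ℤ) : jb n ^ s ≤ br n ^ m := by
  have hj := jb_pos n
  calc jb n ^ s ≤ jb n ^ (m : ℝ) := Real.rpow_le_rpow_of_exponent_le (one_le_jb n) hm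
    _ = jb n ^ m := Real.rpow_natCast _ _
    _ ≤ _ := by gcongr; exact jb_le_br n

theorem Rapid.dn_ne_top {p : ℝ≥0∞} (hp : 1 ≤ p) (s : ℝ) {α : ℤ → ℂ} (h : Rapid α) (k : ℕ) :
    dn p s (fun n => br n ^ k) α ≠ ⊤ := by
  refine ne_top_of_le_ne_top ?_ (seqNorm_le_tsum hp _)
  obtain ⟨m, hm⟩ := exists_nat_ge s
  have h1 := (h.summable (k + m)).tsum_ofReal_ne_top
  refine ne_top_of_le_ne_top h1 (ENNReal.tsum_le_tsum fun n => ?_)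
  have hb := br_pos n
  have hj := jb_pos n
  beta_reduce
  rw [← ofReal_norm, ← ENNReal.ofReal_mul (by positivity)]
  apply ENNReal.ofReal_le_ofReal
  have h2 := jb_rpow_le_br_pow hm n
  rw [pow_add]
  gcongr

/-- The weighted norm exceeds the unweighted one by at most εK with K finite, and the strict
inequality leaves room for this excess once ε is small. -/
theorem Rapid.exists_polyWeight {p : ℝ≥0∞} (hp : 1 ≤ p) {s R : ℝ} {α : ℤ → ℂ} (h : Rapid α)
    (hR : dn p s (fun _ => 1) α < ENNReal.ofReal R) (k : ℕ) :
    ∃ ε : ℝ, 0 < ε ∧ ε ≤ 1 ∧ dn p s (polyWeight ε k) α ≤ ENNReal.ofReal R := by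
  set K := dn p s (fun n => br n ^ k) α with hK
  have hKt : K ≠ ⊤ := h.dn_ne_top hp s k
  have hle : ∀ ε : ℝ, 0 ≤ ε → ε ≤ 1 → dn p s (polyWeight ε k) α ≤
      dn p s (fun _ => 1) α + ENNReal.ofReal ε * K := by
    intro ε h0 h1
    rw [hK]
    unfold dn wNorm
    rw [← seqNorm_const_mul hp]
    refine le_trans (seqNorm_mono fun n => ?_) (seqNorm_add_le hp _ _)
    have hj := jb_pos n
    have hb := br_pos n
    rw [← mul_assoc, ← ENNReal.ofReal_mul h0, ← add_mul, ← ENNReal.ofReal_add (by positivity)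
      (by positivity)]
    gcongr
    have := polyWeight_le h0 h1 k n
    have h2 : 0 < jb n ^ s := Real.rpow_pos_of_pos hj _
    nlinarith
  have hlim : Filter.Tendsto (fun ε : ℝ => dn p s (fun _ => 1) α + ENNReal.ofReal ε * K)
      (nhdsWithin 0 (Set.Ioi 0)) (nhds (dn p s (fun _ => 1) α)) := by
    have h1 : Filter.Tendsto (fun ε : ℝ => ENNReal.ofReal ε * K) (nhds 0) (nhds 0) := by
      have := ENNReal.Tendsto.mul_const (b := K) (ENNReal.tendsto_ofReal
        (Filter.tendsto_id (α := ℝ) (x := nhds 0))) (Or.inr hKt)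
      simpa using this
    have h2 : Filter.Tendsto (fun ε : ℝ => ENNReal.ofReal ε * K)
      (nhdsWithin 0 (Set.Ioi 0)) (nhds 0) := h1.mono_left nhdsWithin_le_nhds
    have := (tendsto_const_nhds (x := dn p s (fun _ => 1) α)).add h2
    simpa using this
  have hev := (hlim.eventually (gt_mem_nhds hR)).and
    ((eventually_mem_nhdsWithin (a := (0 : ℝ)) (s := Set.Ioi 0)).and
      (nhdsWithin_le_nhds (Iic_mem_nhds (show (0 : ℝ) < 1 by norm_num))))
  obtain ⟨ε, h1, h2, h3⟩ := hev.exists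
  exact ⟨ε, h2, h3, (hle ε (le_of_lt h2) h3).trans h1.le⟩

/-- For fixed ε > 0 the weight (1+ε|n|)^k still grows like ε^k|n|^k; the size of ε affects only the
constant. -/
theorem rapid_of_forall_polyWeight {δ : ℝ} {p : ℝ≥0∞} (hp : 1 ≤ p) {s R : ℝ} (hs : 0 ≤ s)
    {a : ℤ → Holder δ}
    (h : ∀ k, ∃ ε : ℝ, 0 < ε ∧ ε ≤ 1 ∧ wn p s (polyWeight ε k) a ≤ ENNReal.ofReal R) :
    Rapid a := by
  intro k
  obtain ⟨ε, h0, h1, hε⟩ := h k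
  refine ⟨(ε ^ k)⁻¹ * max R 0, fun n => ?_⟩
  have h2 := (le_seqNorm hp
    (fun n => ENNReal.ofReal (polyWeight ε k n * jb n ^ s) * ‖a n‖ₑ) n).trans hε
  have hv := isWeight_polyWeight h0.le k
  rw [← ofReal_norm, ← ENNReal.ofReal_mul (weight_pos hv n).le] at h2
  have h3 : polyWeight ε k n * jb n ^ s * ‖a n‖ ≤ max R 0 := by
    rcases le_total 0 R with hR | hR
    · rw [ENNReal.ofReal_le_ofReal_iff hR] at h2
      exact h2.trans (le_max_left _ _)
    · rw [ENNReal.ofReal_eq_zero.2 hR, nonpos_iff_eq_zero, ENNReal.ofReal_eq_zero] at h2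
      exact h2.trans (le_max_right _ _)
  have h4 := le_polyWeight h0.le h1 k n
  have h5 : 1 ≤ jb n ^ s := Real.one_le_rpow (one_le_jb n) hs
  have hb := br_pos n
  have hp := hv.pos n
  rw [← div_eq_inv_mul, le_div_iff₀ (by positivity)]
  calc _ = ε ^ k * br n ^ k * 1 * ‖a n‖ := by ring
    _ ≤ polyWeight ε k n * jb n ^ s * ‖a n‖ := by gcongr
    _ ≤ _ := h3

/-- On a time interval depending only on `R`, data of norm below `R` have a unique mild solution
of norm at most `2R`; it depends Lipschitz-continuously on the data, it is real for real data and
rapidly decreasing for rapidly decreasing data. -/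
theorem exists_mild_solution {s : ℝ} {p p' : ℝ≥0∞} [Fact (1 ≤ p)] (hpp' : p.HolderConjugate p')
    (hs : 1 / 2 ≤ s) (hsp : 1 < p' * ENNReal.ofReal (s + 1 / 4)) {R : ℝ} (hR : 0 < R) :
    ∃ (δ : ℝ) (hδ : 0 < δ) (sol : (ℤ → ℂ) → ℤ → Holder δ), ∀ α : ℤ → ℂ,
      dn p s (fun _ => 1) α < ENNReal.ofReal R → IsMild hδ α (sol α) ∧
      wn p s (fun _ => 1) (sol α) ≠ ⊤ ∧
      (∀ n, Summable (cubicTerm hδ (sol α) (sol α) (sol α) n)) ∧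
      (∀ β : ℤ → ℂ, dn p s (fun _ => 1) β < ENNReal.ofReal R →
        wn p s (fun _ => 1) (sol α - sol β) ≤ 2 * dn p s (fun _ => 1) (α - β)) ∧
      ((∀ n, α (-n) = starRingEnd ℂ (α n)) →
        ∀ n t, Holder.eval t (sol α (-n)) = starRingEnd ℂ (Holder.eval t (sol α n))) ∧
      (Rapid α → Rapid (sol α)) := by
  have hp : 1 ≤ p := Fact.out
  obtain ⟨δ, hδ, H⟩ := exists_solvable hpp' hs hsp hR
  obtain ⟨hex, hlip, hsum⟩ := H _ isWeight_one
  choose! sol hsol using hex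
  refine ⟨δ, hδ, sol, fun α hα => ?_⟩
  obtain ⟨hm, hb⟩ := hsol α hα.le
  have hfin := ne_top_of_le_ne_top ENNReal.ofReal_ne_top hb
  have hαfin : dn p s (fun _ => 1) α ≠ ⊤ := hα.ne_top
  have huniq : ∀ a : ℤ → Holder δ, IsMild hδ α a →
      wn p s (fun _ => 1) a ≤ ENNReal.ofReal (2 * R) → a = sol α := by
    intro a ha hab
    refine eq_of_wn_sub_eq_zero hp isWeight_one (v := fun _ => 1) (s := s) (p := p) ?_
    have := hlip α α a (sol α) hαfin hαfin ha hm hab hb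
    rw [sub_self] at this
    have h0 : dn p s (fun _ => 1) (0 : ℤ → ℂ) = 0 := by
      unfold dn
      have := wNorm_const_mul hp (s := s) (v := fun _ => 1) 0 (fun _ => 0)
      simpa using this
    rw [h0, mul_zero] at this
    exact nonpos_iff_eq_zero.1 this
  refine ⟨hm, hfin, hsum _ hfin, fun β hβ => ?_, fun hreal => ?_, fun hrap => ?_⟩
  · obtain ⟨hm', hb'⟩ := hsol β hβ.le
    exact hlip α β _ _ hαfin hβ.ne_top hm hm' hb hb'
  · have hr : wn p s (fun _ => 1) (reflect (sol α)) ≤ ENNReal.ofReal (2 * R) := by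
      rwa [wn_reflect]
    -- The reflected profile solves the same equation with the same data and norm, hence equals the
    -- original.
    have h1 := huniq _ (hm.reflect hδ hreal (hsum _ hfin)
      (hsum _ (ne_top_of_le_ne_top ENNReal.ofReal_ne_top hr))) hr
    intro n t
    have h2 := congrFun h1 n
    rw [← h2]
    simp [reflect]
  · refine rapid_of_forall_polyWeight hp (by linarith : (0 : ℝ) ≤ s) (R := 2 * R) fun k => ?_
    -- The contraction is run again with the weight; its solution also lies in the unweighted ball
    -- of radius 2R, where uniqueness identifies it with `sol α`.
    obtain ⟨ε, h0, h1, hε⟩ := hrap.exists_polyWeight hp hα k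
    obtain ⟨a, ha, hab⟩ := (H _ (isWeight_polyWeight h0.le k)).1 α hε
    have h2 : wn p s (fun _ => 1) a ≤ wn p s (polyWeight ε k) a := by
      refine seqNorm_mono fun n => ?_
      have := (isWeight_polyWeight h0.le k).one_le n
      have hj : 0 < jb n ^ s := Real.rpow_pos_of_pos (jb_pos n) _
      gcongr
    rw [huniq a ha (h2.trans hab)] at hab
    exact ⟨ε, h0, h1, hab⟩

end MKdV

end

/-! ### Convolution identities: product rule, resonant set, conservation law -/

noncomputable section

namespace MKdV

/-! ### Triple convolutions of rapidly decreasing sequences -/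

section conv

variable {E : Type*} [NormedAddCommGroup E] {𝕜 : Type*} [RCLike 𝕜]

theorem br_add_le_mul (a b : ℤ) : br (a + b) ≤ br a * br b := by
  unfold br
  push_cast
  have h3 := abs_add_le (a : ℝ) b
  nlinarith [abs_nonneg (a : ℝ), abs_nonneg (b : ℝ)]

theorem Rapid.mono {E' : Type*} [NormedAddCommGroup E'] {f : ℤ → E} {g : ℤ → E'} (hg : Rapid g)
    (h : ∀ n, ‖f n‖ ≤ ‖g n‖) : Rapid f := by
  intro k
  obtain ⟨C, hC⟩ := hg k
  refine ⟨C, fun n => le_trans ?_ (hC n)⟩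
  have := br_pos n
  gcongr
  exact h n

theorem Rapid.norm {f : ℤ → E} (hf : Rapid f) : Rapid fun n => ‖f n‖ :=
  hf.mono fun n => by rw [norm_norm]

theorem Rapid.summable_norm {f : ℤ → E} (hf : Rapid f) : Summable fun n => ‖f n‖ := by
  simpa using hf.summable 0

theorem Rapid.add {f g : ℤ → E} (hf : Rapid f) (hg : Rapid g) : Rapid fun n => f n + g n := by
  intro k
  obtain ⟨C, hC⟩ := hf k
  obtain ⟨C', hC'⟩ := hg k
  refine ⟨C + C', fun n => ?_⟩
  have := br_pos n
  calc _ ≤ br n ^ k * (‖f n‖ + ‖g n‖) := by gcongr; exact norm_add_le _ _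
    _ ≤ _ := by rw [mul_add]; exact add_le_add (hC n) (hC' n)

theorem Rapid.mul {f c : ℤ → 𝕜} (hf : Rapid f) {C : ℝ} {j : ℕ}
    (hc : ∀ n, ‖c n‖ ≤ C * br n ^ j) : Rapid fun n => c n * f n := by
  intro k
  obtain ⟨C', hC'⟩ := hf (k + j)
  have h0 : 0 ≤ C := by
    have := (norm_nonneg _).trans (hc 0)
    have h1 : 0 < br 0 ^ j := pow_pos (br_pos 0) _
    exact nonneg_of_mul_nonneg_left this h1
  refine ⟨C * C', fun n => ?_⟩
  have := br_pos n
  calc _ ≤ br n ^ k * (C * br n ^ j * ‖f n‖) := by rw [norm_mul]; gcongr; exact hc n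
    _ = C * (br n ^ (k + j) * ‖f n‖) := by ring
    _ ≤ _ := by gcongr; exact hC' n

/-- The triple convolution of sequences. -/
def conv3 (f g h : ℤ → 𝕜) (n : ℤ) : 𝕜 :=
  ∑' e : ℤ × ℤ, f (n - (e.1 + e.2)) * (g e.1 * h e.2)

theorem summable_conv3 {f g h : ℤ → 𝕜} (hf : Rapid f) (hg : Rapid g) (hh : Rapid h) (n : ℤ) :
    Summable fun e : ℤ × ℤ => ‖f (n - (e.1 + e.2)) * (g e.1 * h e.2)‖ := by
  obtain ⟨C, hC⟩ := hf 0
  have h1 := (hg.summable_norm.mul_of_nonneg hh.summable_norm (fun _ => norm_nonneg _)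
    fun _ => norm_nonneg _).mul_left C
  refine Summable.of_nonneg_of_le (fun _ => norm_nonneg _) (fun e => ?_) h1
  rw [norm_mul, norm_mul]
  gcongr
  simpa using hC (n - (e.1 + e.2))

theorem norm_conv3_le {f g h : ℤ → 𝕜} {A B C : ℤ → ℝ} (hA : Rapid A) (hB : Rapid B)
    (hC : Rapid C) (hf : ∀ n, ‖f n‖ ≤ A n) (hg : ∀ n, ‖g n‖ ≤ B n) (hh : ∀ n, ‖h n‖ ≤ C n)
    (n : ℤ) : ‖conv3 f g h n‖ ≤ conv3 A B C n := by
  refine tsum_of_norm_bounded (summable_conv3 hA hB hC n).of_norm.hasSum fun e => ?_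
  rw [norm_mul, norm_mul]
  have h1 := (norm_nonneg _).trans (hf (n - (e.1 + e.2)))
  have h2 := (norm_nonneg _).trans (hg e.1)
  gcongr
  · exact hf _
  · exact hg _
  · exact hh _

/-- The weight `br` is submultiplicative, so br n ^ k can be distributed over the three frequencies.
-/
theorem Rapid.conv3 {f g h : ℤ → 𝕜} (hf : Rapid f) (hg : Rapid g) (hh : Rapid h) :
    Rapid (conv3 f g h) := by
  intro k
  obtain ⟨C, hC⟩ := hf k
  have h1 := ((hg.summable k).mul_of_nonneg (hh.summable k)
    (fun n => by have := br_pos n; positivity)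
    fun n => by have := br_pos n; positivity).mul_left C
  refine ⟨∑' e : ℤ × ℤ, C * (br e.1 ^ k * ‖g e.1‖ * (br e.2 ^ k * ‖h e.2‖)), fun n => ?_⟩
  · have hb := br_pos n
    have h2 : ‖(br n ^ k : ℝ) • MKdV.conv3 f g h n‖ ≤
        ∑' e : ℤ × ℤ, C * (br e.1 ^ k * ‖g e.1‖ * (br e.2 ^ k * ‖h e.2‖)) := by
      unfold MKdV.conv3
      rw [← tsum_const_smul'']
      refine tsum_of_norm_bounded h1.hasSum fun e => ?_
      rw [norm_smul, norm_mul, norm_mul, Real.norm_of_nonneg (by positivity)]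
      have h3 : br n ≤ br (n - (e.1 + e.2)) * (br e.1 * br e.2) := by
        calc br n = br (n - (e.1 + e.2) + (e.1 + e.2)) := by rw [sub_add_cancel]
          _ ≤ _ := br_add_le_mul _ _
          _ ≤ _ := by
            have := br_pos (n - (e.1 + e.2))
            gcongr
            exact br_add_le_mul _ _
      have b1 := br_pos (n - (e.1 + e.2))
      have b2 := br_pos e.1
      have b3 := br_pos e.2
      calc _ ≤ (br (n - (e.1 + e.2)) * (br e.1 * br e.2)) ^ k *
            (‖f (n - (e.1 + e.2))‖ * (‖g e.1‖ * ‖h e.2‖)) := by gcongr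
        _ = (br (n - (e.1 + e.2)) ^ k * ‖f (n - (e.1 + e.2))‖) *
            ((br e.1 ^ k * ‖g e.1‖) * (br e.2 ^ k * ‖h e.2‖)) := by ring
        _ ≤ _ := by gcongr; exact hC _
    rw [norm_smul, Real.norm_of_nonneg (by positivity)] at h2
    exact h2

/-- The change of variables `(n, e₁, e₂) ↦ (n - e₁ - e₂, e₁, e₂)`. -/
def shearEquiv : ℤ × (ℤ × ℤ) ≃ ℤ × (ℤ × ℤ) where
  toFun x := (x.1 - (x.2.1 + x.2.2), x.2)
  invFun x := (x.1 + (x.2.1 + x.2.2), x.2)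
  left_inv x := by simp
  right_inv x := by simp

theorem tsum_conv3 {f g h : ℤ → 𝕜} (hf : Rapid f) (hg : Rapid g) (hh : Rapid h) :
    ∑' n, conv3 f g h n = (∑' n, f n) * ((∑' n, g n) * ∑' n, h n) := by
  have h1 := hg.summable_norm.mul_norm hh.summable_norm
  have h2 := hf.summable_norm.mul_norm h1
  rw [tsum_mul_tsum_of_summable_norm hg.summable_norm hh.summable_norm,
    tsum_mul_tsum_of_summable_norm hf.summable_norm h1, ← shearEquiv.tsum_eq]
  have h3 := shearEquiv.summable_iff.2 h2.of_norm
  exact (h3.tsum_prod' fun n => (summable_conv3 hf hg hh n).of_norm).symm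

/-- The Leibniz rule in Fourier variables: n is the sum of the three frequencies. -/
theorem mul_conv3 {f g h : ℤ → 𝕜} (hf : Rapid f) (hg : Rapid g) (hh : Rapid h) {c : 𝕜} (n : ℤ) :
    c * (n : 𝕜) * conv3 f g h n = conv3 (fun n => c * (n : 𝕜) * f n) g h n +
      conv3 f (fun n => c * (n : 𝕜) * g n) h n + conv3 f g (fun n => c * (n : 𝕜) * h n) n := by
  have hD : ∀ {f : ℤ → 𝕜}, Rapid f → Rapid fun n => c * (n : 𝕜) * f n := fun hf =>
    hf.mul (C := ‖c‖) (j := 1) fun n => by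
      rw [norm_mul, pow_one]
      gcongr
      have : ‖(n : 𝕜)‖ = |(n : ℝ)| := by
        rw [← RCLike.ofReal_intCast, RCLike.norm_ofReal]
      rw [this]; unfold br; linarith
  unfold conv3
  rw [← (summable_conv3 (hD hf) hg hh n).of_norm.tsum_add (summable_conv3 hf (hD hg) hh n).of_norm,
    ← Summable.tsum_add _ (summable_conv3 hf hg (hD hh) n).of_norm, ← tsum_mul_left]
  · congr 1
    funext e
    push_cast
    ring
  · exact (summable_conv3 (hD hf) hg hh n).of_norm.add (summable_conv3 hf (hD hg) hh n).of_norm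

theorem conv3_mul_character {f g h w : ℤ → 𝕜} (hw : ∀ m n, w (m + n) = w m * w n) (n : ℤ) :
    conv3 (fun n => f n * w n) (fun n => g n * w n) (fun n => h n * w n) n =
      conv3 f g h n * w n := by
  unfold conv3
  rw [← tsum_mul_right]
  congr 1
  funext e
  have : w n = w (n - (e.1 + e.2)) * (w e.1 * w e.2) := by
    rw [← hw, ← hw, sub_add_cancel]
  rw [this]
  ring

/-- The resonant part of the triple convolution is explicit. -/
theorem tsum_nonres {d : ℤ → 𝕜} (hd : Rapid d) {n : ℤ} (hn : n ≠ 0) :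
    ∑' e : ℤ × ℤ, (if Nonres (n - (e.1 + e.2)) e.1 e.2 then
      d (n - (e.1 + e.2)) * (d e.1 * d e.2) else 0) =
      conv3 d d d n - 3 * (∑' k, d k * d (-k)) * d n + 3 * (d n ^ 2 * d (-n)) := by
  classical
  have hM : Summable fun k => d k * d (-k) := by
    obtain ⟨C, hC⟩ := hd 0
    refine Summable.of_norm_bounded (hd.summable_norm.mul_right C) fun k => ?_
    rw [norm_mul]
    gcongr
    simpa using hC (-k)
  have hM' : Summable fun k => d (-k) * d k := hM.congr fun k => mul_comm _ _
  set M := ∑' k, d k * d (-k) with hMdef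
  have hMM : ∑' k, d (-k) * d k = M := tsum_congr fun k => mul_comm _ _
  set G : ℤ × ℤ → 𝕜 := fun e => d (n - (e.1 + e.2)) * (d e.1 * d e.2) with hG
  have line : ∀ (j : ℤ → ℤ × ℤ), Function.Injective j → Summable (fun k => G (j k)) →
      HasSum (fun e => if e ∈ Set.range j then G e else 0) (∑' k, G (j k)) := by
    intro j hj hs
    have h1 : HasSum ((fun e => if e ∈ Set.range j then G e else 0) ∘ j) (∑' k, G (j k)) := by
      have : (fun e => if e ∈ Set.range j then G e else 0) ∘ j = fun k => G (j k) := by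
        funext k; simp
      rw [this]; exact hs.hasSum
    refine (hj.hasSum_iff fun x hx => ?_).1 h1
    rw [if_neg hx]
  have g1 : ∀ k, G (k, n) = (d (-k) * d k) * d n := fun k => by
    simp only [hG, show n - (k + n) = -k by ring]; ring
  have g2 : ∀ k, G (k, -k) = (d k * d (-k)) * d n := fun k => by
    simp only [hG, show n - (k + -k) = n by ring]; ring
  have g3 : ∀ k, G (n, k) = (d (-k) * d k) * d n := fun k => by
    simp only [hG, show n - (n + k) = -k by ring]; ring
  -- The resonant set is the union of three lines in the plane of (e.1, e.2), and the sum along each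
  -- of them is M d_n.
  have l1 := line (fun k => (k, n)) (fun a b h => by simpa using h)
    (by simp only [g1]; exact hM'.mul_right _)
  have l2 := line (fun k => (k, -k)) (fun a b h => by simpa using h)
    (by simp only [g2]; exact hM.mul_right _)
  have l3 := line (fun k => (n, k)) (fun a b h => by simpa using h)
    (by simp only [g3]; exact hM'.mul_right _)
  simp only [g1, g2, g3, tsum_mul_right, hMM] at l1 l2 l3
  rw [← hMdef] at l2
  -- Inclusion–exclusion: as n ≠ 0, the lines meet pairwise in three distinct points, each
  -- contributing d_n² d_{-n}, and no point lies on all three.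
  have p1 := hasSum_ite_eq ((-n, n) : ℤ × ℤ) (G (-n, n))
  have p2 := hasSum_ite_eq ((n, n) : ℤ × ℤ) (G (n, n))
  have p3 := hasSum_ite_eq ((n, -n) : ℤ × ℤ) (G (n, -n))
  have hall := (summable_conv3 hd hd hd n).of_norm.hasSum
  have key := (hall.sub ((l1.add l2).add l3)).add ((p1.add p2).add p3)
  have e4 : G (-n, n) = d n ^ 2 * d (-n) := by rw [g1, neg_neg]; ring
  have e5 : G (n, n) = d n ^ 2 * d (-n) := by rw [g1]; ring
  have e6 : G (n, -n) = d n ^ 2 * d (-n) := by rw [g3, neg_neg]; ring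
  have hfin : conv3 d d d n - (M * d n + M * d n + M * d n) +
      (G (-n, n) + G (n, n) + G (n, -n)) =
      conv3 d d d n - 3 * M * d n + 3 * (d n ^ 2 * d (-n)) := by
    rw [e4, e5, e6]; ring
  rw [← hfin]
  refine (tsum_congr ?_).trans key.tsum_eq
  rintro ⟨x, y⟩
  change (if Nonres (n - (x + y)) x y then G (x, y) else 0) = G (x, y) - _ + _
  have r1 : ((x, y) ∈ Set.range fun k : ℤ => (k, n)) ↔ y = n := by
    simp [Prod.ext_iff, eq_comm]
  have r2 : ((x, y) ∈ Set.range fun k : ℤ => (k, -k)) ↔ y = -x := by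
    simp [Prod.ext_iff, eq_comm]
  have r3 : ((x, y) ∈ Set.range fun k : ℤ => (n, k)) ↔ x = n := by
    simp [Prod.ext_iff, eq_comm]
  simp only [r1, r2, r3, Prod.mk.injEq]
  have hres : Nonres (n - (x + y)) x y ↔ y ≠ n ∧ y ≠ -x ∧ x ≠ n := by
    unfold Nonres; omega
  simp only [hres]
  by_cases h1 : y = n <;> by_cases h2 : x = n
  · subst h1; subst h2
    simp [show ¬ (x = -x) by omega]
  · subst h1
    by_cases h3 : x = -y
    · subst h3; simp [show ¬ (-y = y) by omega]
    · simp [h2, h3, show ¬ (y = -x) by omega]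
  · subst h2
    by_cases h3 : y = -x
    · subst h3; simp [h1, show ¬ (x = -x) by omega]
    · simp [h1, h3]
  · by_cases h3 : y = -x
    · subst h3; simp [h1, h2]
    · simp [h1, h2, h3]

/-- Conservation of the quadratic form `∑ dₖ d₋ₖ`, in Fourier variables. -/
theorem tsum_mul_conv3_eq_zero {d : ℤ → 𝕜} (hd : Rapid d) :
    ∑' k : ℤ, (k : 𝕜) * (d (-k) * conv3 d d d k) = 0 := by
  obtain ⟨C, hC⟩ := hd 0
  have hC' : ∀ n, ‖d n‖ ≤ C := fun n => by simpa using hC n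
  have nk : ∀ k : ℤ, ‖(k : 𝕜)‖ = |(k : ℝ)| := fun k => by
    rw [← RCLike.ofReal_intCast, RCLike.norm_ofReal]
  set W : ℤ × (ℤ × ℤ) → 𝕜 := fun x =>
    d (-x.1) * (d (x.1 - (x.2.1 + x.2.2)) * (d x.2.1 * d x.2.2)) with hW
  have hs : Summable fun x : ℤ × (ℤ × ℤ) => (x.1 : 𝕜) * W x := by
    have h1 : Summable fun k : ℤ => br k * ‖d (-k)‖ := by
      have := (Equiv.neg ℤ).summable_iff.2 (hd.summable 1)
      refine this.congr fun k => ?_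
      simp [br_neg]
    have h2 := (h1.mul_of_nonneg (hd.summable_norm.mul_of_nonneg hd.summable_norm
      (fun _ => norm_nonneg _) fun _ => norm_nonneg _)
      (fun k => by have := br_pos k; positivity)
      fun _ => mul_nonneg (norm_nonneg _) (norm_nonneg _)).mul_left C
    refine Summable.of_norm_bounded h2 fun x => ?_
    simp only [hW, norm_mul, nk]
    have := hC' (x.1 - (x.2.1 + x.2.2))
    have hb : |(x.1 : ℝ)| ≤ br x.1 := by unfold br; linarith
    have hb' := br_pos x.1
    calc _ ≤ br x.1 * (‖d (-x.1)‖ * (C * (‖d x.2.1‖ * ‖d x.2.2‖))) := by gcongr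
      _ = _ := by ring
  -- W is the product of d at four frequencies with sum zero. The involutions exchange -k with each
  -- of the other three frequencies, so the factor k may be replaced by minus any of them; the four
  -- versions add up to zero.
  have swap : ∀ σ : ℤ × (ℤ × ℤ) → ℤ × (ℤ × ℤ), Function.Involutive σ → (∀ x, W (σ x) = W x) →
      HasSum (fun x => ((σ x).1 : 𝕜) * W x) (∑' x : ℤ × (ℤ × ℤ), (x.1 : 𝕜) * W x) := by
    intro σ hσ hWσ
    have := hσ.toPerm.hasSum_iff.2 hs.hasSum
    convert this using 2 with x
    simp [hWσ]
  have s0 := hs.hasSum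
  have s1 := swap (fun x => (x.2.1 + x.2.2 - x.1, x.2)) (fun x => by simp) fun x => by
    simp only [hW]
    rw [show -(x.2.1 + x.2.2 - x.1) = x.1 - (x.2.1 + x.2.2) by ring,
      show x.2.1 + x.2.2 - x.1 - (x.2.1 + x.2.2) = -x.1 by ring]
    ring
  have s2 := swap (fun x => (-x.2.1, (-x.1, x.2.2))) (fun x => by simp) fun x => by
    simp only [hW]
    rw [show -x.2.1 - (-x.1 + x.2.2) = x.1 - (x.2.1 + x.2.2) by ring, neg_neg]
    ring
  have s3 := swap (fun x => (-x.2.2, (x.2.1, -x.1))) (fun x => by simp) fun x => by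
    simp only [hW]
    rw [show -x.2.2 - (x.2.1 + -x.1) = x.1 - (x.2.1 + x.2.2) by ring, neg_neg]
    ring
  have hsum := ((s0.add s1).add (s2.add s3)).tsum_eq
  have hz : ∀ x : ℤ × (ℤ × ℤ), (x.1 : 𝕜) * W x + ((x.2.1 + x.2.2 - x.1 : ℤ) : 𝕜) * W x +
      (((-x.2.1 : ℤ) : 𝕜) * W x + ((-x.2.2 : ℤ) : 𝕜) * W x) = 0 := fun x => by
    push_cast; ring
  simp only [hz, tsum_zero] at hsum
  have hX : ∑' x : ℤ × (ℤ × ℤ), (x.1 : 𝕜) * W x = 0 := by linear_combination -hsum / 4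
  rw [← hX, hs.tsum_prod' fun k => ?_]
  · refine tsum_congr fun k => ?_
    simp only [hW]
    rw [tsum_mul_left, tsum_mul_left, conv3]
  · have h1 := ((summable_conv3 hd hd hd k).of_norm.mul_left (d (-k))).mul_left (k : 𝕜)
    simpa only [hW] using h1

end conv

end MKdV

end

/-! ### From mild profiles to the Fourier coefficients of mKdV -/

noncomputable section

namespace MKdV

/-! ### The Fourier coefficients of the mKdV flow -/

/-- `d t n` are the Fourier coefficients of a smooth mKdV flow, dominated by the rapidly decreasing
sequence `A`. -/
structure IsFlow (δ : ℝ) (A : ℤ → ℝ) (d : ℝ → ℤ → ℂ) : Prop where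
  rapid : Rapid A
  bound : ∀ t n, ‖d t n‖ ≤ A n
  hasDerivAt : ∀ t ∈ Set.Ioo (-δ) δ, ∀ n : ℤ, HasDerivAt (fun t => d t n)
    (Complex.I * n ^ 3 * d t n - Complex.I * n / 3 * conv3 (d t) (d t) (d t) n) t

theorem IsFlow.rapid_apply {δ : ℝ} {A : ℤ → ℝ} {d : ℝ → ℤ → ℂ} (h : IsFlow δ A d) (t : ℝ) :
    Rapid (d t) :=
  h.rapid.mono fun n => (h.bound t n).trans (Real.le_norm_self _)

section

variable {δ : ℝ} (hδ : 0 < δ)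

theorem hasDerivAt_duhamel (hδ : 0 < δ) (φ : ℝ) (a b c : Holder δ) {t : ℝ}
    (ht : t ∈ Set.Ioo (-δ) δ) :
    HasDerivAt (duhamel δ φ a b c) (Complex.exp (Complex.I * (φ * t : ℝ)) *
      (Holder.eval t a * Holder.eval t b * Holder.eval t c)) t := by
  refine ((continuous_duhamel_integrand φ a b c hδ).integral_hasStrictDerivAt 0
    t).hasDerivAt.congr_of_eventuallyEq ?_
  filter_upwards [Ioo_mem_nhds ht.1 ht.2] with r hr
  unfold duhamel
  rw [clamp_of_mem (Set.Ioo_subset_Icc_self hr)]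

/-- Termwise differentiation of the Duhamel series, dominated by the triple convolution of the
norms. It is confined to the open interval because the integral is frozen outside [-δ, δ]. -/
theorem IsMild.hasDerivAt {α : ℤ → ℂ} {a : ℤ → Holder δ} (h : IsMild hδ α a) (ha : Rapid a)
    (hs : ∀ n, Summable (cubicTerm hδ a a a n)) (n : ℤ) {t : ℝ} (ht : t ∈ Set.Ioo (-δ) δ) :
    HasDerivAt (fun t => Holder.eval t (a n))
      (Complex.I * n * (Holder.eval t (a n) ^ 2 * Holder.eval t (a (-n))) -
        Complex.I * n / 3 * ∑' e : ℤ × ℤ, if Nonres (n - (e.1 + e.2)) e.1 e.2 then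
          Complex.exp (Complex.I * (phase (n - (e.1 + e.2)) e.1 e.2 * t : ℝ)) *
            (Holder.eval t (a (n - (e.1 + e.2))) *
              (Holder.eval t (a e.1) * Holder.eval t (a e.2))) else 0) t := by
  have h1 : (fun t => Holder.eval t (a n)) = fun t => α n +
      (Complex.I * n * duhamel δ 0 (a n) (a n) (a (-n)) t +
        ∑' e, Holder.eval t (cubicTerm hδ a a a n e)) := by
    funext t
    rw [← eval_cubic hδ (hs n), ← Holder.eval_const (δ := δ) (α n) t, ← map_add, ← h n]
  have hb : Summable fun e : ℤ × ℤ =>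
      ‖Complex.I * n / 3‖ * ‖‖a (n - (e.1 + e.2))‖ * (‖a e.1‖ * ‖a e.2‖)‖ :=
    (summable_conv3 ha.norm ha.norm ha.norm n).mul_left _
  have hterm : ∀ e : ℤ × ℤ, ∀ y ∈ Set.Ioo (-δ) δ,
      HasDerivAt (fun t => Holder.eval t (cubicTerm hδ a a a n e))
      (-(Complex.I * n / 3) * if Nonres (n - (e.1 + e.2)) e.1 e.2 then
          Complex.exp (Complex.I * (phase (n - (e.1 + e.2)) e.1 e.2 * y : ℝ)) *
            (Holder.eval y (a (n - (e.1 + e.2))) *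
              (Holder.eval y (a e.1) * Holder.eval y (a e.2))) else 0) y := by
    intro e y hy
    simp only [eval_cubicTerm]
    split_ifs
    · rw [← mul_assoc (Holder.eval y (a (n - (e.1 + e.2))))]
      exact (hasDerivAt_duhamel hδ _ _ _ _ hy).const_mul _
    · rw [mul_zero]
      exact hasDerivAt_const _ _
  have hbound : ∀ e : ℤ × ℤ, ∀ y ∈ Set.Ioo (-δ) δ,
      ‖(-(Complex.I * n / 3) * if Nonres (n - (e.1 + e.2)) e.1 e.2 then
          Complex.exp (Complex.I * (phase (n - (e.1 + e.2)) e.1 e.2 * y : ℝ)) *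
            (Holder.eval y (a (n - (e.1 + e.2))) *
              (Holder.eval y (a e.1) * Holder.eval y (a e.2))) else 0)‖ ≤
      ‖Complex.I * n / 3‖ * ‖‖a (n - (e.1 + e.2))‖ * (‖a e.1‖ * ‖a e.2‖)‖ := by
    intro e y _
    rw [norm_mul, norm_neg]
    gcongr
    rw [Real.norm_of_nonneg (by positivity)]
    split_ifs
    · rw [norm_mul, norm_exp_mul_I, one_mul, norm_mul, norm_mul]
      gcongr <;> exact Holder.norm_eval_le _ _
    · rw [norm_zero]; positivity
  have h0 : (0 : ℝ) ∈ Set.Ioo (-δ) δ := by constructor <;> linarith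
  have hsum0 : Summable fun e => Holder.eval 0 (cubicTerm hδ a a a n e) :=
    (hs n).map (Holder.eval 0) (Holder.eval 0).continuous
  have h2 := hasDerivAt_tsum_of_isPreconnected hb isOpen_Ioo isPreconnected_Ioo hterm hbound h0
    hsum0 ht
  have h3 := (((hasDerivAt_duhamel hδ 0 (a n) (a n) (a (-n)) ht).const_mul
    (Complex.I * n)).add h2).const_add (α n)
  rw [h1]
  convert! h3 using 1
  rw [tsum_mul_left]
  simp only [zero_mul, Complex.ofReal_zero, mul_zero, Complex.exp_zero, one_mul]
  ring

theorem IsMild.eval_zero {α : ℤ → ℂ} {a : ℤ → Holder δ} (h : IsMild hδ α a)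
    (hs : ∀ n, Summable (cubicTerm hδ a a a n)) (n : ℤ) : Holder.eval 0 (a n) = α n := by
  have hz : ∀ φ (x y z : Holder δ), duhamel δ φ x y z 0 = 0 := fun φ x y z => by
    unfold duhamel
    rw [clamp_of_mem (by constructor <;> linarith), intervalIntegral.integral_same]
  rw [h n, map_add, Holder.eval_const, eval_cubic hδ (hs n), hz]
  simp [eval_cubicTerm, hz]

/-- The Fourier coefficients at time `t` of the solution with mild profile `a`;
`m` is the mean of the square of the solution. -/
def gauge (m : ℝ) (a : ℤ → Holder δ) (t : ℝ) (n : ℤ) : ℂ :=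
  Complex.exp (Complex.I * ((((n : ℝ) ^ 3 - n * m) * t : ℝ))) * Holder.eval t (a n)

theorem norm_gauge (m : ℝ) (a : ℤ → Holder δ) (t : ℝ) (n : ℤ) :
    ‖gauge m a t n‖ = ‖Holder.eval t (a n)‖ := by
  rw [gauge, norm_mul, norm_exp_mul_I, one_mul]

theorem norm_gauge_le (m : ℝ) (a : ℤ → Holder δ) (t : ℝ) (n : ℤ) :
    ‖gauge m a t n‖ ≤ ‖a n‖ := by
  rw [norm_gauge]; exact Holder.norm_eval_le _ _

theorem rapid_gauge (m : ℝ) {a : ℤ → Holder δ} (ha : Rapid a) (t : ℝ) : Rapid (gauge m a t) :=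
  ha.mono (norm_gauge_le m a t)

/-- Conservation of M(t) = Σ d_k d_{-k} is not yet available, so the defect n(M(t) - m) is retained;
it is odd in n, which suffices to prove that M is constant. -/
theorem hasDerivAt_gauge_aux (m : ℝ) {α : ℤ → ℂ} {a : ℤ → Holder δ} (h : IsMild hδ α a)
    (ha : Rapid a) (hs : ∀ n, Summable (cubicTerm hδ a a a n)) (n : ℤ) {t : ℝ}
    (ht : t ∈ Set.Ioo (-δ) δ) :
    HasDerivAt (fun t => gauge m a t n)
      (Complex.I * (n ^ 3 - n * m + n * ∑' k, gauge m a t k * gauge m a t (-k)) * gauge m a t n -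
        Complex.I * n / 3 * conv3 (gauge m a t) (gauge m a t) (gauge m a t) n) t := by
  set d := gauge m a t with hd
  have hrd : Rapid d := rapid_gauge m ha t
  set w : ℂ := Complex.I * ((n : ℝ) ^ 3 - n * m : ℝ) with hw
  have h1 : HasDerivAt (fun t : ℝ => Complex.exp (Complex.I * ((((n : ℝ) ^ 3 - n * m) * t : ℝ))))
      (Complex.exp (Complex.I * ((((n : ℝ) ^ 3 - n * m) * t : ℝ))) * w) t := by
    have h2 : HasDerivAt (fun t : ℝ => Complex.I * ((((n : ℝ) ^ 3 - n * m) * t : ℝ) : ℂ)) w t := by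
      have := ((hasDerivAt_id t).const_mul ((n : ℝ) ^ 3 - n * m)).ofReal_comp.const_mul Complex.I
      simpa [hw] using this
    exact h2.cexp
  have h3 := h1.mul (h.hasDerivAt hδ ha hs n ht)
  refine h3.congr_deriv ?_
  have hres : Complex.I * n * (∑' e : ℤ × ℤ, (if Nonres (n - (e.1 + e.2)) e.1 e.2 then
      d (n - (e.1 + e.2)) * (d e.1 * d e.2) else 0)) = Complex.I * n *
      (conv3 d d d n - 3 * (∑' k, d k * d (-k)) * d n + 3 * (d n ^ 2 * d (-n))) := by
    -- For n = 0 the resonant count fails, but the prefactor n vanishes.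
    rcases eq_or_ne n 0 with rfl | hn
    · simp
    · rw [tsum_nonres hrd hn]
  have hquad : Complex.exp (Complex.I * ((((n : ℝ) ^ 3 - n * m) * t : ℝ))) *
      (Holder.eval t (a n) ^ 2 * Holder.eval t (a (-n))) = d n ^ 2 * d (-n) := by
    rw [hd]
    unfold gauge
    have : Complex.exp (Complex.I * (((((-n : ℤ) : ℝ) ^ 3 - (-n : ℤ) * m) * t : ℝ))) *
        Complex.exp (Complex.I * ((((n : ℝ) ^ 3 - n * m) * t : ℝ))) = 1 := by
      rw [← Complex.exp_add, ← Complex.exp_zero]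
      congr 1
      push_cast
      ring
    linear_combination (-Complex.exp (Complex.I * ((((n : ℝ) ^ 3 - n * m) * t : ℝ))) *
      (Holder.eval t (a n) ^ 2 * Holder.eval t (a (-n)))) * this
  have hcub : Complex.exp (Complex.I * ((((n : ℝ) ^ 3 - n * m) * t : ℝ))) *
      (∑' e : ℤ × ℤ, if Nonres (n - (e.1 + e.2)) e.1 e.2 then
          Complex.exp (Complex.I * (phase (n - (e.1 + e.2)) e.1 e.2 * t : ℝ)) *
            (Holder.eval t (a (n - (e.1 + e.2))) *
              (Holder.eval t (a e.1) * Holder.eval t (a e.2))) else 0) =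
      ∑' e : ℤ × ℤ, (if Nonres (n - (e.1 + e.2)) e.1 e.2 then
      d (n - (e.1 + e.2)) * (d e.1 * d e.2) else 0) := by
    rw [← tsum_mul_left]
    refine tsum_congr fun e => ?_
    split_ifs
    · rw [hd]
      unfold gauge
      -- The cubic phases differ by `phase`, while n m is additive in the frequencies and factors
      -- through the product.
      have : Complex.exp (Complex.I * ((((n : ℝ) ^ 3 - n * m) * t : ℝ))) *
          Complex.exp (Complex.I * (phase (n - (e.1 + e.2)) e.1 e.2 * t : ℝ)) =
          Complex.exp (Complex.I * (((((n - (e.1 + e.2) : ℤ) : ℝ) ^ 3 -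
            (n - (e.1 + e.2) : ℤ) * m) * t : ℝ))) *
          (Complex.exp (Complex.I * ((((e.1 : ℝ) ^ 3 - e.1 * m) * t : ℝ))) *
            Complex.exp (Complex.I * ((((e.2 : ℝ) ^ 3 - e.2 * m) * t : ℝ)))) := by
        simp only [← Complex.exp_add]
        congr 1
        unfold phase
        push_cast
        ring
      linear_combination (Holder.eval t (a (n - (e.1 + e.2))) *
              (Holder.eval t (a e.1) * Holder.eval t (a e.2))) * this
    · rw [mul_zero]
  have hg : Complex.exp (Complex.I * ((((n : ℝ) ^ 3 - n * m) * t : ℝ))) * Holder.eval t (a n) =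
    d n := rfl
  rw [← hcub] at hres
  have hw' : w = Complex.I * (n ^ 3 - n * m) := by rw [hw]; push_cast; ring
  linear_combination w * hg + d n * hw' + Complex.I * n * hquad - hres / 3

/-- In the derivative of d_k d_{-k} all terms linear in d cancel, their multipliers being odd in k.
The quartic rest sums to zero by `tsum_mul_conv3_eq_zero`, so M keeps its initial value m. -/
theorem IsMild.tsum_gauge_eq {m : ℝ} {α : ℤ → ℂ} {a : ℤ → Holder δ} (h : IsMild hδ α a)
    (ha : Rapid a) (hs : ∀ n, Summable (cubicTerm hδ a a a n))
    (hm : ∑' k, α k * α (-k) = m) {t : ℝ} (ht : t ∈ Set.Ioo (-δ) δ) :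
    ∑' k, gauge m a t k * gauge m a t (-k) = m := by
  have hA := ha.norm
  set A : ℤ → ℝ := fun n => ‖a n‖ with hAdef
  have hA0 : ∀ n, 0 ≤ A n := fun n => norm_nonneg _
  set H : ℤ → ℝ := fun k => |(k : ℝ)| * (A (-k) * conv3 A A A k) with hH
  have hcA := hA.conv3 hA hA
  have hc0 : ∀ k, 0 ≤ conv3 A A A k := fun k => tsum_nonneg fun e =>
    mul_nonneg (hA0 _) (mul_nonneg (hA0 _) (hA0 _))
  obtain ⟨C, hC⟩ := hA 0
  have hAC : ∀ n, A n ≤ C := fun n => by simpa [hAdef] using hC n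
  have hHs : Summable H := by
    refine Summable.of_nonneg_of_le (fun k => ?_) (fun k => ?_) ((hcA.summable 1).mul_left C)
    · have := hc0 k; have := hA0 (-k); positivity
    · rw [Real.norm_of_nonneg (hc0 k), pow_one]
      have h1 := hc0 k
      have hb : |(k : ℝ)| ≤ br k := by unfold br; linarith
      have hb' := br_pos k
      calc _ ≤ br k * (C * conv3 A A A k) := by
            simp only [hH]; gcongr; exact hAC _
        _ = _ := by ring
  have hH' : Summable fun k => H (-k) := (Equiv.neg ℤ).summable_iff.2 hHs
  set h4 : ℝ → ℤ → ℂ := fun t k =>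
    (k : ℂ) * (gauge m a t (-k) * conv3 (gauge m a t) (gauge m a t) (gauge m a t) k) with h4def
  have h4b : ∀ t k, ‖h4 t k‖ ≤ H k := by
    intro t k
    simp only [h4def, hH]
    rw [norm_mul, norm_mul, Complex.norm_intCast]
    gcongr
    · exact norm_gauge_le m a t _
    · exact norm_conv3_le hA hA hA (norm_gauge_le m a t) (norm_gauge_le m a t)
        (norm_gauge_le m a t) k
  have hder : ∀ k : ℤ, ∀ y ∈ Set.Ioo (-δ) δ,
      HasDerivAt (fun t => gauge m a t k * gauge m a t (-k))
        (-(Complex.I / 3) * (h4 y k + h4 y (-k))) y := by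
    intro k y hy
    refine ((hasDerivAt_gauge_aux hδ m h ha hs k hy).mul
      (hasDerivAt_gauge_aux hδ m h ha hs (-k) hy)).congr_deriv ?_
    simp only [h4def, neg_neg]
    push_cast
    ring
  have hb : ∀ k : ℤ, ∀ y ∈ Set.Ioo (-δ) δ,
      ‖-(Complex.I / 3) * (h4 y k + h4 y (-k))‖ ≤ 1 / 3 * (H k + H (-k)) := by
    intro k y _
    rw [norm_mul]
    gcongr
    · simp
    · exact (norm_add_le _ _).trans (add_le_add (h4b _ _) (h4b _ _))
  have h0 : (0 : ℝ) ∈ Set.Ioo (-δ) δ := by constructor <;> linarith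
  have hg0 : ∀ n, gauge m a 0 n = α n := fun n => by
    simp [gauge, h.eval_zero hδ hs n]
  have hsum0 : Summable fun k => gauge m a 0 k * gauge m a 0 (-k) := by
    refine Summable.of_norm_bounded ((rapid_gauge m ha 0).summable_norm.mul_right C) fun k => ?_
    rw [norm_mul]
    gcongr
    exact (norm_gauge_le m a 0 _).trans (hAC _)
  have hd : ∀ y ∈ Set.Ioo (-δ) δ,
      HasDerivAt (fun t => ∑' k, gauge m a t k * gauge m a t (-k)) 0 y := by
    intro y hy
    refine (hasDerivAt_tsum_of_isPreconnected ((hHs.add hH').mul_left (1 / 3)) isOpen_Ioo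
      isPreconnected_Ioo hder hb h0 hsum0 hy).congr_deriv ?_
    have hsy : Summable (h4 y) := Summable.of_norm_bounded hHs (h4b y)
    have hz : ∑' k, h4 y k = 0 := tsum_mul_conv3_eq_zero (rapid_gauge m ha y)
    have hsy' : Summable fun k => h4 y (-k) := (Equiv.neg ℤ).summable_iff.2 hsy
    rw [tsum_mul_left, hsy.tsum_add hsy',
      show ∑' k, h4 y (-k) = ∑' k, h4 y k from (Equiv.neg ℤ).tsum_eq (h4 y), hz]
    simp
  have hconst := isOpen_Ioo.is_const_of_deriv_eq_zero (𝕜 := ℝ) isPreconnected_Ioo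
    (fun y hy => (hd y hy).differentiableAt.differentiableWithinAt)
    (fun y hy => (hd y hy).deriv) ht h0
  simp only [hg0] at hconst
  rw [hconst, hm]

theorem IsMild.isFlow {m : ℝ} {α : ℤ → ℂ} {a : ℤ → Holder δ} (h : IsMild hδ α a)
    (ha : Rapid a) (hs : ∀ n, Summable (cubicTerm hδ a a a n))
    (hm : ∑' k, α k * α (-k) = m) : IsFlow δ (fun n => ‖a n‖) (gauge m a) where
  rapid := ha.norm
  bound := norm_gauge_le m a
  hasDerivAt t ht n := by
    refine (hasDerivAt_gauge_aux hδ m h ha hs n ht).congr_deriv ?_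
    rw [h.tsum_gauge_eq hδ ha hs hm ht]
    ring

end

end MKdV

end

/-! ### Classical solutions from rapidly decreasing Fourier coefficients -/

noncomputable section

namespace MKdV

/-! ### Smooth solutions from Fourier coefficients -/

/-- The character `x ↦ e^{inx}`. -/
def char (n : ℤ) (x : ℝ) : ℂ := Complex.exp (Complex.I * (n * x : ℝ))

@[simp] theorem norm_char (n : ℤ) (x : ℝ) : ‖char n x‖ = 1 := norm_exp_mul_I _

theorem char_add (m n : ℤ) (x : ℝ) : char (m + n) x = char m x * char n x := by
  unfold char
  rw [← Complex.exp_add]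
  congr 1
  push_cast
  ring

theorem char_neg (n : ℤ) (x : ℝ) : char (-n) x = starRingEnd ℂ (char n x) := by
  unfold char
  rw [← Complex.exp_conj]
  congr 1
  simp

theorem char_periodic (n : ℤ) : Function.Periodic (char n) (2 * Real.pi) := by
  intro x
  unfold char
  rw [← mul_one (Complex.exp (Complex.I * (n * x : ℝ))), ← Complex.exp_int_mul_two_pi_mul_I n,
    ← Complex.exp_add]
  congr 1
  push_cast
  ring

theorem hasDerivAt_char (n : ℤ) (x : ℝ) : HasDerivAt (char n) (Complex.I * n * char n x) x := by
  have h : HasDerivAt (fun x : ℝ => Complex.I * ((n * x : ℝ) : ℂ)) (Complex.I * n) x := by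
    have := ((hasDerivAt_id x).const_mul (n : ℝ)).ofReal_comp.const_mul Complex.I
    simpa using this
  refine h.cexp.congr_deriv ?_
  unfold char
  ring

/-- The Fourier series with coefficients `b`. -/
def fourierSum (b : ℤ → ℂ) (x : ℝ) : ℂ := ∑' n, b n * char n x

theorem Rapid.summable_char {b : ℤ → ℂ} (hb : Rapid b) (x : ℝ) :
    Summable fun n => b n * char n x :=
  Summable.of_norm_bounded hb.summable_norm fun n => by rw [norm_mul, norm_char, mul_one]

theorem fourierSum_periodic (b : ℤ → ℂ) : Function.Periodic (fourierSum b) (2 * Real.pi) :=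
  fun x => tsum_congr fun n => by rw [char_periodic n x]

theorem conj_fourierSum {b : ℤ → ℂ} (hb : ∀ n, b (-n) = starRingEnd ℂ (b n)) (x : ℝ) :
    starRingEnd ℂ (fourierSum b x) = fourierSum b x := by
  unfold fourierSum
  rw [Complex.conj_tsum, ← (Equiv.neg ℤ).tsum_eq]
  refine tsum_congr fun n => ?_
  rw [Equiv.neg_apply, map_mul, hb, char_neg, Complex.conj_conj, Complex.conj_conj]

theorem ofReal_re_fourierSum {b : ℤ → ℂ} (hb : ∀ n, b (-n) = starRingEnd ℂ (b n)) (x : ℝ) :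
    ((fourierSum b x).re : ℂ) = fourierSum b x :=
  Complex.conj_eq_iff_re.1 (conj_fourierSum hb x)

/-- The coefficients of the `j`-th derivative. -/
def dcoef (j : ℕ) (b : ℤ → ℂ) (n : ℤ) : ℂ := (Complex.I * n) ^ j * b n

theorem norm_I_mul_pow_le (j : ℕ) (n : ℤ) : ‖(Complex.I * n : ℂ) ^ j‖ ≤ 1 * br n ^ j := by
  rw [norm_pow, norm_mul, Complex.norm_I, one_mul, one_mul, Complex.norm_intCast]
  gcongr
  unfold br; linarith

theorem Rapid.dcoef {b : ℤ → ℂ} (hb : Rapid b) (j : ℕ) : Rapid (dcoef j b) :=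
  hb.mul (norm_I_mul_pow_le j)

theorem dcoef_zero (b : ℤ → ℂ) : dcoef 0 b = b := by
  funext n; simp [dcoef]

theorem dcoef_succ' (j : ℕ) (b : ℤ → ℂ) : dcoef (j + 1) b = dcoef j (dcoef 1 b) := by
  funext n; simp only [dcoef]; ring

theorem dcoef_succ (j : ℕ) (b : ℤ → ℂ) (n : ℤ) :
    dcoef (j + 1) b n = Complex.I * n * dcoef j b n := by
  simp only [dcoef]; ring

/-- Termwise differentiation in x and t jointly; A and B dominate uniformly in time. -/
theorem hasFDerivAt_fourierSum {δ : ℝ} {f g : ℝ → ℤ → ℂ} {A B : ℤ → ℝ} (hA : Rapid A)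
    (hB : Rapid B) (hf : ∀ t n, ‖f t n‖ ≤ A n) (hg : ∀ t n, ‖g t n‖ ≤ B n)
    (hfg : ∀ t ∈ Set.Ioo (-δ) δ, ∀ n, HasDerivAt (fun t => f t n) (g t n) t) {z : ℝ × ℝ}
    (hz : z.2 ∈ Set.Ioo (-δ) δ) :
    HasFDerivAt (fun z : ℝ × ℝ => fourierSum (f z.2) z.1)
      ((ContinuousLinearMap.fst ℝ ℝ ℝ).smulRight (fourierSum (dcoef 1 (f z.2)) z.1) +
        (ContinuousLinearMap.snd ℝ ℝ ℝ).smulRight (fourierSum (g z.2) z.1)) z := by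
  have hrf : ∀ t, Rapid (f t) := fun t => hA.mono fun n => (hf t n).trans (Real.le_norm_self _)
  have hrg : ∀ t, Rapid (g t) := fun t => hB.mono fun n => (hg t n).trans (Real.le_norm_self _)
  have hu : Summable fun n : ℤ => br n ^ 1 * ‖A n‖ + ‖B n‖ := (hA.summable 1).add hB.summable_norm
  have ho : IsOpen (Set.univ ×ˢ Set.Ioo (-δ) δ : Set (ℝ × ℝ)) := isOpen_univ.prod isOpen_Ioo
  have hpc : IsPreconnected (Set.univ ×ˢ Set.Ioo (-δ) δ : Set (ℝ × ℝ)) :=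
    isPreconnected_univ.prod isPreconnected_Ioo
  have hterm : ∀ (n : ℤ), ∀ y ∈ (Set.univ ×ˢ Set.Ioo (-δ) δ : Set (ℝ × ℝ)),
      HasFDerivAt (fun z : ℝ × ℝ => f z.2 n * char n z.1)
      ((ContinuousLinearMap.fst ℝ ℝ ℝ).smulRight (dcoef 1 (f y.2) n * char n y.1) +
        (ContinuousLinearMap.snd ℝ ℝ ℝ).smulRight (g y.2 n * char n y.1)) y := by
    intro n y hy
    have h1 := (hfg y.2 hy.2 n).hasFDerivAt.comp y (hasFDerivAt_snd (𝕜 := ℝ) (p := y))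
    have h2 := (hasDerivAt_char n y.1).hasFDerivAt.comp y (hasFDerivAt_fst (𝕜 := ℝ) (p := y))
    refine (h1.mul h2).congr_fderiv ?_
    ext <;> simp [dcoef] <;> ring
  have hbd : ∀ (n : ℤ), ∀ y ∈ (Set.univ ×ˢ Set.Ioo (-δ) δ : Set (ℝ × ℝ)),
      ‖(ContinuousLinearMap.fst ℝ ℝ ℝ).smulRight (dcoef 1 (f y.2) n * char n y.1) +
        (ContinuousLinearMap.snd ℝ ℝ ℝ).smulRight (g y.2 n * char n y.1)‖ ≤
      br n ^ 1 * ‖A n‖ + ‖B n‖ := by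
    intro n y _
    have hb := br_pos n
    refine (norm_add_le _ _).trans (add_le_add ?_ ?_)
    · rw [ContinuousLinearMap.norm_smulRight_apply, norm_mul, norm_char, mul_one, dcoef, norm_mul]
      calc _ ≤ 1 * ((1 * br n ^ 1) * ‖A n‖) := by
            gcongr
            · exact ContinuousLinearMap.norm_fst_le ℝ ℝ ℝ
            · exact norm_I_mul_pow_le 1 n
            · exact (hf _ _).trans (Real.le_norm_self _)
        _ = _ := by ring
    · rw [ContinuousLinearMap.norm_smulRight_apply, norm_mul, norm_char, mul_one]
      calc _ ≤ 1 * ‖B n‖ := by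
            gcongr
            · exact ContinuousLinearMap.norm_snd_le ℝ ℝ ℝ
            · exact (hg _ _).trans (Real.le_norm_self _)
        _ = _ := by ring
  have hz' : z ∈ (Set.univ ×ˢ Set.Ioo (-δ) δ : Set (ℝ × ℝ)) := ⟨trivial, hz⟩
  refine (hasFDerivAt_tsum_of_isPreconnected hu ho hpc hterm hbd hz'
    ((hrf z.2).summable_char z.1) hz').congr_fderiv ?_
  have s1 := (((hrf z.2).dcoef 1).summable_char z.1).hasSum.mapL
    (ContinuousLinearMap.smulRightL ℝ (ℝ × ℝ) ℂ (ContinuousLinearMap.fst ℝ ℝ ℝ))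
  have s2 := ((hrg z.2).summable_char z.1).hasSum.mapL
    (ContinuousLinearMap.smulRightL ℝ (ℝ × ℝ) ℂ (ContinuousLinearMap.snd ℝ ℝ ℝ))
  exact (s1.add s2).tsum_eq

section flow

variable {δ : ℝ} {A : ℤ → ℝ} {d : ℝ → ℤ → ℂ} (h : IsFlow δ A d)

theorem fourierSum_add {b c : ℤ → ℂ} (hb : Rapid b) (hc : Rapid c) (x : ℝ) :
    fourierSum (fun n => b n + c n) x = fourierSum b x + fourierSum c x := by
  unfold fourierSum
  rw [← (hb.summable_char x).tsum_add (hc.summable_char x)]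
  exact tsum_congr fun n => add_mul _ _ _

theorem fourierSum_const_mul (k : ℂ) (b : ℤ → ℂ) (x : ℝ) :
    fourierSum (fun n => k * b n) x = k * fourierSum b x := by
  unfold fourierSum
  rw [← tsum_mul_left]
  exact tsum_congr fun n => mul_assoc _ _ _

theorem fourierSum_conv3 {f g h : ℤ → ℂ} (hf : Rapid f) (hg : Rapid g) (hh : Rapid h) (x : ℝ) :
    fourierSum (conv3 f g h) x = fourierSum f x * (fourierSum g x * fourierSum h x) := by
  have hc : ∀ {b : ℤ → ℂ}, Rapid b → Rapid fun n => b n * char n x := fun hb =>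
    hb.mono fun n => by rw [norm_mul, norm_char, mul_one]
  unfold fourierSum
  rw [← tsum_conv3 (hc hf) (hc hg) (hc hh)]
  exact tsum_congr fun n => (conv3_mul_character (w := fun n => char n x)
    (fun m n => char_add m n x) n).symm

/-- The time derivative of the coefficients of the `j`-th derivative of a flow. -/
def flowRate (j : ℕ) (b : ℤ → ℂ) (n : ℤ) : ℂ :=
  -1 * dcoef (j + 3) b n + -(1 / 3) * dcoef (j + 1) (conv3 b b b) n

theorem Rapid.const_mul {b : ℤ → ℂ} (hb : Rapid b) (k : ℂ) : Rapid fun n => k * b n :=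
  hb.mul (C := ‖k‖) (j := 0) fun n => by simp

theorem fourierSum_flowRate (j : ℕ) {b : ℤ → ℂ} (hb : Rapid b) (x : ℝ) :
    fourierSum (flowRate j b) x = -1 * fourierSum (dcoef (j + 3) b) x +
      -(1 / 3) * fourierSum (dcoef (j + 1) (conv3 b b b)) x := by
  unfold flowRate
  rw [fourierSum_add ((hb.dcoef _).const_mul _) (((hb.conv3 hb hb).dcoef _).const_mul _),
    fourierSum_const_mul, fourierSum_const_mul]

theorem IsFlow.hasFDerivAt (h : IsFlow δ A d) (j : ℕ) {z : ℝ × ℝ} (hz : z.2 ∈ Set.Ioo (-δ) δ) :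
    HasFDerivAt (fun z : ℝ × ℝ => fourierSum (dcoef j (d z.2)) z.1)
      ((ContinuousLinearMap.fst ℝ ℝ ℝ).smulRight (fourierSum (dcoef (j + 1) (d z.2)) z.1) +
        (ContinuousLinearMap.snd ℝ ℝ ℝ).smulRight (fourierSum (flowRate j (d z.2)) z.1)) z := by
  have hb : ∀ (k : ℕ) {B : ℤ → ℝ}, Rapid B → Rapid fun n => br n ^ k * B n := fun k B hB =>
    hB.mul (C := 1) (j := k) fun n => by
      have := br_pos n
      rw [Real.norm_of_nonneg (by positivity), one_mul]
  have hc := h.rapid.conv3 h.rapid h.rapid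
  have hle : ∀ (k : ℕ) (b : ℤ → ℂ) (B : ℤ → ℝ) (n : ℤ), ‖b n‖ ≤ B n →
      ‖dcoef k b n‖ ≤ br n ^ k * B n := by
    intro k b B n hbn
    have := br_pos n
    rw [dcoef, norm_mul, ← one_mul (br n ^ k)]
    gcongr
    exact norm_I_mul_pow_le k n
  have key := hasFDerivAt_fourierSum (δ := δ) (f := fun t => dcoef j (d t))
    (g := fun t => flowRate j (d t)) (hb j h.rapid) ((hb (j + 3) h.rapid).add (hb (j + 1) hc))
    (fun t n => hle j _ _ n (h.bound t n)) (fun t n => ?_) (fun t ht n => ?_) hz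
  · have e : dcoef 1 (dcoef j (d z.2)) = dcoef (j + 1) (d z.2) := by
      funext n; simp only [dcoef]; ring
    rwa [e] at key
  · refine (norm_add_le _ _).trans (add_le_add ?_ ?_)
    · rw [norm_mul, norm_neg, norm_one, one_mul]
      exact hle _ _ _ _ (h.bound t n)
    · rw [norm_mul]
      have h1 := hle (j + 1) _ _ n (norm_conv3_le h.rapid h.rapid h.rapid (h.bound t)
        (h.bound t) (h.bound t) n)
      have h2 : ‖(-(1 / 3) : ℂ)‖ ≤ 1 := by norm_num
      exact (mul_le_mul h2 h1 (norm_nonneg _) zero_le_one).trans (by rw [one_mul])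
  · refine ((h.hasDerivAt t ht n).const_mul _).congr_deriv ?_
    simp only [flowRate, dcoef]
    linear_combination ((Complex.I * n) ^ j * Complex.I * n ^ 3 * d t n) * Complex.I_sq

/-- Derivatives of u³ are sums of products of derivatives of u. Different orders p, q, r are allowed
so that the Leibniz induction on j closes. -/
theorem IsFlow.contDiffOn_conv3 (h : IsFlow δ A d) {k : ℕ}
    (hk : ∀ j, ContDiffOn ℝ k (fun z : ℝ × ℝ => fourierSum (dcoef j (d z.2)) z.1)
      (Set.univ ×ˢ Set.Ioo (-δ) δ)) (j p q r : ℕ) :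
    ContDiffOn ℝ k (fun z : ℝ × ℝ => fourierSum (dcoef j
      (conv3 (dcoef p (d z.2)) (dcoef q (d z.2)) (dcoef r (d z.2)))) z.1)
      (Set.univ ×ˢ Set.Ioo (-δ) δ) := by
  have hr : ∀ (t : ℝ) j, Rapid (dcoef j (d t)) := fun t j => (h.rapid_apply t).dcoef j
  induction j generalizing p q r with
  | zero =>
    simp only [dcoef_zero, fourierSum_conv3 (hr _ p) (hr _ q) (hr _ r)]
    exact (hk p).mul ((hk q).mul (hk r))
  | succ j ih =>
    refine (((ih (p + 1) q r).add (ih p (q + 1) r)).add (ih p q (r + 1))).congr fun z _ => ?_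
    have c1 := ((hr z.2 (p + 1)).conv3 (hr z.2 q) (hr z.2 r)).dcoef j
    have c2 := ((hr z.2 p).conv3 (hr z.2 (q + 1)) (hr z.2 r)).dcoef j
    have c3 := ((hr z.2 p).conv3 (hr z.2 q) (hr z.2 (r + 1))).dcoef j
    rw [← fourierSum_add c1 c2, ← fourierSum_add (c1.add c2) c3]
    congr 1
    funext n
    have := mul_conv3 (hr z.2 p) (hr z.2 q) (hr z.2 r) (c := Complex.I) n
    simp only [← dcoef_succ] at this
    rw [dcoef_succ', dcoef, dcoef, dcoef, dcoef, dcoef, pow_one, this]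
    ring

/-- The equation trades a time derivative for space derivatives, so the gradient of ∂ₓ^j u is built
from ∂ₓ^{j+1}u, ∂ₓ^{j+3}u and ∂ₓ^{j+1}(u³). The induction on k therefore has to treat all j at once.
-/
theorem IsFlow.contDiffOn (h : IsFlow δ A d) (k : ℕ) :
    ∀ j, ContDiffOn ℝ k (fun z : ℝ × ℝ => fourierSum (dcoef j (d z.2)) z.1)
      (Set.univ ×ˢ Set.Ioo (-δ) δ) := by
  have ho : IsOpen (Set.univ ×ˢ Set.Ioo (-δ) δ : Set (ℝ × ℝ)) := isOpen_univ.prod isOpen_Ioo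
  induction k with
  | zero =>
    intro j
    rw [Nat.cast_zero, contDiffOn_zero]
    exact fun z hz => (h.hasFDerivAt j hz.2).continuousAt.continuousWithinAt
  | succ k ih =>
    intro j
    rw [Nat.cast_succ, contDiffOn_succ_iff_fderiv_of_isOpen ho]
    refine ⟨fun z hz => (h.hasFDerivAt j hz.2).differentiableAt.differentiableWithinAt,
      fun hk => absurd hk (by simp), ?_⟩
    have h2 := h.contDiffOn_conv3 ih (j + 1) 0 0 0
    simp only [dcoef_zero] at h2
    have h3 : ContDiffOn ℝ k (fun z : ℝ × ℝ => fourierSum (flowRate j (d z.2)) z.1)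
        (Set.univ ×ˢ Set.Ioo (-δ) δ) := by
      simp only [fourierSum_flowRate j (h.rapid_apply _)]
      exact (contDiffOn_const.mul (ih (j + 3))).add (contDiffOn_const.mul h2)
    refine ContDiffOn.congr (f := fun z : ℝ × ℝ =>
      ContinuousLinearMap.smulRightL ℝ (ℝ × ℝ) ℂ (ContinuousLinearMap.fst ℝ ℝ ℝ)
        (fourierSum (dcoef (j + 1) (d z.2)) z.1) +
      ContinuousLinearMap.smulRightL ℝ (ℝ × ℝ) ℂ (ContinuousLinearMap.snd ℝ ℝ ℝ)
        (fourierSum (flowRate j (d z.2)) z.1)) ?_ fun z hz => (h.hasFDerivAt j hz.2).fderiv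
    exact ((ContinuousLinearMap.contDiff _).comp_contDiffOn (ih (j + 1))).add
      ((ContinuousLinearMap.contDiff _).comp_contDiffOn h3)

theorem IsFlow.isSmoothSolution (h : IsFlow δ A d)
    (hreal : ∀ t n, d t (-n) = starRingEnd ℂ (d t n)) {T : ℝ} (hT : 0 < T) (hTδ : T < δ) :
    IsSmoothSolution T (fun x => (fourierSum (d 0) x).re) fun x t => (fourierSum (d t) x).re := by
  have hsub : Set.Icc 0 T ⊆ Set.Ioo (-δ) δ := fun t ht => ⟨by linarith [ht.1], by linarith [ht.2]⟩
  have hx : ∀ j, ∀ t ∈ Set.Icc 0 T, ∀ x, HasDerivAt (fun y => (fourierSum (dcoef j (d t)) y).re)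
      (fourierSum (dcoef (j + 1) (d t)) x).re x := by
    intro j t ht x
    have h1 := (h.hasFDerivAt j (z := (x, t)) (hsub ht)).comp_hasDerivAt x
      ((hasDerivAt_id x).prodMk (hasDerivAt_const x t))
    have h2 := Complex.reCLM.hasFDerivAt.comp_hasDerivAt x h1
    refine h2.congr_deriv ?_
    simp
  have ht' : ∀ t ∈ Set.Icc 0 T, ∀ x, HasDerivAt (fun s => (fourierSum (d s) x).re)
      (fourierSum (flowRate 0 (d t)) x).re t := by
    intro t ht x
    have h1 := (h.hasFDerivAt 0 (z := (x, t)) (hsub ht)).comp_hasDerivAt t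
      ((hasDerivAt_const t x).prodMk (hasDerivAt_id t))
    have h2 := Complex.reCLM.hasFDerivAt.comp_hasDerivAt t h1
    simp only [dcoef_zero] at h2
    refine h2.congr_deriv ?_
    simp
  refine ⟨?_, fun t _ x => congrArg Complex.re (fourierSum_periodic (d t) x), fun x => rfl, fun x t ht => ?_⟩
  · have h1 : ContDiffOn ℝ ∞ (fun z : ℝ × ℝ => fourierSum (d z.2) z.1)
        (Set.univ ×ˢ Set.Ioo (-δ) δ) := by
      rw [contDiffOn_infty]
      intro k
      simpa only [dcoef_zero] using h.contDiffOn k 0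
    exact (Complex.reCLM.contDiff.comp_contDiffOn h1).mono (Set.prod_mono_right hsub)
  · have hr := h.rapid_apply t
    rw [(ht' t ht x).hasDerivWithinAt.derivWithin (uniqueDiffOn_Icc hT t ht)]
    have d1 : ∀ j, deriv (fun y => (fourierSum (dcoef j (d t)) y).re) =
        fun y => (fourierSum (dcoef (j + 1) (d t)) y).re := fun j =>
      funext fun x => (hx j t ht x).deriv
    have d1' := d1 0
    simp only [dcoef_zero, zero_add] at d1'
    rw [iteratedDeriv_succ', iteratedDeriv_succ', iteratedDeriv_one, d1', d1, d1,
      fourierSum_flowRate 0 hr]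
    have hc : fourierSum (dcoef 1 (conv3 (d t) (d t) (d t))) x =
        3 * (fourierSum (d t) x ^ 2 * fourierSum (dcoef 1 (d t)) x) := by
      have e : dcoef 1 (conv3 (d t) (d t) (d t)) = fun n => (conv3 (dcoef 1 (d t)) (d t) (d t) n +
          conv3 (d t) (dcoef 1 (d t)) (d t) n) + conv3 (d t) (d t) (dcoef 1 (d t)) n := by
        funext n
        have h1 : dcoef 1 (d t) = fun n => Complex.I * n * d t n := by
          funext n; rw [dcoef, pow_one]
        rw [dcoef, pow_one, mul_conv3 hr hr hr, h1]
      have c1 := (hr.dcoef 1).conv3 hr hr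
      have c2 := hr.conv3 (hr.dcoef 1) hr
      have c3 := hr.conv3 hr (hr.dcoef 1)
      rw [e, fourierSum_add (c1.add c2) c3, fourierSum_add c1 c2,
        fourierSum_conv3 (hr.dcoef 1) hr hr, fourierSum_conv3 hr (hr.dcoef 1) hr,
        fourierSum_conv3 hr hr (hr.dcoef 1)]
      ring
    rw [zero_add, zero_add, hc, ← ofReal_re_fourierSum (hreal t) x]
    have e2 : -1 * fourierSum (dcoef 3 (d t)) x + -(1 / 3) *
        (3 * (((fourierSum (d t) x).re : ℂ) ^ 2 * fourierSum (dcoef 1 (d t)) x)) =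
        -fourierSum (dcoef 3 (d t)) x -
          (((fourierSum (d t) x).re ^ 2 : ℝ) : ℂ) * fourierSum (dcoef 1 (d t)) x := by
      push_cast; ring
    rw [e2, Complex.sub_re, Complex.neg_re, Complex.re_ofReal_mul, Complex.ofReal_re]
    ring

end flow

end MKdV

end

/-! ### Uniqueness of smooth solutions by an energy estimate -/

noncomputable section

namespace MKdV

/-! ### Uniqueness of smooth solutions -/

section strip

variable {T : ℝ}

/-- The space-time strip `ℝ × [0, T]`. -/
def strip (T : ℝ) : Set (ℝ × ℝ) := Set.univ ×ˢ Set.Icc 0 T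

theorem uniqueDiffOn_strip (hT : 0 < T) : UniqueDiffOn ℝ (strip T) :=
  uniqueDiffOn_univ.prod (uniqueDiffOn_Icc hT)

/-- The directional derivative within the strip. -/
def stripDeriv (T : ℝ) (v : ℝ × ℝ) (U : ℝ × ℝ → ℝ) (z : ℝ × ℝ) : ℝ :=
  fderivWithin ℝ U (strip T) z v

theorem contDiffOn_stripDeriv (hT : 0 < T) {U : ℝ × ℝ → ℝ} (hU : ContDiffOn ℝ ∞ U (strip T))
    (v : ℝ × ℝ) : ContDiffOn ℝ ∞ (stripDeriv T v U) (strip T) :=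
  (hU.fderivWithin (uniqueDiffOn_strip hT) (by simp)).clm_apply contDiffOn_const

theorem hasFDerivWithinAt_strip {U : ℝ × ℝ → ℝ} (hU : ContDiffOn ℝ ∞ U (strip T)) {z : ℝ × ℝ}
    (hz : z ∈ strip T) : HasFDerivWithinAt U (fderivWithin ℝ U (strip T) z) (strip T) z :=
  (hU.differentiableOn (by simp) z hz).hasFDerivWithinAt

theorem hasDerivAt_strip {U : ℝ × ℝ → ℝ} (hU : ContDiffOn ℝ ∞ U (strip T)) {t : ℝ}
    (ht : t ∈ Set.Icc 0 T) (x : ℝ) :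
    HasDerivAt (fun y => U (y, t)) (stripDeriv T (1, 0) U (x, t)) x :=
  HasFDerivWithinAt.comp_hasDerivAt (f := fun y => (y, t)) x
    (hasFDerivWithinAt_strip hU ⟨trivial, ht⟩)
    ((hasDerivAt_id x).prodMk (hasDerivAt_const x t)) (Filter.Eventually.of_forall fun _ =>
      ⟨trivial, ht⟩)

theorem hasDerivWithinAt_strip {U : ℝ × ℝ → ℝ} (hU : ContDiffOn ℝ ∞ U (strip T)) {t : ℝ}
    (ht : t ∈ Set.Icc 0 T) (x : ℝ) :
    HasDerivWithinAt (fun s => U (x, s)) (stripDeriv T (0, 1) U (x, t)) (Set.Icc 0 T) t :=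
  (hasFDerivWithinAt_strip hU (z := (x, t)) ⟨trivial, ht⟩).comp_hasDerivWithinAt t
    ((hasDerivAt_const t x).prodMk (hasDerivAt_id t)).hasDerivWithinAt fun _ hs => ⟨trivial, hs⟩

theorem exists_bound_strip {U : ℝ × ℝ → ℝ} (hU : ContinuousOn U (strip T)) :
    ∃ C, ∀ x ∈ Set.Icc 0 (2 * Real.pi), ∀ t ∈ Set.Icc 0 T, |U (x, t)| ≤ C := by
  obtain ⟨C, hC⟩ := (isCompact_Icc.prod isCompact_Icc).exists_bound_of_continuousOn
    (hU.mono (Set.prod_mono_left (Set.subset_univ (Set.Icc 0 (2 * Real.pi)))))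
  exact ⟨C, fun x hx t ht => hC (x, t) ⟨hx, ht⟩⟩

theorem continuous_slice {U : ℝ × ℝ → ℝ} (hU : ContinuousOn U (strip T)) {t : ℝ}
    (ht : t ∈ Set.Icc 0 T) : Continuous fun x => U (x, t) :=
  hU.comp_continuous (by fun_prop) fun _ => ⟨trivial, ht⟩

theorem continuousOn_integral_strip (hT : 0 < T) {U : ℝ × ℝ → ℝ}
    (hU : ContinuousOn U (strip T)) :
    ContinuousOn (fun t => ∫ x in (0 : ℝ)..2 * Real.pi, U (x, t)) (Set.Icc 0 T) := by
  have hc : Continuous (Function.uncurry fun t x : ℝ => U (x, (Set.projIcc 0 T hT.le t : ℝ))) := by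
    refine hU.comp_continuous (f := fun q : ℝ × ℝ => (q.2, (Set.projIcc 0 T hT.le q.1 : ℝ))) ?_
      fun q => ⟨trivial, (Set.projIcc 0 T hT.le q.1).2⟩
    have := continuous_projIcc (h := hT.le)
    fun_prop
  refine (intervalIntegral.continuous_parametric_intervalIntegral_of_continuous' (μ := volume) hc 0
    (2 * Real.pi)).continuousOn.congr fun t ht => ?_
  simp only [Set.projIcc_of_mem hT.le ht]

theorem hasDerivAt_integral_strip (hT : 0 < T) {U : ℝ × ℝ → ℝ}
    (hU : ContDiffOn ℝ ∞ U (strip T)) {t : ℝ} (ht : t ∈ Set.Ioo 0 T) :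
    HasDerivAt (fun t => ∫ x in (0 : ℝ)..2 * Real.pi, U (x, t))
      (∫ x in (0 : ℝ)..2 * Real.pi, stripDeriv T (0, 1) U (x, t)) t := by
  have hD := contDiffOn_stripDeriv hT hU (0, 1)
  obtain ⟨C, hC⟩ := exists_bound_strip hD.continuousOn
  have hsub : ∀ {s}, s ∈ Set.Ioo 0 T → s ∈ Set.Icc 0 T := fun hs => Set.Ioo_subset_Icc_self hs
  refine (intervalIntegral.hasDerivAt_integral_of_dominated_loc_of_deriv_le
    (F := fun t x => U (x, t)) (F' := fun t x => stripDeriv T (0, 1) U (x, t))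
    (bound := fun _ => C) (Ioo_mem_nhds ht.1 ht.2) ?_ ?_ ?_ ?_ ?_ ?_).2
  · filter_upwards [Ioo_mem_nhds ht.1 ht.2] with s hs
    exact (continuous_slice hU.continuousOn (hsub hs)).aestronglyMeasurable
  · exact (continuous_slice hU.continuousOn (hsub ht)).intervalIntegrable _ _
  · exact (continuous_slice hD.continuousOn (hsub ht)).aestronglyMeasurable
  · refine Filter.Eventually.of_forall fun x hx s hs => ?_
    rw [Set.uIoc_of_le Real.two_pi_pos.le] at hx
    exact hC x (Set.Ioc_subset_Icc_self hx) s (hsub hs)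
  · exact intervalIntegrable_const
  · exact Filter.Eventually.of_forall fun x _ s hs =>
      (hasDerivWithinAt_strip hU (hsub hs) x).hasDerivAt (Icc_mem_nhds hs.1 hs.2)

end strip

/-- Let w = u - v and P = u² + uv + v². The nonlinear difference is (Pw)ₓ/3, so (w²)ₜ + Pₓw²/3 is an
exact x-derivative. Integration over a period and Grönwall's inequality give w = 0. -/
theorem IsSmoothSolution.eq_on_period {T : ℝ} (hT : 0 < T) {φ : ℝ → ℝ} {u v : ℝ → ℝ → ℝ}
    (hu : IsSmoothSolution T φ u) (hv : IsSmoothSolution T φ v) {t : ℝ} (ht : t ∈ Set.Icc 0 T)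
    {x : ℝ} (hx : x ∈ Set.Icc 0 (2 * Real.pi)) : u x t = v x t := by
  set S := strip T with hS
  have deriv_eq : ∀ {U : ℝ × ℝ → ℝ}, ContDiffOn ℝ ∞ U S → ∀ t ∈ Set.Icc 0 T,
      deriv (fun y => U (y, t)) = fun y => stripDeriv T (1, 0) U (y, t) := fun hU t ht =>
    funext fun x => (hasDerivAt_strip hU ht x).deriv
  set X : (ℝ × ℝ → ℝ) → ℝ × ℝ → ℝ := stripDeriv T (1, 0) with hX
  have hper : ∀ {U : ℝ × ℝ → ℝ}, ContDiffOn ℝ ∞ U S →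
      (∀ t ∈ Set.Icc 0 T, Function.Periodic (fun x => U (x, t)) (2 * Real.pi)) →
      ∀ t ∈ Set.Icc 0 T, Function.Periodic (fun x => X U (x, t)) (2 * Real.pi) := by
    intro U hU hp t ht x
    have h1 := (hasDerivAt_strip hU ht (x + 2 * Real.pi)).comp_add_const x (2 * Real.pi)
    have h2 : (fun y => U (y + 2 * Real.pi, t)) = fun y => U (y, t) := funext fun y => hp t ht y
    rw [h2] at h1
    exact h1.unique (hasDerivAt_strip hU ht x)
  set a : ℝ × ℝ → ℝ := fun z => u z.1 z.2 with ha
  set b : ℝ × ℝ → ℝ := fun z => v z.1 z.2 with hb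
  have ca : ContDiffOn ℝ ∞ a S := hu.smooth
  have cb : ContDiffOn ℝ ∞ b S := hv.smooth
  have ca1 := contDiffOn_stripDeriv hT ca (1, 0)
  have cb1 := contDiffOn_stripDeriv hT cb (1, 0)
  have ca2 := contDiffOn_stripDeriv hT ca1 (1, 0)
  have cb2 := contDiffOn_stripDeriv hT cb1 (1, 0)
  have eqn : ∀ {w : ℝ → ℝ → ℝ}, IsSmoothSolution T φ w → ∀ x, ∀ t ∈ Set.Icc 0 T,
      stripDeriv T (0, 1) (fun z => w z.1 z.2) (x, t) =
        -X (X (X fun z => w z.1 z.2)) (x, t) - w x t ^ 2 * X (fun z => w z.1 z.2) (x, t) := by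
    intro w hw x t ht
    have c0 : ContDiffOn ℝ ∞ (fun z : ℝ × ℝ => w z.1 z.2) S := hw.smooth
    have c1 := contDiffOn_stripDeriv hT c0 (1, 0)
    have c2 := contDiffOn_stripDeriv hT c1 (1, 0)
    have h := hw.equation x t ht
    have e0 := (hasDerivWithinAt_strip c0 ht x).derivWithin (uniqueDiffOn_Icc hT t ht)
    have e1 := deriv_eq c0 t ht
    simp only at e0 e1
    rw [iteratedDeriv_succ', iteratedDeriv_succ', iteratedDeriv_one, e0, e1, deriv_eq c1 t ht,
      deriv_eq c2 t ht] at h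
    linarith
  set W : ℝ × ℝ → ℝ := fun z => (a z - b z) ^ 2 with hW
  have cW : ContDiffOn ℝ ∞ W S := (ca.sub cb).pow 2
  -- Q is the x-derivative of a² + ab + b².
  set Q : ℝ × ℝ → ℝ := fun z => 2 * a z * X a z + X a z * b z + a z * X b z + 2 * b z * X b z
    with hQ
  have cQ : ContinuousOn Q S := by
    have h1 := ca.continuousOn
    have h2 := cb.continuousOn
    have h3 : ContinuousOn (X a) S := ca1.continuousOn
    have h4 : ContinuousOn (X b) S := cb1.continuousOn
    fun_prop
  obtain ⟨C, hC⟩ := exists_bound_strip cQ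
  set E : ℝ → ℝ := fun t => ∫ x in (0 : ℝ)..2 * Real.pi, W (x, t) with hE
  have hder : ∀ t ∈ Set.Ioo 0 T, ∃ e, HasDerivAt E e t ∧ e ≤ C * E t := by
    intro t ht
    have ht' := Set.Ioo_subset_Icc_self ht
    refine ⟨_, hasDerivAt_integral_strip hT cW ht, ?_⟩
    have cA := (contDiffOn_stripDeriv hT ca2 (1, 0)).continuousOn
    have cWt := (contDiffOn_stripDeriv hT cW (0, 1)).continuousOn
    have hWt : ∀ x, stripDeriv T (0, 1) W (x, t) = 2 * (a (x, t) - b (x, t)) *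
        (-(X (X (X a)) (x, t) - X (X (X b)) (x, t)) -
          (a (x, t) ^ 2 * X a (x, t) - b (x, t) ^ 2 * X b (x, t))) := by
      intro x
      have hn := Icc_mem_nhds ht.1 ht.2
      have h1 := (((hasDerivWithinAt_strip ca ht' x).hasDerivAt hn).sub
        ((hasDerivWithinAt_strip cb ht' x).hasDerivAt hn)).pow 2
      rw [((hasDerivWithinAt_strip cW ht' x).hasDerivAt hn).unique h1, eqn hu x t ht',
        eqn hv x t ht']
      simp only [ha, hb, Pi.sub_apply]
      push_cast
      ring
    -- The flux -(2w wₓₓ - wₓ²) - Pw²/3; its first part is a primitive of -2w wₓₓₓ.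
    set H : ℝ → ℝ := fun x => -(2 * ((a (x, t) - b (x, t)) * (X (X a) (x, t) - X (X b) (x, t))) -
      (X a (x, t) - X b (x, t)) ^ 2) -
      (a (x, t) ^ 2 + a (x, t) * b (x, t) + b (x, t) ^ 2) * (a (x, t) - b (x, t)) ^ 2 / 3 with hH
    have hHd : ∀ x, HasDerivAt H
        (stripDeriv T (0, 1) W (x, t) + 1 / 3 * (Q (x, t) * W (x, t))) x := by
      intro x
      have da := hasDerivAt_strip ca ht' x
      have db := hasDerivAt_strip cb ht' x
      have da1 := hasDerivAt_strip ca1 ht' x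
      have db1 := hasDerivAt_strip cb1 ht' x
      have da2 := hasDerivAt_strip ca2 ht' x
      have db2 := hasDerivAt_strip cb2 ht' x
      have h1 := ((((da.sub db).mul (da2.sub db2)).const_mul 2).sub ((da1.sub db1).pow 2)).neg.sub
        (((((da.pow 2).add (da.mul db)).add (db.pow 2)).mul ((da.sub db).pow 2)).div_const 3)
      refine h1.congr_deriv ?_
      rw [hWt]
      simp only [hQ, hW, hX, Pi.sub_apply, Pi.add_apply, Pi.mul_apply, Pi.pow_apply]
      push_cast
      ring
    have hHper : H (2 * Real.pi) = H 0 := by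
      have p : ∀ (U : ℝ × ℝ → ℝ), (∀ t ∈ Set.Icc 0 T,
          Function.Periodic (fun x => U (x, t)) (2 * Real.pi)) →
          U (2 * Real.pi, t) = U (0, t) := fun U h => by
        have := h t ht' 0
        simpa using this
      simp only [hH]
      rw [p a hu.periodic, p b hv.periodic, p _ (hper ca hu.periodic), p _ (hper cb hv.periodic),
        p _ (hper ca1 (hper ca hu.periodic)), p _ (hper cb1 (hper cb hv.periodic))]
    have i1 : IntervalIntegrable (fun x => stripDeriv T (0, 1) W (x, t)) volume 0
      (2 * Real.pi) := (continuous_slice cWt ht').intervalIntegrable _ _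
    have i2 : IntervalIntegrable (fun x => 1 / 3 * (Q (x, t) * W (x, t))) volume 0
      (2 * Real.pi) := ((continuous_slice (cQ.mul cW.continuousOn) ht').const_mul
        (1 / 3)).intervalIntegrable _ _
    have hint := intervalIntegral.integral_eq_sub_of_hasDerivAt (fun x _ => hHd x) (i1.add i2)
    rw [hHper, sub_self, intervalIntegral.integral_add i1 i2] at hint
    rw [eq_neg_of_add_eq_zero_left hint, ← intervalIntegral.integral_neg, hE]
    simp only
    rw [← intervalIntegral.integral_const_mul]
    refine intervalIntegral.integral_mono_on Real.two_pi_pos.le i2.neg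
      (((continuous_slice cW.continuousOn ht').const_mul C).intervalIntegrable _ _) fun y hy => ?_
    have h1 := abs_le.1 (hC y hy t ht')
    have h2 : 0 ≤ W (y, t) := sq_nonneg _
    nlinarith [h1.1, h1.2]
  -- Grönwall by an integrating factor; differentiability is needed only in the open interval,
  -- continuity up to the endpoints.
  have hanti : AntitoneOn (fun t => Real.exp (-C * t) * E t) (Set.Icc 0 T) := by
    have hexp : ∀ t, HasDerivAt (fun t => Real.exp (-C * t)) (Real.exp (-C * t) * (-C)) t :=
      fun t => by
        have := ((hasDerivAt_id t).const_mul (-C)).exp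
        simpa using this
    refine antitoneOn_of_deriv_nonpos (convex_Icc 0 T) ?_ ?_ ?_
    · exact (by fun_prop : Continuous fun t => Real.exp (-C * t)).continuousOn.mul
        (continuousOn_integral_strip hT cW.continuousOn)
    · rw [interior_Icc]
      intro t ht
      obtain ⟨e, he, -⟩ := hder t ht
      exact ((hexp t).mul he).differentiableAt.differentiableWithinAt
    · rw [interior_Icc]
      intro t ht
      obtain ⟨e, he, hle⟩ := hder t ht
      refine (((hexp t).mul he).deriv).trans_le ?_
      have := Real.exp_pos (-C * t)
      nlinarith
  have h0 := hanti (Set.left_mem_Icc.2 hT.le) ht ht.1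
  have hE0 : E 0 = 0 := by
    simp [hE, hW, ha, hb, hu.initial, hv.initial]
  simp only [hE0, mul_zero] at h0
  by_contra hne
  have hpos : 0 < E t := by
    refine intervalIntegral.integral_pos Real.two_pi_pos
      (continuous_slice cW.continuousOn ht).continuousOn (fun _ _ => sq_nonneg _) ⟨x, hx, ?_⟩
    exact sq_pos_of_ne_zero (sub_ne_zero.2 hne)
  have := Real.exp_pos (-C * t)
  nlinarith

end MKdV

end

/-! ### Fourier analysis of periodic distributions and functions -/

noncomputable section

namespace MKdV

/-! ### Fourier coefficients of functions and distributions -/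

/-- `∫₀^{2π} g e^{inx} dx`. -/
def charInt (g : ℝ → ℝ) (n : ℤ) : ℂ := ∫ x in (0 : ℝ)..2 * Real.pi, (g x : ℂ) * char n x

theorem continuous_char (n : ℤ) : Continuous (char n) :=
  continuous_iff_continuousAt.2 fun x => (hasDerivAt_char n x).continuousAt

theorem charInt_deriv {g g' : ℝ → ℝ} (hg : ∀ x, HasDerivAt g (g' x) x) (hg' : Continuous g')
    (hper : Function.Periodic g (2 * Real.pi)) (n : ℤ) :
    charInt g' n = -(Complex.I * n) * charInt g n := by
  have hc : Continuous g := continuous_iff_continuousAt.2 fun x => (hg x).continuousAt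
  have hch := continuous_char n
  have h1 : ∀ x, HasDerivAt (fun x => (g x : ℂ) * char n x)
      ((g' x : ℂ) * char n x + (Complex.I * n) * ((g x : ℂ) * char n x)) x := fun x => by
    refine ((hg x).ofReal_comp.mul (hasDerivAt_char n x)).congr_deriv ?_
    ring
  have i1 : IntervalIntegrable (fun x => (g' x : ℂ) * char n x) volume 0 (2 * Real.pi) :=
    ((Complex.continuous_ofReal.comp hg').mul hch).intervalIntegrable _ _
  have i2 : IntervalIntegrable (fun x => Complex.I * n * ((g x : ℂ) * char n x)) volume 0
      (2 * Real.pi) :=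
    (((Complex.continuous_ofReal.comp hc).mul hch).const_mul _).intervalIntegrable _ _
  have h2 := intervalIntegral.integral_eq_sub_of_hasDerivAt (fun x _ => h1 x) (i1.add i2)
  have p1 := hper 0
  have p2 := char_periodic n 0
  rw [zero_add] at p1 p2
  rw [p1, p2, sub_self, intervalIntegral.integral_add i1 i2,
    intervalIntegral.integral_const_mul] at h2
  unfold charInt
  linear_combination h2

theorem SmoothPeriodic.deriv_mem {g : ℝ → ℝ} (hg : g ∈ SmoothPeriodic) :
    deriv g ∈ SmoothPeriodic := by
  refine ⟨(contDiff_infty_iff_deriv.1 hg.1).2, fun x => ?_⟩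
  rw [← deriv_comp_add_const]
  congr 1
  exact funext hg.2

theorem SmoothPeriodic.hasDerivAt {g : ℝ → ℝ} (hg : g ∈ SmoothPeriodic) (x : ℝ) :
    HasDerivAt g (deriv g x) x :=
  (hg.1.differentiable (by simp) x).hasDerivAt

theorem SmoothPeriodic.iteratedDeriv_mem {g : ℝ → ℝ} (hg : g ∈ SmoothPeriodic) (k : ℕ) :
    iteratedDeriv k g ∈ SmoothPeriodic := by
  induction k with
  | zero => rwa [iteratedDeriv_zero]
  | succ k ih => rw [iteratedDeriv_succ]; exact SmoothPeriodic.deriv_mem ih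

theorem charInt_iteratedDeriv {g : ℝ → ℝ} (hg : g ∈ SmoothPeriodic) (k : ℕ) (n : ℤ) :
    charInt (iteratedDeriv k g) n = (-(Complex.I * n)) ^ k * charInt g n := by
  induction k with
  | zero => simp
  | succ k ih =>
    have h := SmoothPeriodic.iteratedDeriv_mem hg k
    rw [iteratedDeriv_succ, charInt_deriv (SmoothPeriodic.hasDerivAt h)
      (SmoothPeriodic.deriv_mem h).1.continuous h.2, ih]
    ring

theorem norm_charInt_le {g : ℝ → ℝ} {M : ℝ} (hM : ∀ x, |g x| ≤ M) (n : ℤ) :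
    ‖charInt g n‖ ≤ 2 * Real.pi * M := by
  have h := intervalIntegral.norm_integral_le_of_norm_le_const (a := 0) (b := 2 * Real.pi)
    (f := fun x => (g x : ℂ) * char n x) (C := M) fun x _ => by
      rw [norm_mul, norm_char, mul_one, Complex.norm_real]; exact hM x
  rw [sub_zero, abs_of_pos Real.two_pi_pos] at h
  rw [mul_comm]; exact h

/-- Integration by parts k times, combined with (1+x)^k ≤ 2^{k-1}(1+x^k). For k = 2 it shows that
bounded coefficients define a distribution of order at most 2. -/
theorem br_pow_mul_norm_charInt_le {g : ℝ → ℝ} (hg : g ∈ SmoothPeriodic) (k : ℕ) {M : ℝ}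
    (h0 : ∀ x, |g x| ≤ M) (hk : ∀ x, |iteratedDeriv k g x| ≤ M) (n : ℤ) :
    br n ^ k * ‖charInt g n‖ ≤ 2 ^ (k - 1) * (4 * Real.pi * M) := by
  have h1 := norm_charInt_le h0 n
  have h2 := norm_charInt_le hk n
  rw [charInt_iteratedDeriv hg, norm_mul, norm_pow, norm_neg, norm_mul, Complex.norm_I, one_mul,
    Complex.norm_intCast] at h2
  have h3 : br n ^ k ≤ 2 ^ (k - 1) * (1 + |(n : ℝ)| ^ k) := by
    have := add_pow_le zero_le_one (abs_nonneg (n : ℝ)) k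
    rwa [one_pow] at this
  calc _ ≤ 2 ^ (k - 1) * (1 + |(n : ℝ)| ^ k) * ‖charInt g n‖ := by gcongr
    _ = 2 ^ (k - 1) * (‖charInt g n‖ + |(n : ℝ)| ^ k * ‖charInt g n‖) := by ring
    _ ≤ 2 ^ (k - 1) * (2 * Real.pi * M + 2 * Real.pi * M) := by gcongr
    _ = _ := by ring

theorem SmoothPeriodic.exists_bound {g : ℝ → ℝ} (hg : g ∈ SmoothPeriodic) :
    ∃ M, ∀ x, |g x| ≤ M := by
  obtain ⟨M, hM⟩ := isCompact_Icc.exists_bound_of_continuousOn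
    (hg.1.continuous.continuousOn (s := Set.Icc 0 (2 * Real.pi)))
  refine ⟨M, fun x => ?_⟩
  obtain ⟨y, hy, e⟩ := Function.Periodic.exists_mem_Ico₀ hg.2 Real.two_pi_pos x
  rw [e]
  exact hM y (Set.Ico_subset_Icc_self hy)

theorem SmoothPeriodic.rapid_charInt {g : ℝ → ℝ} (hg : g ∈ SmoothPeriodic) :
    Rapid (charInt g) := by
  intro k
  obtain ⟨M, hM⟩ := SmoothPeriodic.exists_bound hg
  obtain ⟨M', hM'⟩ := SmoothPeriodic.exists_bound (SmoothPeriodic.iteratedDeriv_mem hg k)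
  exact ⟨_, br_pow_mul_norm_charInt_le hg k (M := max M M')
    (fun x => (hM x).trans (le_max_left _ _)) fun x => (hM' x).trans (le_max_right _ _)⟩

theorem charInt_add {g h : ℝ → ℝ} (hg : Continuous g) (hh : Continuous h) (n : ℤ) :
    charInt (g + h) n = charInt g n + charInt h n := by
  have hch := continuous_char n
  have i1 : IntervalIntegrable (fun x => (g x : ℂ) * char n x) volume 0 (2 * Real.pi) :=
    ((Complex.continuous_ofReal.comp hg).mul hch).intervalIntegrable _ _
  have i2 : IntervalIntegrable (fun x => (h x : ℂ) * char n x) volume 0 (2 * Real.pi) :=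
    ((Complex.continuous_ofReal.comp hh).mul hch).intervalIntegrable _ _
  unfold charInt
  rw [← intervalIntegral.integral_add i1 i2]
  refine intervalIntegral.integral_congr fun x _ => ?_
  simp [add_mul]

theorem charInt_smul (c : ℝ) (g : ℝ → ℝ) (n : ℤ) : charInt (c • g) n = c * charInt g n := by
  unfold charInt
  rw [← intervalIntegral.integral_const_mul]
  refine intervalIntegral.integral_congr fun x _ => ?_
  simp [mul_assoc]

theorem charInt_neg (g : ℝ → ℝ) (n : ℤ) :
    charInt g (-n) = starRingEnd ℂ (charInt g n) := by
  unfold charInt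
  rw [← intervalIntegral.intervalIntegral_conj]
  refine intervalIntegral.integral_congr fun x _ => ?_
  simp [char_neg]

theorem summable_mul_charInt {b : ℤ → ℂ} (hb : ∃ C, ∀ n, ‖b n‖ ≤ C) (ψ : SmoothPeriodic) :
    Summable fun n => b n * charInt ψ n := by
  obtain ⟨C, hC⟩ := hb
  refine Summable.of_norm_bounded
    ((SmoothPeriodic.rapid_charInt ψ.2).summable_norm.mul_left C) fun n => ?_
  rw [norm_mul]
  gcongr
  exact hC n

/-- The distribution with the (bounded) Fourier coefficients `b`. -/
def ofCoef (b : ℤ → ℂ) (hb : ∃ C, ∀ n, ‖b n‖ ≤ C) : Distr :=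
  have hsum := summable_mul_charInt hb
  ⟨{ toFun ψ := (∑' n, b n * charInt ψ n).re
     map_add' ψ χ := by
      rw [← Complex.add_re, ← (hsum ψ).tsum_add (hsum χ)]
      congr 2
      funext n
      rw [← mul_add, ← charInt_add ψ.2.1.continuous χ.2.1.continuous]
      rfl
     map_smul' c ψ := by
      rw [RingHom.id_apply, smul_eq_mul, ← Complex.re_ofReal_mul, ← tsum_mul_left]
      congr 2
      funext n
      rw [mul_left_comm, ← charInt_smul]
      rfl }, by
    obtain ⟨C, hC⟩ := hb
    refine ⟨2, C * (∑' n : ℤ, (br n ^ 2)⁻¹) * (8 * Real.pi), fun ψ M hM => ?_⟩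
    have h0 : 0 ≤ C := (norm_nonneg _).trans (hC 0)
    have h1 : ∀ n, ‖b n * charInt ψ n‖ ≤ C * (8 * Real.pi * M) * (br n ^ 2)⁻¹ := fun n => by
      have hb := br_pos n
      have h2 := br_pow_mul_norm_charInt_le ψ.2 2
        (fun x => by simpa using hM 0 (by norm_num) x) (hM 2 le_rfl) n
      rw [norm_mul, mul_assoc]
      gcongr
      · exact hC n
      · rw [← div_eq_mul_inv, le_div_iff₀ (by positivity)]
        norm_num at h2
        linarith
    have h3 := tsum_of_norm_bounded (summable_br_pow.mul_left _).hasSum h1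
    refine (Complex.abs_re_le_norm _).trans (h3.trans (le_of_eq ?_))
    rw [tsum_mul_left]
    ring⟩

theorem pair_ofCoef (b : ℤ → ℂ) (hb : ∃ C, ∀ n, ‖b n‖ ≤ C) (ψ : SmoothPeriodic) :
    (ofCoef b hb).pair ψ = (∑' n, b n * charInt ψ n).re := rfl

/-- Hermitian symmetry makes the pairing real, so the real part in `ofCoef` loses nothing. -/
theorem ofReal_pair_ofCoef {b : ℤ → ℂ} (hb : ∃ C, ∀ n, ‖b n‖ ≤ C)
    (hsymm : ∀ n, b (-n) = starRingEnd ℂ (b n)) (ψ : SmoothPeriodic) :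
    ((ofCoef b hb).pair ψ : ℂ) = ∑' n, b n * charInt ψ n := by
  rw [pair_ofCoef]
  refine Complex.conj_eq_iff_re.1 ?_
  rw [Complex.conj_tsum, ← (Equiv.neg ℤ).tsum_eq]
  refine tsum_congr fun n => ?_
  rw [Equiv.neg_apply, map_mul, hsymm, charInt_neg, Complex.conj_conj, Complex.conj_conj]

theorem integral_char (n : ℤ) :
    ∫ x in (0 : ℝ)..2 * Real.pi, char n x = if n = 0 then (2 * Real.pi : ℂ) else 0 := by
  have h := charInt_deriv (g := fun _ => 1) (g' := fun _ => 0) (fun x => hasDerivAt_const x 1)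
    continuous_const (fun _ => rfl) n
  simp only [charInt, Complex.ofReal_zero, zero_mul, intervalIntegral.integral_zero,
    Complex.ofReal_one, one_mul] at h
  split_ifs with hn
  · subst hn
    simp [char]
  · have h2 : -(Complex.I * (n : ℂ)) ≠ 0 := by simp [hn]
    exact (mul_eq_zero.1 h.symm).resolve_left h2

theorem char_neg_eq (n : ℤ) (x : ℝ) :
    char (-n) x = (Real.cos (n * x) : ℂ) - Complex.I * (Real.sin (n * x) : ℂ) := by
  unfold char
  rw [mul_comm Complex.I, Complex.exp_mul_I, ← Complex.ofReal_cos, ← Complex.ofReal_sin]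
  push_cast
  rw [neg_mul, Complex.cos_neg, Complex.sin_neg]
  ring

theorem charInt_cos_sub_sin (m n : ℤ) :
    charInt (cosTest m) n - Complex.I * charInt (sinTest m) n =
      if n = m then (2 * Real.pi : ℂ) else 0 := by
  have h1 : Continuous fun x => ((cosTest m : ℝ → ℝ) x : ℂ) * char n x :=
    (Complex.continuous_ofReal.comp (cosTest m).2.1.continuous).mul (continuous_char n)
  have h2 : Continuous fun x => Complex.I * (((sinTest m : ℝ → ℝ) x : ℂ) * char n x) :=
    ((Complex.continuous_ofReal.comp (sinTest m).2.1.continuous).mul (continuous_char n)).const_mul _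
  unfold charInt
  rw [← intervalIntegral.integral_const_mul, ← intervalIntegral.integral_sub
    (h1.intervalIntegrable _ _) (h2.intervalIntegrable _ _)]
  have h3 := integral_char (n - m)
  simp only [sub_eq_zero] at h3
  rw [← h3]
  refine intervalIntegral.integral_congr fun x _ => ?_
  rw [sub_eq_add_neg n m, char_add, char_neg_eq]
  change ((Real.cos (m * x) : ℝ) : ℂ) * _ - Complex.I * (((Real.sin (m * x) : ℝ) : ℂ) * _) = _
  ring

theorem fourierCoef_ofCoef {b : ℤ → ℂ} (hb : ∃ C, ∀ n, ‖b n‖ ≤ C)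
    (hsymm : ∀ n, b (-n) = starRingEnd ℂ (b n)) (m : ℤ) :
    fourierCoef (ofCoef b hb) m = b m := by
  have hsum := summable_mul_charInt hb
  unfold fourierCoef
  rw [ofReal_pair_ofCoef hb hsymm, ofReal_pair_ofCoef hb hsymm, ← tsum_mul_left,
    ← (hsum _).tsum_sub ((hsum _).mul_left _)]
  have h1 : ∀ n, b n * charInt (cosTest m) n - Complex.I * (b n * charInt (sinTest m) n) =
      if n = m then b m * (2 * Real.pi) else 0 := fun n => by
    have := charInt_cos_sub_sin m n
    split_ifs with h
    · subst h
      rw [if_pos rfl] at this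
      linear_combination b n * this
    · rw [if_neg h] at this
      linear_combination b n * this
  simp only [h1, tsum_ite_eq]
  have : (2 * Real.pi : ℂ) ≠ 0 := by exact_mod_cast Real.two_pi_pos.ne'
  field_simp

theorem fourierCoef_neg (f : Distr) (n : ℤ) :
    fourierCoef f (-n) = starRingEnd ℂ (fourierCoef f n) := by
  have h1 : cosTest (-n) = cosTest n := by
    refine Subtype.ext (funext fun x => ?_)
    change Real.cos ((-n : ℤ) * x) = Real.cos (n * x)
    push_cast
    rw [neg_mul, Real.cos_neg]
  have h2 : sinTest (-n) = -sinTest n := by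
    refine Subtype.ext (funext fun x => ?_)
    change Real.sin ((-n : ℤ) * x) = -Real.sin (n * x)
    push_cast
    rw [neg_mul, Real.sin_neg]
  unfold fourierCoef
  rw [h1, h2, map_neg, map_mul, map_sub, map_mul, Complex.conj_I, Complex.conj_ofReal,
    Complex.conj_ofReal, map_inv₀, map_mul, Complex.conj_ofReal, map_ofNat]
  push_cast
  ring

theorem fourierCoef_eq_charInt {f : Distr} {g : ℝ → ℝ} (h : IsFunction f g)
    (hg : IntervalIntegrable g volume 0 (2 * Real.pi)) (n : ℤ) :
    fourierCoef f n = (2 * Real.pi : ℂ)⁻¹ * charInt g (-n) := by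
  unfold fourierCoef
  congr 1
  rw [h, h, ← intervalIntegral.integral_ofReal, ← intervalIntegral.integral_ofReal,
    ← intervalIntegral.integral_const_mul, ← intervalIntegral.integral_sub]
  · unfold charInt
    refine intervalIntegral.integral_congr fun x _ => ?_
    rw [char_neg_eq]
    change ((g x * Real.cos (n * x) : ℝ) : ℂ) - Complex.I * ((g x * Real.sin (n * x) : ℝ) : ℂ) = _
    push_cast
    ring
  · have h1 := hg.mul_continuousOn (cosTest n).2.1.continuous.continuousOn
    exact ⟨Integrable.ofReal h1.1, Integrable.ofReal h1.2⟩
  · have h1 := hg.mul_continuousOn (sinTest n).2.1.continuous.continuousOn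
    exact IntervalIntegrable.const_mul ⟨Integrable.ofReal h1.1, Integrable.ofReal h1.2⟩ _

theorem IsFunction.rapid_fourierCoef {f : Distr} {g : ℝ → ℝ} (h : IsFunction f g)
    (hg : g ∈ SmoothPeriodic) : Rapid (fourierCoef f) := by
  have h1 : Rapid fun n => charInt g (-n) := (SmoothPeriodic.rapid_charInt hg).mono fun n => by
    rw [charInt_neg, RCLike.norm_conj]
  have h2 := h1.const_mul (2 * Real.pi : ℂ)⁻¹
  have e : fourierCoef f = fun n => (2 * Real.pi : ℂ)⁻¹ * charInt g (-n) :=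
    funext fun n => fourierCoef_eq_charInt h (hg.1.continuous.intervalIntegrable _ _) n
  rwa [e]

theorem continuous_fourierSum {b : ℤ → ℂ} (hr : Rapid b) : Continuous (fourierSum b) :=
  continuous_tsum (fun n => (continuous_char n).const_mul _) hr.summable_norm fun n x => by
    rw [norm_mul, norm_char, mul_one]

theorem isFunction_fourierSum {b : ℤ → ℂ} (hb : ∃ C, ∀ n, ‖b n‖ ≤ C) (hr : Rapid b) :
    IsFunction (ofCoef b hb) fun x => (fourierSum b x).re := by
  intro ψ
  rw [pair_ofCoef]
  obtain ⟨M, hM⟩ := SmoothPeriodic.exists_bound ψ.2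
  have h0 : 0 ≤ M := (abs_nonneg _).trans (hM 0)
  have hψ : Continuous fun x => ((ψ : ℝ → ℝ) x : ℂ) :=
    Complex.continuous_ofReal.comp ψ.2.1.continuous
  have h1 : HasSum (fun n => ∫ x in (0 : ℝ)..2 * Real.pi,
      b n * (((ψ : ℝ → ℝ) x : ℂ) * char n x))
      (∫ x in (0 : ℝ)..2 * Real.pi, fourierSum b x * ((ψ : ℝ → ℝ) x : ℂ)) := by
    refine intervalIntegral.hasSum_integral_of_dominated_convergence (fun n _ => ‖b n‖ * M)
      (fun n => ?_) (fun n => ?_) ?_ ?_ ?_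
    · exact ((hψ.mul (continuous_char n)).const_mul _).aestronglyMeasurable
    · refine Filter.Eventually.of_forall fun x _ => ?_
      rw [norm_mul, norm_mul, norm_char, mul_one, Complex.norm_real]
      gcongr
      exact hM x
    · exact Filter.Eventually.of_forall fun x _ => hr.summable_norm.mul_right M
    · exact intervalIntegrable_const
    · refine Filter.Eventually.of_forall fun x _ => ?_
      have h2 := (hr.summable_char x).hasSum.mul_right ((ψ : ℝ → ℝ) x : ℂ)
      refine h2.congr_fun fun n => ?_
      ring
  simp only [intervalIntegral.integral_const_mul] at h1
  unfold charInt
  rw [h1.tsum_eq]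
  have i1 : IntervalIntegrable (fun x => fourierSum b x * ((ψ : ℝ → ℝ) x : ℂ)) volume 0
    (2 * Real.pi) := ((continuous_fourierSum hr).mul hψ).intervalIntegrable _ _
  have h2 := Complex.reCLM.intervalIntegral_comp_comm i1
  rw [← Complex.reCLM_apply, ← h2]
  refine intervalIntegral.integral_congr fun x _ => ?_
  simp

/-! ### Smooth functions are sums of their Fourier series; Parseval's identity -/

theorem fourier_coe_eq_char {T : ℝ} (hT : T = 2 * Real.pi) (n : ℤ) (x : ℝ) :
    fourier n (x : AddCircle T) = char n x := by
  rw [fourier_coe_apply, hT]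
  unfold char
  congr 1
  have : (Real.pi : ℂ) ≠ 0 := by exact_mod_cast Real.pi_ne_zero
  push_cast
  field_simp

theorem IsFunction.eq_fourierSum {f : Distr} {g : ℝ → ℝ} (h : IsFunction f g)
    (hg : g ∈ SmoothPeriodic) (x : ℝ) : (g x : ℂ) = fourierSum (fourierCoef f) x := by
  have hT : Fact (0 < 2 * Real.pi) := ⟨Real.two_pi_pos⟩
  have hgc : Function.Periodic (fun x => (g x : ℂ)) (2 * Real.pi) := fun x =>
    congrArg Complex.ofReal (hg.2 x)
  have hcont : Continuous fun x => (g x : ℂ) := Complex.continuous_ofReal.comp hg.1.continuous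
  set G : C(AddCircle (2 * Real.pi), ℂ) :=
    ⟨hgc.lift, continuous_coinduced_dom.2 hcont⟩ with hG
  have hGx : ∀ x : ℝ, G (x : AddCircle (2 * Real.pi)) = g x := fun x => hgc.lift_coe x
  have hcoef : ∀ n, fourierCoeff G n = fourierCoef f n := fun n => by
    rw [fourierCoeff_eq_intervalIntegral _ _ 0, zero_add,
      fourierCoef_eq_charInt h (hg.1.continuous.intervalIntegrable _ _)]
    simp only [hGx, fourier_coe_eq_char rfl, smul_eq_mul, charInt, Complex.real_smul]
    push_cast
    rw [one_div]
    congr 1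
    exact intervalIntegral.integral_congr fun x _ => mul_comm _ _
  have hr : Rapid (fourierCoef f) := h.rapid_fourierCoef hg
  have hs : Summable (fourierCoeff G) := by
    rw [funext hcoef]
    exact hr.summable_norm.of_norm
  have := has_pointwise_sum_fourier_series_of_summable hs (x : AddCircle (2 * Real.pi))
  simp only [hcoef, hGx, fourier_coe_eq_char rfl, smul_eq_mul] at this
  exact this.tsum_eq.symm

/-- Parseval; since f is real, the product of the coefficients at k and -k is a squared modulus.
This determines the gauge parameter m from c. -/
theorem HasL2Norm.tsum_fourierCoef {f : Distr} {c : ℝ} (hc : 0 ≤ c) (h : HasL2Norm f c) :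
    ∑' k, fourierCoef f k * fourierCoef f (-k) = (c ^ 2 / (2 * Real.pi) : ℝ) := by
  obtain ⟨g, hg2, hfg, hn⟩ := h
  have hgc : MemLp (fun x => (g x : ℂ)) 2 (volume.restrict (Set.Ioc 0 (2 * Real.pi))) :=
    hg2.ofReal
  have hint : IntervalIntegrable g volume 0 (2 * Real.pi) := by
    rw [intervalIntegrable_iff_integrableOn_Ioc_of_le Real.two_pi_pos.le]
    exact hg2.integrable (by norm_num)
  have key := hasSum_sq_fourierCoeffOn Real.two_pi_pos hgc
  have hcoef : ∀ n, fourierCoeffOn Real.two_pi_pos (fun x => (g x : ℂ)) n = fourierCoef f n := by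
    intro n
    rw [fourierCoeffOn_eq_integral, fourierCoef_eq_charInt hfg hint]
    simp only [fourier_coe_eq_char (sub_zero (2 * Real.pi)), sub_zero, smul_eq_mul, charInt, Complex.real_smul]
    push_cast
    rw [one_div]
    congr 1
    exact intervalIntegral.integral_congr fun x _ => mul_comm _ _
  have hI : ∫ x in (0 : ℝ)..2 * Real.pi, ‖(g x : ℂ)‖ ^ 2 = c ^ 2 := by
    have h1 := hg2.eLpNorm_eq_integral_rpow_norm (by norm_num) (by norm_num)
    rw [hn, ENNReal.ofReal_eq_ofReal_iff hc (by positivity)] at h1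
    rw [h1, intervalIntegral.integral_of_le Real.two_pi_pos.le]
    simp only [ENNReal.toReal_ofNat, Real.rpow_ofNat, Complex.norm_real]
    rw [← Real.rpow_natCast, ← Real.rpow_mul (by positivity)]
    norm_num
  rw [hI, sub_zero, smul_eq_mul] at key
  simp only [hcoef] at key
  have h2 := (Complex.hasSum_ofReal.2 key).tsum_eq
  rw [show c ^ 2 / (2 * Real.pi) = (2 * Real.pi)⁻¹ * c ^ 2 by ring, ← h2]
  refine tsum_congr fun k => ?_
  rw [fourierCoef_neg, Complex.mul_conj, Complex.normSq_eq_norm_sq]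

end MKdV

end

/-! ### A Lipschitz retraction of the data, needed for p = ∞ -/

noncomputable section

namespace MKdV

/-! ### A retraction onto the closure of the finitely supported sequences -/

/-- Soft thresholding. -/
def soft (κ x : ℝ) : ℝ := x - max (-κ) (min κ x)

theorem soft_zero (x : ℝ) : soft 0 x = x := by
  unfold soft
  rw [neg_zero, max_eq_left (min_le_left _ _), sub_zero]

theorem soft_neg {κ : ℝ} (hκ : 0 ≤ κ) (x : ℝ) : soft κ (-x) = -soft κ x := by
  unfold soft
  rcases le_total κ x with h | h <;> rcases le_total (-κ) x with h' | h' <;>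
    grind

theorem abs_soft_le {κ : ℝ} (hκ : 0 ≤ κ) (x : ℝ) : |soft κ x| ≤ max 0 (|x| - κ) := by
  unfold soft
  grind

theorem abs_soft_le_abs {κ : ℝ} (hκ : 0 ≤ κ) (x : ℝ) : |soft κ x| ≤ |x| :=
  (abs_soft_le hκ x).trans (max_le (abs_nonneg x) (by linarith))

/-- Joint continuity in argument and threshold is required because the threshold will itself depend
on the sequence. -/
theorem abs_soft_sub_soft_le (κ μ x y : ℝ) :
    |soft κ x - soft μ y| ≤ 2 * |x - y| + |κ - μ| := by
  have h1 : |max (-κ) (min κ x) - max (-μ) (min μ y)| ≤ max |κ - μ| |x - y| := by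
    refine (abs_max_sub_max_le_max _ _ _ _).trans (max_le ?_ ?_)
    · rw [neg_sub_neg, abs_sub_comm]; exact le_max_left _ _
    · exact abs_min_sub_min_le_max _ _ _ _
  have h2 : max |κ - μ| |x - y| ≤ |κ - μ| + |x - y| :=
    max_le (by linarith [abs_nonneg (x - y)]) (by linarith [abs_nonneg (κ - μ)])
  unfold soft
  calc _ = |(x - y) - (max (-κ) (min κ x) - max (-μ) (min μ y))| := by congr 1; ring
    _ ≤ |x - y| + |max (-κ) (min κ x) - max (-μ) (min μ y)| := abs_sub _ _
    _ ≤ _ := by linarith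

/-- Soft thresholding of the real and imaginary parts. -/
def csoft (κ : ℝ) (z : ℂ) : ℂ := ⟨soft κ z.re, soft κ z.im⟩

theorem csoft_zero (z : ℂ) : csoft 0 z = z := by
  unfold csoft; rw [soft_zero, soft_zero]

theorem csoft_conj {κ : ℝ} (hκ : 0 ≤ κ) (z : ℂ) :
    csoft κ (starRingEnd ℂ z) = starRingEnd ℂ (csoft κ z) := by
  unfold csoft
  refine Complex.ext rfl ?_
  simp only [Complex.conj_im, soft_neg hκ]

theorem norm_csoft_le {κ : ℝ} (hκ : 0 ≤ κ) (z : ℂ) : ‖csoft κ z‖ ≤ ‖z‖ := by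
  rw [Complex.norm_def, Complex.norm_def]
  refine Real.sqrt_le_sqrt ?_
  rw [Complex.normSq_apply, Complex.normSq_apply]
  exact add_le_add (abs_le_iff_mul_self_le.1 (abs_soft_le_abs hκ z.re))
    (abs_le_iff_mul_self_le.1 (abs_soft_le_abs hκ z.im))

theorem norm_csoft_le_max {κ : ℝ} (hκ : 0 ≤ κ) (z : ℂ) :
    ‖csoft κ z‖ ≤ 2 * max 0 (‖z‖ - κ) := by
  refine (Complex.norm_le_abs_re_add_abs_im _).trans ?_
  have h1 := abs_soft_le hκ z.re
  have h2 := abs_soft_le hκ z.im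
  have h3 : max 0 (|z.re| - κ) ≤ max 0 (‖z‖ - κ) :=
    max_le_max le_rfl (by linarith [Complex.abs_re_le_norm z])
  have h4 : max 0 (|z.im| - κ) ≤ max 0 (‖z‖ - κ) :=
    max_le_max le_rfl (by linarith [Complex.abs_im_le_norm z])
  change |soft κ z.re| + |soft κ z.im| ≤ _
  linarith

theorem norm_csoft_sub_csoft_le (κ μ : ℝ) (z w : ℂ) :
    ‖csoft κ z - csoft μ w‖ ≤ 4 * ‖z - w‖ + 2 * |κ - μ| := by
  refine (Complex.norm_le_abs_re_add_abs_im _).trans ?_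
  have h1 := abs_soft_sub_soft_le κ μ z.re w.re
  have h2 := abs_soft_sub_soft_le κ μ z.im w.im
  have h3 := Complex.abs_re_le_norm (z - w)
  have h4 := Complex.abs_im_le_norm (z - w)
  rw [Complex.sub_re] at h3
  rw [Complex.sub_im] at h4
  change |soft κ z.re - soft μ w.re| + |soft κ z.im - soft μ w.im| ≤ _
  linarith

/-- Bounds for `⟨n⟩^s |αₙ|` that hold for all but finitely many `n`. -/
def tailBounds (s : ℝ) (α : ℤ → ℂ) : Set ℝ :=
  {C | 0 ≤ C ∧ ∀ᶠ n in Filter.cofinite, jb n ^ s * ‖α n‖ ≤ C}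

/-- The upper limit of `⟨n⟩^s |αₙ|`. -/
def tailSup (s : ℝ) (α : ℤ → ℂ) : ℝ := sInf (tailBounds s α)

theorem tailSup_nonneg (s : ℝ) (α : ℤ → ℂ) : 0 ≤ tailSup s α :=
  Real.sInf_nonneg fun _ h => h.1

theorem tailSup_le {s C : ℝ} {α : ℤ → ℂ} (h : C ∈ tailBounds s α) : tailSup s α ≤ C :=
  csInf_le ⟨0, fun _ h => h.1⟩ h

theorem eventually_le_of_tailSup_lt {s C : ℝ} {α : ℤ → ℂ} (hne : (tailBounds s α).Nonempty)
    (h : tailSup s α < C) : ∀ᶠ n in Filter.cofinite, jb n ^ s * ‖α n‖ ≤ C := by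
  obtain ⟨D, hD, hDC⟩ := exists_lt_of_csInf_lt hne h
  filter_upwards [hD.2] with n hn using hn.trans hDC.le

/-- The upper limit is 1-Lipschitz in the weighted supremum norm. -/
theorem tailSup_sub_le {s D : ℝ} {α β : ℤ → ℂ} (hne : (tailBounds s β).Nonempty) (hD : 0 ≤ D)
    (h : ∀ n, jb n ^ s * ‖α n - β n‖ ≤ D) : tailSup s α - tailSup s β ≤ D := by
  have h1 : tailSup s α - D ≤ tailSup s β := by
    refine le_csInf hne fun C hC => ?_
    have : tailSup s α ≤ C + D := tailSup_le ⟨by linarith [hC.1], by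
      filter_upwards [hC.2] with n hn
      have hj := Real.rpow_pos_of_pos (jb_pos n) s
      have h2 : ‖α n‖ ≤ ‖β n‖ + ‖α n - β n‖ := by
        have := norm_add_le (β n) (α n - β n)
        rwa [add_sub_cancel] at this
      calc _ ≤ jb n ^ s * (‖β n‖ + ‖α n - β n‖) := by gcongr
        _ ≤ _ := by rw [mul_add]; exact add_le_add hn (h n)⟩
    linarith
  linarith

theorem Rapid.tailSup_eq_zero {α : ℤ → ℂ} (h : Rapid α) (s : ℝ) : tailSup s α = 0 := by
  obtain ⟨m, hm⟩ := exists_nat_ge s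
  have h1 : Filter.Tendsto (fun n => br n ^ m * ‖α n‖) Filter.cofinite (nhds 0) :=
    (h.summable m).tendsto_cofinite_zero
  refine le_antisymm (le_of_forall_pos_le_add fun ε hε => ?_) (tailSup_nonneg s α)
  rw [zero_add]
  refine tailSup_le ⟨hε.le, ?_⟩
  filter_upwards [h1.eventually (ge_mem_nhds hε)] with n hn
  refine le_trans ?_ hn
  have h2 := jb_rpow_le_br_pow hm n
  gcongr

theorem dn_top_le_ofReal {s D : ℝ} (hD : 0 ≤ D) {α : ℤ → ℂ} :
    dn ⊤ s (fun _ => 1) α ≤ ENNReal.ofReal D ↔ ∀ n, jb n ^ s * ‖α n‖ ≤ D := by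
  unfold dn wNorm
  rw [seqNorm_top, iSup_le_iff]
  refine forall_congr' fun n => ?_
  have hj := Real.rpow_pos_of_pos (jb_pos n) s
  beta_reduce
  rw [one_mul, ← ofReal_norm, ← ENNReal.ofReal_mul hj.le, ENNReal.ofReal_le_ofReal_iff hD]

theorem exists_truncation {p : ℝ≥0∞} (hp : 1 ≤ p) (hpt : p ≠ ⊤) {s : ℝ} {α : ℤ → ℂ}
    (hα : dn p s (fun _ => 1) α ≠ ⊤) {ε : ℝ≥0∞} (hε : 0 < ε) :
    ∃ F : Finset ℤ, dn p s (fun _ => 1) (fun n => if n ∈ F then 0 else α n) ≤ ε := by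
  have h0 : 0 < p.toReal := by linarith [toReal_ge_one hp hpt]
  set f : ℤ → ℝ≥0∞ := fun n => (ENNReal.ofReal (1 * jb n ^ s) * ‖α n‖ₑ) ^ p.toReal with hf
  have hsum : ∑' n, f n ≠ ⊤ := by
    intro h
    refine hα ?_
    unfold dn wNorm
    rw [seqNorm_of_ne_top hpt, h, ENNReal.top_rpow_of_pos (by positivity)]
  have h1 := ENNReal.tendsto_tsum_compl_atTop_zero hsum
  obtain ⟨F, hF⟩ := (h1.eventually (ge_mem_nhds (ENNReal.rpow_pos_of_nonneg hε h0.le))).exists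
  refine ⟨F, ?_⟩
  unfold dn wNorm
  rw [seqNorm_of_ne_top hpt]
  have h2 : ∑' n, (ENNReal.ofReal (1 * jb n ^ s) * ‖if n ∈ F then 0 else α n‖ₑ) ^ p.toReal =
      ∑' n : {x // x ∉ F}, f n := by
    rw [show ∑' n : {x // x ∉ F}, f n = ∑' n, Set.indicator {x | x ∉ F} f n from
      tsum_subtype {x | x ∉ F} f]
    refine tsum_congr fun n => ?_
    by_cases hn : n ∈ F
    · simp [hn, h0]
    · simp [hn, hf]
  rw [h2, one_div]
  calc _ ≤ (ε ^ p.toReal) ^ p.toReal⁻¹ := by gcongr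
    _ = ε := ENNReal.rpow_rpow_inv h0.ne' ε

/-- For p < ∞ finitely supported sequences are dense and the identity works. For p = ∞ the weighted
coefficients are soft-thresholded at their upper limit, which makes them tend to zero. The threshold
is 0 for rapidly decreasing sequences, so these are fixed, and it is Lipschitz in the sequence. -/
theorem exists_retraction (s : ℝ) {p : ℝ≥0∞} (hp : 1 ≤ p) :
    ∃ r : (ℤ → ℂ) → ℤ → ℂ, (∀ α n, ‖r α n‖ ≤ ‖α n‖) ∧
      (∀ α, (∀ n, α (-n) = starRingEnd ℂ (α n)) → ∀ n, r α (-n) = starRingEnd ℂ (r α n)) ∧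
      (∀ α, Rapid α → r α = α) ∧
      (∀ α β, dn p s (fun _ => 1) α ≠ ⊤ → dn p s (fun _ => 1) β ≠ ⊤ →
        dn p s (fun _ => 1) (r α - r β) ≤ 6 * dn p s (fun _ => 1) (α - β)) ∧
      ∀ α, dn p s (fun _ => 1) α ≠ ⊤ → ∀ ε : ℝ≥0∞, 0 < ε →
        ∃ F : Finset ℤ, dn p s (fun _ => 1) (fun n => if n ∈ F then 0 else r α n) ≤ ε := by
  by_cases hpt : p = ⊤
  swap
  · refine ⟨id, fun _ _ => le_rfl, fun _ h => h, fun _ _ => rfl, fun α β _ _ => ?_,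
      fun α hα ε hε => exists_truncation hp hpt hα hε⟩
    simp only [id]
    exact le_mul_of_one_le_left' (by norm_num)
  subst hpt
  have hj : ∀ n, 0 < jb n ^ s := fun n => Real.rpow_pos_of_pos (jb_pos n) s
  have hbdd : ∀ {α : ℤ → ℂ}, dn ⊤ s (fun _ => 1) α ≠ ⊤ →
      ∀ n, jb n ^ s * ‖α n‖ ≤ (dn ⊤ s (fun _ => 1) α).toReal := fun h =>
    (dn_top_le_ofReal ENNReal.toReal_nonneg).1 (ENNReal.ofReal_toReal h).ge
  have hne : ∀ {α : ℤ → ℂ}, dn ⊤ s (fun _ => 1) α ≠ ⊤ → (tailBounds s α).Nonempty := fun h =>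
    ⟨_, ENNReal.toReal_nonneg, Filter.Eventually.of_forall (hbdd h)⟩
  have hκ : ∀ α n, 0 ≤ tailSup s α / jb n ^ s := fun α n =>
    div_nonneg (tailSup_nonneg s α) (hj n).le
  refine ⟨fun α n => csoft (tailSup s α / jb n ^ s) (α n), fun α n => norm_csoft_le (hκ α n) _,
    fun α h n => ?_, fun α h => ?_, fun α β hα hβ => ?_, fun α hα ε hε => ?_⟩
  · beta_reduce
    rw [jb_neg, h, csoft_conj (hκ α n)]
  · funext n
    beta_reduce
    rw [h.tailSup_eq_zero, zero_div, csoft_zero]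
  · by_cases hd : dn ⊤ s (fun _ => 1) (α - β) = ⊤
    · rw [hd]; simp
    have h1 := hbdd hd
    set D := (dn ⊤ s (fun _ => 1) (α - β)).toReal with hD
    have hD0 : 0 ≤ D := ENNReal.toReal_nonneg
    have h2 := tailSup_sub_le (hne hβ) hD0 h1
    have h3 := tailSup_sub_le (α := β) (β := α) (hne hα) hD0 fun n => by
      rw [norm_sub_rev]; exact h1 n
    have h4 : |tailSup s α - tailSup s β| ≤ D := abs_le.2 ⟨by linarith, h2⟩
    -- 6 = 4 + 2: dependence of `csoft` on its argument and on the threshold.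
    rw [← ENNReal.ofReal_toReal hd, ← hD, show (6 : ℝ≥0∞) = ENNReal.ofReal 6 by simp,
      ← ENNReal.ofReal_mul (by norm_num), dn_top_le_ofReal (by positivity)]
    intro n
    have h5 := norm_csoft_sub_csoft_le (tailSup s α / jb n ^ s) (tailSup s β / jb n ^ s) (α n) (β n)
    rw [← sub_div, abs_div, abs_of_pos (hj n)] at h5
    calc _ ≤ jb n ^ s * (4 * ‖α n - β n‖ + 2 * (|tailSup s α - tailSup s β| / jb n ^ s)) :=
          mul_le_mul_of_nonneg_left h5 (hj n).le
      _ = 4 * (jb n ^ s * ‖α n - β n‖) + 2 * |tailSup s α - tailSup s β| := by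
          have := (hj n).ne'
          field_simp
      _ ≤ 4 * D + 2 * D := by gcongr; exact h1 n
      _ = 6 * D := by ring
  · by_cases hεt : ε = ⊤
    · exact ⟨∅, by rw [hεt]; exact le_top⟩
    have hε0 : 0 < ε.toReal := ENNReal.toReal_pos hε.ne' hεt
    have h1 := eventually_le_of_tailSup_lt (hne hα)
      (show tailSup s α < tailSup s α + ε.toReal / 2 by linarith)
    refine ⟨(Filter.eventually_cofinite.1 h1).toFinset, ?_⟩
    refine le_of_le_of_eq ((dn_top_le_ofReal hε0.le).2 fun n => ?_) (ENNReal.ofReal_toReal hεt)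
    split_ifs with hn
    · simp
    · rw [Set.Finite.mem_toFinset] at hn
      have h2 : jb n ^ s * ‖α n‖ ≤ tailSup s α + ε.toReal / 2 := not_not.1 hn
      have h3 := norm_csoft_le_max (hκ α n) (α n)
      have h4 : max 0 (‖α n‖ - tailSup s α / jb n ^ s) ≤ ε.toReal / 2 / jb n ^ s := by
        refine max_le (by have := hj n; positivity) ?_
        rw [sub_le_iff_le_add, ← add_div, le_div_iff₀ (hj n)]
        linarith
      calc _ ≤ jb n ^ s * (2 * (ε.toReal / 2 / jb n ^ s)) := by
            refine mul_le_mul_of_nonneg_left (h3.trans ?_) (hj n).le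
            linarith
        _ = _ := by
          have := (hj n).ne'
          field_simp

/-! ### Elements of `FL` and their coefficients -/

section FL

variable {s : ℝ} {p : ℝ≥0∞}

theorem fourierCoef_sub (f g : FL s p) :
    fourierCoef (f - g).toDistr = fourierCoef f.toDistr - fourierCoef g.toDistr := by
  funext n
  have h : (f - g).toDistr = f.toDistr - g.toDistr := rfl
  rw [h]
  simp only [fourierCoef, map_sub, LinearMap.sub_apply, Pi.sub_apply, Complex.ofReal_sub]
  ring

variable [Fact (1 ≤ p)]

theorem dn_fourierCoef (f : FL s p) :
    dn p s (fun _ => 1) (fourierCoef f.toDistr) = ENNReal.ofReal ‖f‖ := by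
  have h : ‖f‖ = ‖FL.toLp s p f‖ := rfl
  rw [h, ofReal_norm, ← seqNorm_enorm]
  unfold dn wNorm
  congr 1
  funext n
  change _ = ‖((jb n ^ s : ℝ) : ℂ) * fourierCoef f.toDistr n‖ₑ
  have hj := Real.rpow_pos_of_pos (jb_pos n) s
  rw [enorm_mul, one_mul, ← ofReal_norm ((jb n ^ s : ℝ) : ℂ), Complex.norm_real,
    Real.norm_of_nonneg hj.le]

theorem dn_sub_fourierCoef (f g : FL s p) :
    dn p s (fun _ => 1) (fourierCoef f.toDistr - fourierCoef g.toDistr) = edist f g := by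
  rw [← fourierCoef_sub, dn_fourierCoef, edist_dist, dist_eq_norm]

theorem exists_of_fourierCoef (hs : 0 ≤ s) {b : ℤ → ℂ}
    (hsymm : ∀ n, b (-n) = starRingEnd ℂ (b n)) (hb : dn p s (fun _ => 1) b ≠ ⊤) :
    ∃ f : FL s p, fourierCoef f.toDistr = b ∧
      (Rapid b → IsFunction f.toDistr fun x => (fourierSum b x).re) := by
  have hp : 1 ≤ p := Fact.out
  have hj := fun n => Real.rpow_pos_of_pos (jb_pos n) s
  have hbd : ∃ C, ∀ n, ‖b n‖ ≤ C := by
    refine ⟨(dn p s (fun _ => 1) b).toReal, fun n => ?_⟩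
    have h1 := le_seqNorm hp (fun n => ENNReal.ofReal (1 * jb n ^ s) * ‖b n‖ₑ) n
    have h2 : ‖b n‖ₑ ≤ ENNReal.ofReal (1 * jb n ^ s) * ‖b n‖ₑ := by
      refine le_mul_of_one_le_left' ?_
      rw [one_mul, ENNReal.one_le_ofReal]
      exact Real.one_le_rpow (one_le_jb n) hs
    have h3 := ENNReal.toReal_mono hb (h2.trans h1)
    rwa [toReal_enorm] at h3
  have hcoef : fourierCoef (ofCoef b hbd) = b := funext (fourierCoef_ofCoef hbd hsymm)
  refine ⟨⟨ofCoef b hbd, ?_⟩, hcoef, isFunction_fourierSum hbd⟩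
  refine memℓp_of_seqNorm_ne_top hp ?_
  refine ne_of_eq_of_ne ?_ hb
  unfold dn wNorm
  congr 1
  funext n
  change ‖((jb n ^ s : ℝ) : ℂ) * fourierCoef (ofCoef b hbd) n‖ₑ = _
  rw [hcoef, enorm_mul, one_mul, ← ofReal_norm ((jb n ^ s : ℝ) : ℂ), Complex.norm_real,
    Real.norm_of_nonneg (hj n).le]

end FL

end MKdV

end

/-! ### Assembling the solution map -/

noncomputable section

namespace MKdV

/-! ### The solution map -/

section flowmap

variable {δ s : ℝ} {p : ℝ≥0∞}

theorem rapid_of_finset (F : Finset ℤ) (α : ℤ → ℂ) : Rapid fun n => if n ∈ F then α n else 0 := by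
  intro k
  refine ⟨∑ n ∈ F, br n ^ k * ‖α n‖, fun n => ?_⟩
  have h0 : ∀ n, 0 ≤ br n ^ k * ‖α n‖ := fun n => by have := br_pos n; positivity
  beta_reduce
  split_ifs with hn
  · exact Finset.single_le_sum (f := fun n => br n ^ k * ‖α n‖) (fun n _ => h0 n) hn
  · rw [norm_zero, mul_zero]
    exact Finset.sum_nonneg fun n _ => h0 n

theorem dn_gauge_sub_le (m : ℝ) (a b : ℤ → Holder δ) (t : ℝ) :
    dn p s (fun _ => 1) (gauge m a t - gauge m b t) ≤ wn p s (fun _ => 1) (a - b) := by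
  refine wNorm_mono fun n => ?_
  have h : (gauge m a t - gauge m b t) n = gauge m (a - b) t n := by
    simp only [gauge, Pi.sub_apply, map_sub, mul_sub]
  rw [h, ← ofReal_norm, ← ofReal_norm]
  exact ENNReal.ofReal_le_ofReal (norm_gauge_le m (a - b) t n)

theorem dn_gauge_le (m : ℝ) (a : ℤ → Holder δ) (t : ℝ) :
    dn p s (fun _ => 1) (gauge m a t) ≤ wn p s (fun _ => 1) a := by
  refine wNorm_mono fun n => ?_
  rw [← ofReal_norm, ← ofReal_norm]
  exact ENNReal.ofReal_le_ofReal (norm_gauge_le m a t n)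

theorem dn_sub_le (hp : 1 ≤ p) (α β γ : ℤ → ℂ) : dn p s (fun _ => 1) (α - γ) ≤
    dn p s (fun _ => 1) (α - β) + dn p s (fun _ => 1) (β - γ) := by
  refine le_trans (wNorm_mono fun n => ?_) (wNorm_add_le hp _ _)
  have : (α - γ) n = (α - β) n + (β - γ) n := by simp
  rw [this]
  exact enorm_add_le _ _

theorem dn_sub_comm (α β : ℤ → ℂ) :
    dn p s (fun _ => 1) (α - β) = dn p s (fun _ => 1) (β - α) := by
  unfold dn
  congr 1
  funext n
  rw [← neg_sub β α, Pi.neg_apply, enorm_neg]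

theorem continuous_gauge (hδ : 0 < δ) (m : ℝ) (a : ℤ → Holder δ) (n : ℤ) :
    Continuous fun t => gauge m a t n := by
  have := Holder.continuous_eval hδ (a n)
  unfold gauge
  fun_prop

/-- Each coefficient is continuous in time, and rapid decay dominates the ℓ^p norm by a uniformly
convergent series. Less regular profiles are reached by approximation. -/
theorem tendsto_dn_gauge (hδ : 0 < δ) (hp : 1 ≤ p) (m : ℝ) {a : ℤ → Holder δ} (ha : Rapid a)
    (t : ℝ) : Filter.Tendsto (fun r => dn p s (fun _ => 1) (gauge m a r - gauge m a t)) (nhds t)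
      (nhds 0) := by
  obtain ⟨k, hk⟩ := exists_nat_ge s
  have hj := fun n => Real.rpow_pos_of_pos (jb_pos n) s
  have hu : Summable fun n => 2 * (br n ^ k * ‖a n‖) := (ha.summable k).mul_left 2
  have hle : ∀ n r, ‖jb n ^ s * ‖gauge m a r n - gauge m a t n‖‖ ≤ 2 * (br n ^ k * ‖a n‖) := by
    intro n r
    have h1 := hj n
    have h2 : ‖gauge m a r n - gauge m a t n‖ ≤ 2 * ‖a n‖ := by
      refine (norm_sub_le _ _).trans ?_
      linarith [norm_gauge_le m a r n, norm_gauge_le m a t n]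
    rw [Real.norm_of_nonneg (by positivity)]
    calc _ ≤ br n ^ k * (2 * ‖a n‖) := by
          have := jb_rpow_le_br_pow hk n
          have := br_pos n
          gcongr
      _ = _ := by ring
  have hc : Continuous fun r => ∑' n, jb n ^ s * ‖gauge m a r n - gauge m a t n‖ :=
    continuous_tsum (fun n => (((continuous_gauge hδ m a n).sub continuous_const).norm).const_mul _)
      hu hle
  have h0 := (ENNReal.continuous_ofReal.comp hc).tendsto t
  simp only [Function.comp_apply, sub_self, norm_zero, mul_zero, tsum_zero,
    ENNReal.ofReal_zero] at h0
  refine tendsto_of_tendsto_of_tendsto_of_le_of_le tendsto_const_nhds h0 (fun _ => zero_le)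
    fun r => ?_
  refine (seqNorm_le_tsum hp _).trans (le_of_eq ?_)
  rw [Function.comp_apply, ENNReal.ofReal_tsum_of_nonneg
    (fun n => mul_nonneg (hj n).le (norm_nonneg _)) (Summable.of_norm_bounded hu fun n => hle n r)]
  refine tsum_congr fun n => ?_
  rw [one_mul, ENNReal.ofReal_mul (hj n).le, ofReal_norm]
  rfl

theorem gauge_neg (m : ℝ) {a : ℤ → Holder δ} {t : ℝ} {n : ℤ}
    (h : Holder.eval t (a (-n)) = starRingEnd ℂ (Holder.eval t (a n))) :
    gauge m a t (-n) = starRingEnd ℂ (gauge m a t n) := by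
  unfold gauge
  rw [h, map_mul, ← Complex.exp_conj, map_mul, Complex.conj_I, Complex.conj_ofReal]
  congr 2
  push_cast
  ring

end flowmap

/-- The extension is the gauged profile of the retracted data. The number c enters only through the
phase, after T has been chosen. -/
theorem exists_solutionMap {s : ℝ} {p p' : ℝ≥0∞} [Fact (1 ≤ p)] (hpp' : p.HolderConjugate p')
    (hs : 1 / 2 ≤ s) (hsp : 1 < p' * ENNReal.ofReal (s + 1 / 4)) {R : ℝ} (hR : 0 < R) :
    ∃ T : ℝ, 0 < T ∧ ∀ c : ℝ, 0 < c →
      ∃ F : FL s p → C(Set.Icc (0 : ℝ) T, FL s p),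
        UniformContinuousOn F (Metric.ball 0 R ∩ {φ | HasL2Norm φ.toDistr c}) ∧
        ∀ φ ∈ Metric.ball (0 : FL s p) R ∩ {φ | HasL2Norm φ.toDistr c},
          ∀ g ∈ SmoothPeriodic, IsFunction φ.toDistr g → IsSolutionMapValue T g (F φ) := by
  have hp : 1 ≤ p := Fact.out
  have hs0 : 0 ≤ s := by linarith
  obtain ⟨δ, hδ, sol, H⟩ := exists_mild_solution hpp' hs hsp hR
  obtain ⟨r, hrle, hrsymm, hrrapid, hrlip, hrtrunc⟩ := exists_retraction s hp
  -- The flow equation holds on the open interval (-δ, δ), whereas [0, T] must be closed.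
  have hT : 0 < δ / 2 := by linarith
  refine ⟨δ / 2, hT, fun c hc => ?_⟩
  set m : ℝ := c ^ 2 / (2 * Real.pi) with hm
  have hball : ∀ {φ : FL s p}, φ ∈ Metric.ball (0 : FL s p) R →
      dn p s (fun _ => 1) (fourierCoef φ.toDistr) < ENNReal.ofReal R := fun hφ => by
    rw [dn_fourierCoef]
    exact (ENNReal.ofReal_lt_ofReal_iff hR).2 (mem_ball_zero_iff.1 hφ)
  have hrball : ∀ {α : ℤ → ℂ}, dn p s (fun _ => 1) α < ENNReal.ofReal R →
      dn p s (fun _ => 1) (r α) < ENNReal.ofReal R := fun h =>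
    (wNorm_mono fun n => by
      rw [← ofReal_norm, ← ofReal_norm]
      exact ENNReal.ofReal_le_ofReal (hrle _ n)).trans_lt h
  have hcurve : ∀ φ : FL s p, φ ∈ Metric.ball (0 : FL s p) R →
      ∃ v : C(Set.Icc (0 : ℝ) (δ / 2), FL s p), ∀ t,
        fourierCoef (v t).toDistr = gauge m (sol (r (fourierCoef φ.toDistr))) t ∧
        (Rapid (gauge m (sol (r (fourierCoef φ.toDistr))) t) → IsFunction (v t).toDistr fun x =>
          (fourierSum (gauge m (sol (r (fourierCoef φ.toDistr))) t) x).re) := by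
    intro φ hφ
    set α := fourierCoef φ.toDistr with hα
    have hαR := hball hφ
    obtain ⟨-, hfin, -, hlip, hreal, -⟩ := H _ (hrball hαR)
    have hreal' := hreal (hrsymm α fun n => fourierCoef_neg _ n)
    have hex : ∀ t : ℝ, ∃ f : FL s p, fourierCoef f.toDistr = gauge m (sol (r α)) t ∧
        (Rapid (gauge m (sol (r α)) t) → IsFunction f.toDistr fun x =>
          (fourierSum (gauge m (sol (r α)) t) x).re) := fun t =>
      exists_of_fourierCoef hs0 (fun n => gauge_neg m (hreal' n t))
        (ne_top_of_le_ne_top hfin (dn_gauge_le m _ t))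
    choose v hv hvf using hex
    have hvc : Continuous v := by
      rw [continuous_iff_continuousAt]
      intro t
      rw [ContinuousAt, tendsto_iff_edist_tendsto_0, ENNReal.tendsto_nhds_zero]
      intro ε hε
      -- Two approximations at 2ε/5 each, the factor 2 being the Lipschitz constant of `sol`, and
      -- ε/5 for continuity of the approximant.
      have hε5 : 0 < ε / 5 := ENNReal.div_pos hε.ne' (by norm_num)
      obtain ⟨F, hF⟩ := hrtrunc α (ne_top_of_lt hαR) (ε / 5) hε5
      set β : ℤ → ℂ := fun n => if n ∈ F then r α n else 0 with hβ
      have hβR : dn p s (fun _ => 1) β < ENNReal.ofReal R := by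
        refine (wNorm_mono fun n => ?_).trans_lt (hrball hαR)
        simp only [hβ]
        split_ifs
        · exact le_rfl
        · rw [enorm_zero]; exact zero_le
      have hd : dn p s (fun _ => 1) (r α - β) ≤ ε / 5 := by
        refine le_trans (le_of_eq ?_) hF
        congr 1
        funext n
        simp only [hβ, Pi.sub_apply]
        split_ifs <;> simp
      have hβr := (H β hβR).2.2.2.2.2 (rapid_of_finset F _)
      have hclose : ∀ q, dn p s (fun _ => 1) (gauge m (sol (r α)) q - gauge m (sol β) q) ≤
          2 * (ε / 5) := fun q =>
        (dn_gauge_sub_le m _ _ q).trans ((hlip β hβR).trans (by gcongr))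
      have hmid := ENNReal.tendsto_nhds_zero.1 (tendsto_dn_gauge (p := p) (s := s) hδ hp m hβr t)
        (ε / 5) hε5
      filter_upwards [hmid] with q hq
      rw [← dn_sub_fourierCoef, hv, hv]
      refine (dn_sub_le hp _ (gauge m (sol β) q) _).trans ?_
      refine (add_le_add (hclose q) (dn_sub_le hp _ (gauge m (sol β) t) _)).trans ?_
      rw [dn_sub_comm (gauge m (sol β) t)]
      refine (add_le_add le_rfl (add_le_add hq (hclose t))).trans (le_of_eq ?_)
      calc _ = 5 * (ε / 5) := by ring
        _ = ε := ENNReal.mul_div_cancel (by norm_num) (by norm_num)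
    exact ⟨⟨fun t => v t, hvc.comp continuous_subtype_val⟩, fun t => ⟨hv t, hvf t⟩⟩
  choose! F hF using hcurve
  refine ⟨F, ?_, ?_⟩
  · have hL : LipschitzOnWith 12 F (Metric.ball 0 R ∩ {φ | HasL2Norm φ.toDistr c}) := by
      refine LipschitzOnWith.of_dist_le_mul fun φ hφ ψ hψ => ?_
      rw [ContinuousMap.dist_le (by positivity)]
      intro t
      have hφR := hball hφ.1
      have hψR := hball hψ.1
      have h1 : edist (F φ t) (F ψ t) ≤ 12 * edist φ ψ := by
        rw [← dn_sub_fourierCoef, ← dn_sub_fourierCoef, (hF φ hφ.1 t).1, (hF ψ hψ.1 t).1]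
        refine (dn_gauge_sub_le m _ _ t).trans
          (((H _ (hrball hφR)).2.2.2.1 _ (hrball hψR)).trans ?_)
        refine (mul_le_mul_right (hrlip _ _ (ne_top_of_lt hφR) (ne_top_of_lt hψR)) 2).trans
          (le_of_eq ?_)
        rw [← mul_assoc]
        norm_num
      rw [edist_dist, edist_dist, show (12 : ℝ≥0∞) = ENNReal.ofReal 12 by simp,
        ← ENNReal.ofReal_mul (by norm_num), ENNReal.ofReal_le_ofReal_iff (by positivity)] at h1
      exact h1
    exact hL.uniformContinuousOn
  · rintro φ ⟨hφ, hL2⟩ g hg hfg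
    set α := fourierCoef φ.toDistr with hα
    have hαr : Rapid α := hfg.rapid_fourierCoef hg
    have hrα : r α = α := hrrapid α hαr
    have hαR := hball hφ
    obtain ⟨hmild, -, hsum, -, hreal, hrap⟩ := H α hαR
    have hreal' := hreal fun n => fourierCoef_neg _ n
    have har := hrap hαr
    have hflow := hmild.isFlow hδ har hsum (m := m) (hL2.tsum_fourierCoef hc.le)
    have hsol := hflow.isSmoothSolution (fun t n => gauge_neg m (hreal' n t)) hT
      (by linarith : δ / 2 < δ)
    have h0 : gauge m (sol α) 0 = α := funext fun n => by
      simp [gauge, hmild.eval_zero hδ hsum n]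
    have hg0 : (fun x => (fourierSum (gauge m (sol α) 0) x).re) = g := funext fun x => by
      rw [h0, ← hfg.eq_fourierSum hg x, Complex.ofReal_re]
    rw [hg0] at hsol
    refine ⟨⟨_, hsol⟩, fun u hu t ψ => ?_⟩
    have hFt := (hF φ hφ t).2
    rw [← hα, hrα] at hFt
    rw [hFt (rapid_gauge m har t) ψ]
    refine intervalIntegral.integral_congr fun x hx => ?_
    rw [Set.uIcc_of_le Real.two_pi_pos.le] at hx
    have := hsol.eq_on_period hT hu t.2 hx
    simp only [this]

end MKdV

end

theorem mainTheorem2 (s : ℝ) (p p' : ℝ≥0∞) [Fact (1 ≤ p)] (hpp' : p.HolderConjugate p')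
    (hs : 1 / 2 ≤ s) (hsp : 1 < p' * ENNReal.ofReal (s + 1 / 4)) :
    ∀ R : ℝ, 0 < R → ∃ T : ℝ, 0 < T ∧ ∀ c : ℝ, 0 < c →
      ∃ F : MKdV.FL s p → C(Set.Icc (0 : ℝ) T, MKdV.FL s p),
        UniformContinuousOn F
          (Metric.ball 0 R ∩ {φ | MKdV.HasL2Norm φ.toDistr c}) ∧
        ∀ φ ∈ Metric.ball (0 : MKdV.FL s p) R ∩ {φ | MKdV.HasL2Norm φ.toDistr c},
          ∀ g ∈ MKdV.SmoothPeriodic, MKdV.IsFunction φ.toDistr g →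
            MKdV.IsSolutionMapValue T g (F φ) :=
  fun _ hR => MKdV.exists_solutionMap hpp' hs hsp hR
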